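/- **Setting.** Let $\{\xi_{ij}\}_{1\le i\le j}$ be independent real random variables such that the $\xi_{ii}$ are identically distributed, the $\xi_{ij}$ with $i<j$ are identically distributed, all moments of $\xi_{11}$ and $\xi_{12}$ are finite, $\mathbb E[\xi_{11}]=\mathbb E[\xi_{12}]=0$ and $\mathbb E[\xi_{12}^2]=1$. Put $\xi_{ji}=\xi_{ij}$ and, for an unordered pair $e=\{i,j\}$ (possibly $i=j$), $\xi_e=\xi_{ij}$. A *word* of length $k+1$ is a sequence $w=(s_1,\dots,s_{k+1})$ of positive integers (letters). Its edge set $E_w$ consists of the unordered pairs $\{s_i,s_{i+1}\}$, $1\le i\le k$, and $N_e^w$ is the number of indices $i$ with $\{s_i,s_{i+1}\}=e$. Let $\mathcal U_k$ be the set of words of length $k+1$ with $s_1=s_{k+1}=1$ and $s_i\ne s_{i+1}$ for all $i$, and let $\mathcal U_k^{(N)}$ be the set of those with all letters in $\{1,\dots,N\}$. Put $$T_w=\prod_{e\in E_w}\xi_e^{N_e^w},\qquad \bar T_w=T_w-\mathbb E[T_w],\qquad Y_{N,k}=\sqrt N\Big(\frac1{N^{k/2}}\sum_{w\in\mathcal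 U_k^{(N)}}(T_w-\mathbb E[T_w])\Big).$$ For a pair $a=(w_1,w_2)$ of words of lengths $k+1$ and $l+1$, let $E_a=E_{w_1}\cup E_{w_2}$, $N_e^a=N_e^{w_1}+N_e^{w_2}$, and let $\mathrm{wt}(a)$ be the number of distinct letters occurring in $w_1$ or $w_2$. The pair is a *CLT pair* if $N_e^a\ge 2$ for all $e\in E_a$, $E_{w_1}\cap E_{w_2}\neq\emptyset$, and $\mathrm{wt}(a)=\frac{(k+1)+(l+1)}2-1=\frac{k+l}2$. Two pairs are *equivalent* if a bijection between their sets of letters maps one to the other. Let $\mathcal U_{k,l}$ be a set of representatives for the equivalence classes of CLT pairs $(w_1,w_2)$ with $w_1\in\mathcal U_k$, $w_2\in\mathcal U_l$ and letters in $\{1,\dots,(k+l)/2\}$ (so $\mathcal U_{k,l}=\emptyset$ if $k+l$ is odd), and put $$A(k,l)=\sum_{(w_1,w_2)\in\mathcal U_{k,l}}\mathbb E[\bar T_{w_1}\bar T_{w_2}],\qquad k,l\ge 2.$$ **Theorem.** The number $\mathbb E[\bar T_{w_1}\bar T_{w_2}]$ depends only on the equivalence class of the CLT pair $(w_1,w_2)$;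 $A(k,l)=0$ whenever $k+l$ is odd; and $A(k,l)$ depends on the law of the family $(\xi_{ij})$ only through the second and fourth moments of $\xi_{12}$. There exists a sequence $(\eta_k)_{k\ge2}$ of jointly Gaussian random variables on one probability space with $\mathbb E[\eta_k]=0$ and $\mathbb E[\eta_k\eta_l]=A(k,l)$ for all $k,l\ge 2$, and for every fixed $K\ge2$ the random vector $(Y_{N,k})_{k=2}^K$ converges in distribution to $(\eta_k)_{k=2}^K$ as $N\to\infty$. -/

import Mathlib

open MeasureTheory ProbabilityTheory Filter

noncomputable section

/-- A word `(s₁, …, s_{k+1})` of length `k + 1` in the positive integers, i.e. a walk with `k`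
steps. -/
abbrev Word (k : ℕ) : Type := Fin (k + 1) → ℕ+

namespace Word

variable {k l : ℕ}

/-- The support of a word: the finite set of letters appearing in it. -/
def supp (w : Word k) : Finset ℕ+ := Finset.univ.image w

/-- The edge (an unordered pair, possibly a self edge) traversed by the `i`-th step. -/
def step (w : Word k) (i : Fin k) : Sym2 ℕ+ := s(w i.castSucc, w i.succ)

/-- The edge set `E_w`. -/
def edges (w : Word k) : Finset (Sym2 ℕ+) := Finset.univ.image w.step

/-- The passage count `N_e^w`: how many steps of `w` traverse `e`, in either direction. -/
def passages (w : Word k) (e : Sym2 ℕ+) : ℕ := (Finset.univ.filter fun i => w.step i = e).card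

/-- Membership in `𝒰`: closed words starting (hence also ending) at `1`, without self edge. -/
def NoSelfEdgeLoop (w : Word k) : Prop :=
  w 0 = 1 ∧ w (Fin.last k) = 1 ∧ ∀ e ∈ w.edges, ¬ e.IsDiag

end Word

/-- The letters `1, …, N`. -/
def letters (N : ℕ) : Finset ℕ+ :=
  (Finset.range N).map ⟨Nat.succPNat, Nat.succPNat_injective⟩

open scoped Classical in
/-- `𝒰_k^{(N)}`: closed words of length `k + 1` starting at `1`, with letters in `{1, …, N}` and
without self edge. -/
def noSelfEdgeWords (N k : ℕ) : Finset (Word k) :=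
  (Fintype.piFinset fun _ : Fin (k + 1) => letters N).filter Word.NoSelfEdgeLoop

/-- The sentence consisting of two words of lengths `k + 1` and `l + 1`. -/
abbrev WordPair (k l : ℕ) : Type := Word k × Word l

namespace WordPair

variable {k l : ℕ}

/-- The support of the sentence `(w₁, w₂)`. -/
def supp (a : WordPair k l) : Finset ℕ+ := a.1.supp ∪ a.2.supp

/-- The weight of the sentence. -/
def wt (a : WordPair k l) : ℕ := a.supp.card

/-- The edge set `E_a` of the sentence. -/
def edges (a : WordPair k l) : Finset (Sym2 ℕ+) := a.1.edges ∪ a.2.edges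

/-- The passage count `N_e^a` of the sentence. -/
def passages (a : WordPair k l) (e : Sym2 ℕ+) : ℕ := a.1.passages e + a.2.passages e

/-- Weak CLT pair: every edge of the sentence is traversed at least twice, and the two words
share an edge. -/
def IsWeakCLT (a : WordPair k l) : Prop :=
  (∀ e ∈ a.edges, 2 ≤ a.passages e) ∧ (a.1.edges ∩ a.2.edges).Nonempty

/-- CLT pair: a weak CLT pair whose weight is `(ℓ(w₁) + ℓ(w₂)) / 2 - 1`, where the words have
lengths `ℓ(w₁) = k + 1` and `ℓ(w₂) = l + 1`. -/
def IsCLT (a : WordPair k l) : Prop :=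
  a.IsWeakCLT ∧ (a.wt : ℚ) = (((k + 1 : ℕ) : ℚ) + ((l + 1 : ℕ) : ℚ)) / 2 - 1

/-- Equivalence of sentences: a bijection between the supports maps one onto the other. -/
def Equivalent (a b : WordPair k l) : Prop :=
  ∃ f : ℕ+ → ℕ+, Set.BijOn f a.supp b.supp ∧ f ∘ a.1 = b.1 ∧ f ∘ a.2 = b.2

lemma fst_mem_supp (a : WordPair k l) (i : Fin (k + 1)) : a.1 i ∈ a.supp := by
  simp [supp, Word.supp]

lemma snd_mem_supp (a : WordPair k l) (i : Fin (l + 1)) : a.2 i ∈ a.supp := by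
  simp [supp, Word.supp]

lemma equivalent_equivalence : Equivalence (Equivalent (k := k) (l := l)) where
  refl a := ⟨id, Set.bijOn_id _, rfl, rfl⟩
  symm := by
    rintro a b ⟨f, hf, h1, h2⟩
    have hinv := hf.invOn_invFunOn
    refine ⟨Function.invFunOn f a.supp, hf.symm hinv.symm, ?_, ?_⟩
    · rw [← h1]
      funext i
      exact hinv.1 (a.fst_mem_supp i)
    · rw [← h2]
      funext i
      exact hinv.1 (a.snd_mem_supp i)
  trans := by
    rintro a b c ⟨f, hf, h1, h2⟩ ⟨g, hg, h3, h4⟩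
    exact ⟨g ∘ f, hg.comp hf, by rw [Function.comp_assoc, h1, h3],
      by rw [Function.comp_assoc, h2, h4]⟩

end WordPair

open scoped Classical in
/-- The CLT pairs `(w₁, w₂)` with `w₁ ∈ 𝒰_k`, `w₂ ∈ 𝒰_l` whose letters lie in
`{1, …, (k + l) / 2}`. For `k + l` odd this is empty, because of the weight condition. -/
def cltPairs (k l : ℕ) : Finset (WordPair k l) :=
  (noSelfEdgeWords ((k + l) / 2) k ×ˢ noSelfEdgeWords ((k + l) / 2) l).filter WordPair.IsCLT

/-- Equivalence of CLT pairs. -/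
def cltSetoid (k l : ℕ) : Setoid {a : WordPair k l // a ∈ cltPairs k l} where
  r a b := WordPair.Equivalent a.1 b.1
  iseqv :=
    ⟨fun a => WordPair.equivalent_equivalence.refl a.1,
      fun h => WordPair.equivalent_equivalence.symm h,
      fun h h' => WordPair.equivalent_equivalence.trans h h'⟩

/-- The finite set of equivalence classes of CLT pairs. -/
abbrev CLTClass (k l : ℕ) : Type := Quotient (cltSetoid k l)

instance instFintypeCLTClass (k l : ℕ) : Fintype (CLTClass k l) := Fintype.ofFinite _

/-- A chosen representative of an equivalence class of CLT pairs. -/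
def CLTClass.rep {k l : ℕ} (q : CLTClass k l) : WordPair k l := (Quotient.out q).1

section Random

variable {Ω : Type*} [MeasurableSpace Ω]

/-- The entries of real Wigner matrices, `ξ s(i, j) = ξ_{ij} = ξ_{ji}` for positive integers
`i, j`: independent real random variables, the diagonal ones identically distributed, the
off-diagonal ones identically distributed, all centered with all moments finite, and the
off-diagonal ones of unit variance. -/
structure IsWignerFamily (ξ : Sym2 ℕ+ → Ω → ℝ) (P : Measure Ω) : Prop where
  measurable : ∀ e, Measurable (ξ e)
  indep : iIndepFun ξ P
  identDistrib_diag : ∀ i : ℕ+, IdentDistrib (ξ s(i, i)) (ξ s(1, 1)) P P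
  identDistrib_offDiag : ∀ i j : ℕ+, i ≠ j → IdentDistrib (ξ s(i, j)) (ξ s(1, 2)) P P
  moments_diag : ∀ p : ℕ, Integrable (fun ω => |ξ s(1, 1) ω| ^ p) P
  moments_offDiag : ∀ p : ℕ, Integrable (fun ω => |ξ s(1, 2) ω| ^ p) P
  mean_diag : ∫ ω, ξ s(1, 1) ω ∂P = 0
  mean_offDiag : ∫ ω, ξ s(1, 2) ω ∂P = 0
  variance_offDiag : ∫ ω, ξ s(1, 2) ω ^ 2 ∂P = 1

/-- `T_w = ∏_{e ∈ E_w} ξ_e ^ {N_e^w}`. -/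
def wordProd (ξ : Sym2 ℕ+ → Ω → ℝ) {k : ℕ} (w : Word k) (ω : Ω) : ℝ :=
  ∏ e ∈ w.edges, ξ e ω ^ w.passages e

/-- `T̄_w = T_w - E[T_w]`. -/
def centeredWordProd (ξ : Sym2 ℕ+ → Ω → ℝ) (P : Measure Ω) {k : ℕ} (w : Word k) (ω : Ω) : ℝ :=
  wordProd ξ w ω - ∫ ω', wordProd ξ w ω' ∂P

/-- `Y_{N,k} = √N (N^{-k/2} ∑_{w ∈ 𝒰_k^{(N)}} (T_w - E[T_w]))`. -/
def Y (ξ : Sym2 ℕ+ → Ω → ℝ) (P : Measure Ω) (N k : ℕ) (ω : Ω) : ℝ :=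
  √(N : ℝ) * (1 / (N : ℝ) ^ ((k : ℝ) / 2) *
    ∑ w ∈ noSelfEdgeWords N k, centeredWordProd ξ P w ω)

/-- `E[T̄_{(w₁, w₂)}]`, where `T̄_{(w₁, w₂)} = T̄_{w₁} T̄_{w₂}`. -/
def pairExpectation (ξ : Sym2 ℕ+ → Ω → ℝ) (P : Measure Ω) {k l : ℕ} (a : WordPair k l) : ℝ :=
  ∫ ω, centeredWordProd ξ P a.1 ω * centeredWordProd ξ P a.2 ω ∂P

/-- `A(k, l)`: the sum of `E[T̄_{(w₁, w₂)}]` over a set of representatives of the equivalence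
classes of CLT pairs. -/
def limitCov (ξ : Sym2 ℕ+ → Ω → ℝ) (P : Measure Ω) (k l : ℕ) : ℝ :=
  ∑ q : CLTClass k l, pairExpectation ξ P q.rep

/-- A centered jointly Gaussian sequence `(η_k)_{k ≥ 2}` with `E[η_k η_l] = C k l`. -/
structure IsCenteredGaussianSeq (η : Set.Ici (2 : ℕ) → Ω → ℝ) (Q : Measure Ω) (C : ℕ → ℕ → ℝ) :
    Prop where
  gaussian : IsGaussianProcess η Q
  mean : ∀ k, ∫ ω, η k ω ∂Q = 0
  cov : ∀ k l, ∫ ω, η k ω * η l ω ∂Q = C k l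

end Random

end

/-! The proof is the method of moments. Expand the expectation of a product of `n` variables
`Y_{N,k_i}` with `L = ∑ k_i`: it is `N^{(n-L)/2}` times a sum, over families of `n` words, of `E[∏
T̄_{w_i}]`. These terms are bounded uniformly in the words. Since the entries are independent and
centered, and the `T̄_w` are centered, a term vanishes unless the family is linked (`IsLinked`):
every edge is passed at least twice in total, and every word shares an edge with another one.
Families with `v` letters number `O(N^{v-1})`, the letter `1` being prescribed, so everything rests
on bounding `v`.

The combinatorial core is that a linked family satisfies `2v + n ≤ L + 2`, strictly if some word
shares edges with two others. Take a spanning tree `T` of the union graph, so `|T| = v - 1`. Each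
tree edge needs two passages; one further passage is charged to each word. A word leaving the tree
pays with a non-tree step. A word staying in the tree crosses each fundamental cut, hence passes
each tree edge, an even number of times, so a tree edge that it shares with another word has
passages to spare. The equality case excludes a word touching two others.

Hence the families where one word touches two others contribute `O(N^{-1/2})`. In every other linked
family the words are matched in pairs that are independent of each other. This gives the asymptotic
Wick formula `IsWignerFamily.tendsto_momentY_sub`: a moment is the sum over the partner `j` of a
fixed index `i₀` of a covariance times the moment of the remaining factors.

For two words the bound reads `wt ≤ (k + l) / 2`, and the CLT pairs are the weak CLT pairs attaining
it. A class of CLT pairs has `(N - 1)(N - 2)⋯(N - wt + 1)` members with letters in `{1, …, N}`,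
which cancels the normalization, so the covariances tend to `A(k, l)`. In a CLT pair the length
exceeds `2|T|` by exactly two, which forces all passage counts into `{0, 1, 2, 4}`; so only the
second and fourth moments of `ξ₁₂` enter.

The moments of linear combinations thus satisfy the Gaussian recursion in the limit. Taylor
expansion of the exponential turns this into convergence of characteristic functions, and Lévy's
theorem concludes. The Gaussian sequence exists because `A` is a limit of covariances, hence
symmetric and positive semidefinite. -/

set_option linter.unusedSectionVars false

noncomputable section

/-! ### Passage counts of closed walks relative to a spanning tree -/

/-- Passage counts `c i e` of closed walks `i` through the edges `e ∈ E` of a connected graph, with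
a spanning tree `T`, and the indicators `χ t` of the fundamental cuts of the tree edges `t`. Every
edge is passed at least twice in total. -/
structure TreeCounts {ε ι : Type*} [Fintype ι] [DecidableEq ε] (c : ι → ε → ℕ) (E T : Finset ε)
    (χ : ε → ε → ZMod 2) : Prop where
  subset : T ⊆ E
  mem_of_ne : ∀ i e, c i e ≠ 0 → e ∈ E
  cut_self : ∀ t ∈ T, χ t t = 1
  cut_tree : ∀ t ∈ T, ∀ t' ∈ T, t' ≠ t → χ t t' = 0
  cross : ∀ f ∈ E, f ∉ T → ∃ t ∈ T, χ t f = 1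
  closed : ∀ i, ∀ t ∈ T, ∑ e ∈ E, (c i e : ZMod 2) * χ t e = 0
  two_le : ∀ e ∈ E, 2 ≤ ∑ i, c i e

namespace TreeCounts

variable {ε ι : Type*} [Fintype ι] [DecidableEq ε] {c : ι → ε → ℕ} {E T : Finset ε}
  {χ : ε → ε → ZMod 2}

/-- The fundamental cut of `t` contains no tree edge except `t`, so the cut equation for a closed
walk involves only `t` and non-tree edges. -/
lemma parity (h : TreeCounts c E T χ) (i : ι) {t : ε} (ht : t ∈ T) :
    (c i t : ZMod 2) + ∑ f ∈ E \ T, (c i f : ZMod 2) * χ t f = 0 := by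
  have h1 := h.closed i t ht
  rw [← Finset.sum_sdiff h.subset, add_comm] at h1
  rw [← h1]
  congr 1
  rw [Finset.sum_eq_single_of_mem t ht]
  · rw [h.cut_self t ht, mul_one]
  · intro t' ht' hne
    rw [h.cut_tree t ht t' ht' hne, mul_zero]

lemma even_of_tree (h : TreeCounts c E T χ) {i : ι} (hi : ∀ f ∈ E \ T, c i f = 0) {t : ε}
    (ht : t ∈ T) : Even (c i t) := by
  have h1 := h.parity i ht
  rw [Finset.sum_eq_zero (fun f hf => by rw [hi f hf]; simp), add_zero] at h1
  exact (ZMod.natCast_eq_zero_iff_even).1 h1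

/-- If the walk `i` passes the non-tree edge `f` once and no other non-tree edge, then the tree
edges are passed an odd number of times exactly if they lie on the fundamental cycle of `f`. -/
lemma cast_eq_cut (h : TreeCounts c E T χ) {i : ι} {f : ε} (hf : f ∈ E \ T) (h1 : c i f = 1)
    (h0 : ∀ g ∈ E \ T, g ≠ f → c i g = 0) {t : ε} (ht : t ∈ T) : (c i t : ZMod 2) = χ t f := by
  have hp := h.parity i ht
  rw [Finset.sum_eq_single_of_mem f hf (fun g hg hne => by rw [h0 g hg hne]; simp), h1,
    Nat.cast_one, one_mul] at hp
  have : (c i t : ZMod 2) = - χ t f := eq_neg_of_add_eq_zero_left hp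
  rw [this]
  exact ZMod.neg_eq_self_mod_two _

open scoped Classical in
/-- The walks passing `e`. -/
def through (c : ι → ε → ℕ) (e : ε) : Finset ι := Finset.univ.filter fun i => c i e ≠ 0

open scoped Classical in
/-- The walks staying in the tree. -/
def treeWalks (c : ι → ε → ℕ) (E T : Finset ε) : Finset ι :=
  Finset.univ.filter fun i => ∀ f ∈ E \ T, c i f = 0

open scoped Classical in
-- Every walk through `t` contributes at least one passage, and a walk confined to the tree at least
-- two, by parity.
lemma card_through_add_le (h : TreeCounts c E T χ) {t : ε} (ht : t ∈ T) :
    (treeWalks c E T ∩ through c t).card + (through c t).card ≤ ∑ i, c i t := by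
  have e1 : (treeWalks c E T ∩ through c t).card
      = ∑ i : ι, if i ∈ treeWalks c E T ∩ through c t then 1 else 0 := by
    rw [Finset.sum_ite_mem]; simp
  have e2 : (through c t).card = ∑ i : ι, if i ∈ through c t then 1 else 0 := by
    rw [Finset.sum_ite_mem]; simp
  rw [e1, e2, ← Finset.sum_add_distrib]
  refine Finset.sum_le_sum fun i _ => ?_
  by_cases hi : i ∈ through c t
  · have hne : c i t ≠ 0 := by simpa [through] using hi
    by_cases hA : i ∈ treeWalks c E T
    · have hev : Even (c i t) := h.even_of_tree (by simpa [treeWalks] using hA) ht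
      obtain ⟨m, hm⟩ := hev
      simp only [Finset.mem_inter, hA, hi, and_self, if_true]
      omega
    · simp only [Finset.mem_inter, hA, hi, false_and, if_true, if_false]
      omega
  · simp [hi]

open scoped Classical in
/-- The tree edges passed by at least two walks. -/
def sharedTree (c : ι → ε → ℕ) (T : Finset ε) : Finset ε :=
  T.filter fun t => 2 ≤ (through c t).card

open scoped Classical in
-- Two or more walks through `t` already supply the two compulsory passages, so the second passage
-- of each tree walk is surplus.
lemma tree_term_le (h : TreeCounts c E T χ) {t : ε} (ht : t ∈ T) :
    2 + (if t ∈ sharedTree c T then (treeWalks c E T ∩ through c t).card else 0)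
      ≤ ∑ i, c i t := by
  split_ifs with hs
  · have := h.card_through_add_le ht
    have h2 : 2 ≤ (through c t).card := (Finset.mem_filter.1 hs).2
    omega
  · simpa using h.two_le t (h.subset ht)

open scoped Classical in
lemma sum_shared (c : ι → ε → ℕ) (E T : Finset ε) :
    ∑ t ∈ T, (if t ∈ sharedTree c T then (treeWalks c E T ∩ through c t).card else 0)
      = ∑ i ∈ treeWalks c E T, ((sharedTree c T).filter fun t => c i t ≠ 0).card := by
  rw [Finset.sum_ite_mem,
    Finset.inter_eq_right.2 (show sharedTree c T ⊆ T from Finset.filter_subset _ _)]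
  simp_rw [Finset.card_eq_sum_ones, Finset.sum_filter]
  rw [Finset.sum_comm]
  refine Finset.sum_congr rfl fun t _ => ?_
  rw [← Finset.sum_filter]
  refine Finset.sum_congr ?_ fun _ _ => rfl
  ext i
  simp [through]

lemma through_two {i j : ι} (hij : j ≠ i) {e : ε} (hi : c i e ≠ 0) (hj : c j e ≠ 0) :
    2 ≤ (through c e).card := by
  classical
  have : ({i, j} : Finset ι) ⊆ through c e := by
    intro x hx
    simp only [Finset.mem_insert, Finset.mem_singleton] at hx
    rcases hx with rfl | rfl <;> simpa [through]
  have h2 := Finset.card_le_card this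
  rwa [Finset.card_pair hij.symm] at h2

lemma through_three {i j k : ι} (hij : j ≠ i) (hik : k ≠ i) (hjk : j ≠ k) {e : ε} (hi : c i e ≠ 0)
    (hj : c j e ≠ 0) (hk : c k e ≠ 0) : 3 ≤ (through c e).card := by
  classical
  have : ({i, j, k} : Finset ι) ⊆ through c e := by
    intro x hx
    simp only [Finset.mem_insert, Finset.mem_singleton] at hx
    rcases hx with rfl | rfl | rfl <;> simpa [through]
  have h2 := Finset.card_le_card this
  rwa [Finset.card_eq_three.2 ⟨i, j, k, hij.symm, hik.symm, hjk, rfl⟩] at h2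

open scoped Classical in
-- An edge that a tree walk shares with another walk is a tree edge. This is where a tree walk
-- collects the extra passage charged to it.
lemma one_le_shared (h : TreeCounts c E T χ)
    (hs : ∀ i, ∃ j, j ≠ i ∧ ∃ e, c i e ≠ 0 ∧ c j e ≠ 0) {i : ι} (hi : i ∈ treeWalks c E T) :
    1 ≤ ((sharedTree c T).filter fun t => c i t ≠ 0).card := by
  obtain ⟨j, hj, e, h1, h2⟩ := hs i
  have hi' : ∀ f ∈ E \ T, c i f = 0 := by simpa [treeWalks] using hi
  have heT : e ∈ T := by
    by_contra hT
    exact h1 (hi' e (Finset.mem_sdiff.2 ⟨h.mem_of_ne i e h1, hT⟩))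
  refine Finset.card_pos.2 ⟨e, Finset.mem_filter.2 ⟨Finset.mem_filter.2 ⟨heT, ?_⟩, h1⟩⟩
  exact through_two hj h1 h2

open scoped Classical in
lemma one_le_nontree {i : ι} (hi : i ∉ treeWalks c E T) : 1 ≤ ∑ f ∈ E \ T, c i f := by
  by_contra hlt
  have h0 : ∑ f ∈ E \ T, c i f = 0 := by omega
  exact hi (by simpa [treeWalks] using (Finset.sum_eq_zero_iff.1 h0))

lemma total (h : TreeCounts c E T χ) :
    ∑ e ∈ E, ∑ i, c i e = ∑ t ∈ T, ∑ i, c i t + ∑ i, ∑ f ∈ E \ T, c i f := by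
  rw [← Finset.sum_sdiff h.subset, add_comm, Finset.sum_comm (s := E \ T)]

open scoped Classical in
/-- The excess of the total passage count over twice the number of tree edges is at least the
number of walks, when every walk shares an edge with another one. -/
theorem two_mul_card_add_card_le (h : TreeCounts c E T χ)
    (hs : ∀ i, ∃ j, j ≠ i ∧ ∃ e, c i e ≠ 0 ∧ c j e ≠ 0) :
    2 * T.card + Fintype.card ι ≤ ∑ e ∈ E, ∑ i, c i e := by
  have hA : (treeWalks c E T).card
      ≤ ∑ i ∈ treeWalks c E T, ((sharedTree c T).filter fun t => c i t ≠ 0).card := by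
    rw [Finset.card_eq_sum_ones]
    exact Finset.sum_le_sum fun i hi => h.one_le_shared hs hi
  have hB : (treeWalks c E T)ᶜ.card ≤ ∑ i, ∑ f ∈ E \ T, c i f := by
    rw [Finset.card_eq_sum_ones]
    refine (Finset.sum_le_sum fun i hi => one_le_nontree (Finset.mem_compl.1 hi)).trans ?_
    exact Finset.sum_le_univ_sum_of_nonneg fun _ => Nat.zero_le _
  have hT := Finset.sum_le_sum fun t ht => h.tree_term_le (t := t) ht
  rw [Finset.sum_add_distrib, sum_shared] at hT
  simp only [Finset.sum_const, smul_eq_mul] at hT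
  have := Finset.card_add_card_compl (treeWalks c E T)
  rw [h.total]
  omega

open scoped Classical in
/-- The excess is strictly larger than the number of walks if some walk shares edges with two
others. -/
theorem two_mul_card_add_card_lt (h : TreeCounts c E T χ)
    (hs : ∀ i, ∃ j, j ≠ i ∧ ∃ e, c i e ≠ 0 ∧ c j e ≠ 0) {i₀ j₁ j₂ : ι} (h1 : j₁ ≠ i₀)
    (h2 : j₂ ≠ i₀) (h12 : j₁ ≠ j₂) (he1 : ∃ e, c i₀ e ≠ 0 ∧ c j₁ e ≠ 0)
    (he2 : ∃ e, c i₀ e ≠ 0 ∧ c j₂ e ≠ 0) :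
    2 * T.card + Fintype.card ι < ∑ e ∈ E, ∑ i, c i e := by
  by_contra hcon
  have hA1 := fun i (hi : i ∈ treeWalks c E T) => h.one_le_shared hs hi
  have hA : (treeWalks c E T).card
      ≤ ∑ i ∈ treeWalks c E T, ((sharedTree c T).filter fun t => c i t ≠ 0).card := by
    rw [Finset.card_eq_sum_ones]
    exact Finset.sum_le_sum hA1
  have hB1 := fun i (hi : i ∈ (treeWalks c E T)ᶜ) =>
    one_le_nontree (c := c) (E := E) (T := T) (Finset.mem_compl.1 hi)
  have hB : (treeWalks c E T)ᶜ.card ≤ ∑ i ∈ (treeWalks c E T)ᶜ, ∑ f ∈ E \ T, c i f := by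
    rw [Finset.card_eq_sum_ones]
    exact Finset.sum_le_sum hB1
  have hB2 : ∑ i ∈ (treeWalks c E T)ᶜ, ∑ f ∈ E \ T, c i f ≤ ∑ i, ∑ f ∈ E \ T, c i f :=
    Finset.sum_le_univ_sum_of_nonneg fun _ => Nat.zero_le _
  have hT1 := fun t ht => h.tree_term_le (t := t) ht
  have hT := Finset.sum_le_sum hT1
  have hTs : ∑ t ∈ T, (2 + if t ∈ sharedTree c T then (treeWalks c E T ∩ through c t).card else 0)
      = 2 * T.card + ∑ i ∈ treeWalks c E T, ((sharedTree c T).filter fun t => c i t ≠ 0).card := by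
    rw [Finset.sum_add_distrib, sum_shared]
    simp [mul_comm]
  have hcard := Finset.card_add_card_compl (treeWalks c E T)
  rw [h.total] at hcon
  -- Without strict inequality all three estimates are tight, hence tight term by term: on each tree
  -- edge, for each walk leaving the tree (exactly one non-tree passage), and for each tree walk
  -- (exactly one shared tree edge).
  have eT := (Finset.sum_eq_sum_iff_of_le hT1).1 (by omega)
  have eB := (Finset.sum_eq_sum_iff_of_le hB1).1
    (by rw [← Finset.card_eq_sum_ones]; omega)
  have eA := (Finset.sum_eq_sum_iff_of_le hA1).1
    (by rw [← Finset.card_eq_sum_ones]; omega)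
  clear hA hB hB2 hT hTs hcard hcon
  -- Tightness at `t` together with `card_through_add_le` leaves room for only two walks.
  have key : ∀ t ∈ sharedTree c T, (through c t).card = 2 := by
    intro t ht
    have htT : t ∈ T := (Finset.mem_filter.1 ht).1
    have h3 := eT t htT
    rw [if_pos ht] at h3
    have h4 := h.card_through_add_le htT
    have h5 : 2 ≤ (through c t).card := (Finset.mem_filter.1 ht).2
    omega
  obtain ⟨e1, he1i, he1j⟩ := he1
  obtain ⟨e2, he2i, he2j⟩ := he2
  by_cases hi0 : i₀ ∈ treeWalks c E T
  · have hi' : ∀ f ∈ E \ T, c i₀ f = 0 := by simpa [treeWalks] using hi0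
    have hmem : ∀ e, c i₀ e ≠ 0 → e ∈ T := fun e he => by
      by_contra hT
      exact he (hi' e (Finset.mem_sdiff.2 ⟨h.mem_of_ne _ e he, hT⟩))
    -- A tree walk has only one shared tree edge, so `e1 = e2`; but then three walks pass it.
    have m1 : e1 ∈ sharedTree c T :=
      Finset.mem_filter.2 ⟨hmem e1 he1i, through_two h1 he1i he1j⟩
    have m2 : e2 ∈ sharedTree c T :=
      Finset.mem_filter.2 ⟨hmem e2 he2i, through_two h2 he2i he2j⟩
    by_cases hee : e1 = e2
    · subst hee
      have h3 := through_three h1 h2 h12 he1i he1j he2j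
      have := key e1 m1
      omega
    · have h3 := eA i₀ hi0
      obtain ⟨x, hx⟩ := Finset.card_eq_one.1 h3.symm
      have x1 : e1 ∈ ({x} : Finset ε) := hx ▸ Finset.mem_filter.2 ⟨m1, he1i⟩
      have x2 : e2 ∈ ({x} : Finset ε) := hx ▸ Finset.mem_filter.2 ⟨m2, he2i⟩
      rw [Finset.mem_singleton] at x1 x2
      exact hee (x1.trans x2.symm)
  · have uniq : ∀ i f, f ∈ E \ T → c i f ≠ 0 →
        c i f = 1 ∧ ∀ g ∈ E \ T, g ≠ f → c i g = 0 := by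
      intro i f hf hne
      have hi : i ∈ (treeWalks c E T)ᶜ := by
        rw [Finset.mem_compl]
        intro hi
        have hi' : ∀ f ∈ E \ T, c i f = 0 := by simpa [treeWalks] using hi
        exact hne (hi' f hf)
      have h3 := eB i hi
      rw [← Finset.add_sum_erase _ _ hf] at h3
      have h4 : ∑ g ∈ (E \ T).erase f, c i g = 0 := by omega
      refine ⟨by omega, fun g hg hgf => ?_⟩
      exact Finset.sum_eq_zero_iff.1 h4 g (Finset.mem_erase.2 ⟨hgf, hg⟩)
    obtain ⟨f, hf, hfne⟩ : ∃ f ∈ E \ T, c i₀ f ≠ 0 := by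
      by_contra hno
      push Not at hno
      exact hi0 (by simpa [treeWalks] using hno)
    obtain ⟨hf1, hf0⟩ := uniq i₀ f hf hfne
    obtain ⟨k, hk, hkf⟩ : ∃ k, k ≠ i₀ ∧ c k f ≠ 0 := by
      by_contra hno
      push Not at hno
      have h3 := h.two_le f (Finset.mem_sdiff.1 hf).1
      rw [Finset.sum_eq_single_of_mem i₀ (Finset.mem_univ _) (fun b _ hb => hno b hb)] at h3
      omega
    obtain ⟨hk1, hk0⟩ := uniq k f hf hkf
    obtain ⟨t, ht, htf⟩ := h.cross f (Finset.mem_sdiff.1 hf).1 (Finset.mem_sdiff.1 hf).2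
    -- The edge `t` lies on the fundamental cycle of `f`. A walk through `f` has `f` as its only
    -- non-tree passage, so it passes `t` an odd number of times; since only two walks pass `t`,
    -- only `i₀` and `k` pass `f`.
    have odd : ∀ i, c i f ≠ 0 → c i t ≠ 0 := by
      intro i hi h0
      obtain ⟨hi1, hi0⟩ := uniq i f hf hi
      have := h.cast_eq_cut hf hi1 hi0 ht
      rw [h0, htf] at this
      exact absurd this (by decide)
    have only : ∀ i, i ≠ i₀ → i ≠ k → c i f = 0 := by
      intro i hi hik
      by_contra hne
      have h3 := through_three hi hk hik (odd i₀ hfne) (odd i hne) (odd k hkf)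
      have h4 := key t (Finset.mem_filter.2 ⟨ht, through_two hk (odd i₀ hfne) (odd k hkf)⟩)
      omega
    obtain ⟨j, hj, hjk, e, hei, hej⟩ : ∃ j, j ≠ i₀ ∧ j ≠ k ∧ ∃ e, c i₀ e ≠ 0 ∧ c j e ≠ 0 := by
      by_cases hjk : j₁ = k
      · exact ⟨j₂, h2, fun hh => h12 (hjk.trans hh.symm), e2, he2i, he2j⟩
      · exact ⟨j₁, h1, hjk, e1, he1i, he1j⟩
    have hef : e ≠ f := by
      rintro rfl
      exact hej (only j hj hjk)
    have heT : e ∈ T := by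
      by_contra hT
      exact hei (hf0 e (Finset.mem_sdiff.2 ⟨h.mem_of_ne _ e hei, hT⟩) hef)
    have hsh : e ∈ sharedTree c T := Finset.mem_filter.2 ⟨heT, through_two hj hei hej⟩
    have hke : c k e = 0 := by
      by_contra hne
      have h3 := through_three hj hk hjk hei hej hne
      have := key e hsh
      omega
    -- Both `i₀` and `k` leave the tree only through `f`, so their parities agree on every tree
    -- edge, and `k` misses `e`.
    have hev : Even (c i₀ e) := by
      rw [← ZMod.natCast_eq_zero_iff_even, h.cast_eq_cut hf hf1 hf0 heT,
        ← h.cast_eq_cut hf hk1 hk0 heT, hke, Nat.cast_zero]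
    have hN := eT e heT
    rw [if_pos hsh] at hN
    have hset : through c e = {i₀, j} := by
      symm
      refine Finset.eq_of_subset_of_card_le ?_ ?_
      · intro x hx
        simp only [Finset.mem_insert, Finset.mem_singleton] at hx
        rcases hx with rfl | rfl <;> simpa [through]
      · rw [key e hsh, Finset.card_pair hj.symm]
    have hNle : c i₀ e + c j e ≤ ∑ i, c i e := by
      rw [← Finset.sum_pair hj.symm (f := fun i => c i e)]
      exact Finset.sum_le_univ_sum_of_nonneg fun _ => Nat.zero_le _
    obtain ⟨m, hm⟩ := hev
    -- Tightness at `e` allows two passages plus one for each tree walk through it. The walk `i₀`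
    -- uses two and is no tree walk; `j` needs at least one more, and at least two if it is a tree
    -- walk. Either way the total is too large.
    by_cases hjA : j ∈ treeWalks c E T
    · obtain ⟨m', hm'⟩ := h.even_of_tree (i := j) (by simpa [treeWalks] using hjA) heT
      have h6 : (treeWalks c E T ∩ through c e).card ≤ 1 := by
        rw [hset]
        refine (Finset.card_le_card (t := {j}) ?_).trans (by simp)
        intro x hx
        simp only [Finset.mem_inter, Finset.mem_insert, Finset.mem_singleton] at hx ⊢
        rcases hx with ⟨hxA, rfl | rfl⟩
        · exact absurd hxA hi0
        · rfl
      omega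
    · have h6 : treeWalks c E T ∩ through c e = ∅ := by
        rw [hset]
        ext x
        simp only [Finset.mem_inter, Finset.mem_insert, Finset.mem_singleton, Finset.notMem_empty,
          iff_false, not_and, not_or]
        intro hx
        exact ⟨fun h' => hi0 (h' ▸ hx), fun h' => hjA (h' ▸ hx)⟩
      rw [h6, Finset.card_empty] at hN
      omega

/-- If the excess is two, then every walk passes each edge `0`, `1`, `2` or `4` times. -/
theorem passages_of_excess_two (h : TreeCounts c E T χ)
    (heq : ∑ e ∈ E, ∑ i, c i e = 2 * T.card + 2) (i : ι) (e : ε) :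
    c i e ≤ 2 ∨ c i e = 4 := by
  by_cases he : c i e = 0
  · omega
  have heE := h.mem_of_ne i e he
  have hle : c i e ≤ ∑ j, c j e :=
    Finset.single_le_sum (f := fun j => c j e) (fun _ _ => Nat.zero_le _) (Finset.mem_univ i)
  by_cases hET : E \ T = ∅
  · have heT : e ∈ T := by
      by_contra hT
      have : e ∈ E \ T := Finset.mem_sdiff.2 ⟨heE, hT⟩
      rw [hET] at this
      exact absurd this (Finset.notMem_empty e)
    obtain ⟨m, hm⟩ := h.even_of_tree (i := i) (by simp [hET]) heT
    have hEq : E = T := (Finset.sdiff_eq_empty_iff_subset.1 hET).antisymm h.subset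
    rw [hEq, ← Finset.add_sum_erase _ _ heT] at heq
    have h3 : 2 * (T.erase e).card ≤ ∑ t ∈ T.erase e, ∑ j, c j t := by
      rw [mul_comm, ← smul_eq_mul, ← Finset.sum_const]
      exact Finset.sum_le_sum fun t ht => h.two_le t (h.subset (Finset.mem_of_mem_erase ht))
    have h4 := Finset.card_erase_add_one heT
    omega
  · obtain ⟨f, hf⟩ := Finset.nonempty_iff_ne_empty.2 hET
    left
    by_contra hgt
    -- A non-tree edge `f` uses up the surplus: `T` and `f`, passed twice each, already give `2 *
    -- T.card + 2`.
    have hsub : insert f T ⊆ E := by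
      intro x hx
      rcases Finset.mem_insert.1 hx with rfl | hx
      · exact (Finset.mem_sdiff.1 hf).1
      · exact h.subset hx
    have hlt : ∑ t ∈ insert f T, 2 < ∑ e ∈ E, ∑ i, c i e := by
      by_cases hmem : e ∈ insert f T
      · refine lt_of_lt_of_le (Finset.sum_lt_sum (fun t ht => h.two_le t (hsub ht))
          ⟨e, hmem, ?_⟩) (Finset.sum_le_sum_of_subset hsub)
        omega
      · have h5 : insert e (insert f T) ⊆ E := by
          intro x hx
          rcases Finset.mem_insert.1 hx with rfl | hx
          · exact heE
          · exact hsub hx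
        refine lt_of_lt_of_le ?_ (Finset.sum_le_sum_of_subset h5)
        rw [Finset.sum_insert hmem]
        have := Finset.sum_le_sum fun t ht => h.two_le t (hsub ht)
        omega
    rw [Finset.sum_const, Finset.card_insert_of_notMem (Finset.mem_sdiff.1 hf).2, smul_eq_mul,
      heq] at hlt
    omega

end TreeCounts

/-! ### Closed words and rooted trees of letters -/

namespace Word

variable {k : ℕ}

lemma step_mem_edges (w : Word k) (i : Fin k) : w.step i ∈ w.edges :=
  Finset.mem_image_of_mem _ (Finset.mem_univ i)

lemma mem_supp (w : Word k) (i : Fin (k + 1)) : w i ∈ w.supp :=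
  Finset.mem_image_of_mem _ (Finset.mem_univ i)

lemma passages_ne_zero (w : Word k) (e : Sym2 ℕ+) : w.passages e ≠ 0 ↔ e ∈ w.edges := by
  rw [passages, Finset.card_ne_zero, Finset.filter_nonempty_iff]
  simp [edges]

lemma sum_passages_mul {R : Type*} [CommSemiring R] (w : Word k) {E : Finset (Sym2 ℕ+)}
    (hE : w.edges ⊆ E) (g : Sym2 ℕ+ → R) :
    ∑ e ∈ E, (w.passages e : R) * g e = ∑ i, g (w.step i) := by
  simp_rw [passages, Finset.card_filter, Nat.cast_sum, Finset.sum_mul]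
  rw [Finset.sum_comm]
  refine Finset.sum_congr rfl fun i _ => ?_
  rw [Finset.sum_eq_single_of_mem (w.step i) (hE (w.step_mem_edges i))]
  · simp
  · intro e _ hne
    simp [hne.symm]

lemma sum_passages (w : Word k) {E : Finset (Sym2 ℕ+)} (hE : w.edges ⊆ E) :
    ∑ e ∈ E, w.passages e = k := by
  simpa using w.sum_passages_mul hE (fun _ => (1 : ℕ))

/-- Telescoping modulo 2. With `a` the indicator of one side of a cut, it says that a closed walk
crosses the cut an even number of times. -/
lemma sum_add_eq_zero (w : Word k) (h : w 0 = w (Fin.last k)) (a : ℕ+ → ZMod 2) :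
    ∑ i : Fin k, (a (w i.castSucc) + a (w i.succ)) = 0 := by
  have h1 := Fin.sum_univ_castSucc fun i => a (w i)
  have h2 := Fin.sum_univ_succ fun i => a (w i)
  rw [h1, ← h] at h2
  have h3 : ∑ i : Fin k, a (w i.castSucc) = ∑ i : Fin k, a (w i.succ) := by
    have h4 := h2.trans (add_comm _ _)
    exact add_right_cancel h4
  rw [Finset.sum_add_distrib, h3]
  exact CharTwo.add_self_eq_zero _

end Word

/-- A rooted tree on the vertices `V` with root `1`, given by parents `p` and depths `d`. -/
structure LetterTree (V : Finset ℕ+) (p : ℕ+ → ℕ+) (d : ℕ+ → ℕ) : Prop where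
  root : 1 ∈ V
  parent_mem : ∀ v ∈ V, v ≠ 1 → p v ∈ V
  depth_lt : ∀ v ∈ V, v ≠ 1 → d (p v) < d v

namespace LetterTree

variable {V : Finset ℕ+} {p : ℕ+ → ℕ+} {d : ℕ+ → ℕ}

/-- `v` is an ancestor of `u`, or `v = u`. -/
def Anc (p : ℕ+ → ℕ+) (v u : ℕ+) : Prop := ∃ n, (fun x => if x = 1 then 1 else p x)^[n] u = v

lemma anc_self (p : ℕ+ → ℕ+) (v : ℕ+) : Anc p v v := ⟨0, rfl⟩

lemma anc_iff {v u : ℕ+} (hu : u ≠ 1) : Anc p v u ↔ u = v ∨ Anc p v (p u) := by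
  constructor
  · rintro ⟨n, hn⟩
    cases n with
    | zero => exact Or.inl hn
    | succ n =>
      right
      rw [Function.iterate_succ_apply, if_neg hu] at hn
      exact ⟨n, hn⟩
  · rintro (rfl | ⟨n, hn⟩)
    · exact anc_self p u
    · exact ⟨n + 1, by rw [Function.iterate_succ_apply, if_neg hu]; exact hn⟩

lemma not_anc_one {v : ℕ+} (hv : v ≠ 1) : ¬ Anc p v 1 := by
  rintro ⟨n, hn⟩
  rw [Function.iterate_fixed (by simp)] at hn
  exact hv hn.symm

lemma eq_or_depth_lt (h : LetterTree V p d) {v u : ℕ+} (hv : v ≠ 1) (hu : u ∈ V)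
    (ha : Anc p v u) : u = v ∨ d v < d u := by
  obtain ⟨n, hn⟩ := ha
  induction n generalizing u with
  | zero => exact Or.inl hn
  | succ n ih =>
    right
    rw [Function.iterate_succ_apply] at hn
    by_cases hu1 : u = 1
    · subst hu1
      rw [if_pos rfl, Function.iterate_fixed (by simp)] at hn
      exact absurd hn.symm hv
    · rw [if_neg hu1] at hn
      have hlt := h.depth_lt u hu hu1
      rcases ih (h.parent_mem u hu hu1) hn with h' | h'
      · rwa [← h']
      · omega

/-- The edge from `v` to its parent. -/
def edge (p : ℕ+ → ℕ+) (v : ℕ+) : Sym2 ℕ+ := s(p v, v)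

/-- Two distinct vertices with the same parent edge would be each other's parent, against the strict
decrease of depth. -/
lemma edge_injOn (h : LetterTree V p d) : Set.InjOn (edge p) (V.erase 1 : Finset ℕ+) := by
  intro v hv u hu huv
  rw [Finset.mem_coe, Finset.mem_erase] at hv hu
  rw [edge, edge, Sym2.eq_iff] at huv
  rcases huv with ⟨_, h2⟩ | ⟨h1, h2⟩
  · exact h2
  · have h3 := h.depth_lt v hv.2 hv.1
    have h4 := h.depth_lt u hu.2 hu.1
    rw [h1] at h3
    rw [← h2] at h4
    omega

open scoped Classical in
/-- The indicator of the edges with exactly one endpoint below `v`. -/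
def cut (p : ℕ+ → ℕ+) (v : ℕ+) : Sym2 ℕ+ → ZMod 2 :=
  Sym2.lift ⟨fun x y => (if Anc p v x then 1 else 0) + (if Anc p v y then 1 else 0),
    fun _ _ => add_comm _ _⟩

open scoped Classical in
lemma cut_mk (v x y : ℕ+) :
    cut p v s(x, y) = (if Anc p v x then 1 else 0) + (if Anc p v y then 1 else 0) := rfl

lemma cut_edge_self (h : LetterTree V p d) {v : ℕ+} (hv : v ∈ V) (hv1 : v ≠ 1) :
    cut p v (edge p v) = 1 := by
  have hn : ¬ Anc p v (p v) := by
    intro ha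
    have h1 := h.depth_lt v hv hv1
    rcases h.eq_or_depth_lt hv1 (h.parent_mem v hv hv1) ha with h2 | h2
    · rw [h2] at h1
      omega
    · omega
  rw [edge, cut_mk, if_neg hn, if_pos (anc_self p v), zero_add]

/-- For `u ≠ v`, the vertex `u` is below `v` exactly when its parent is. -/
lemma cut_edge_of_ne {v u : ℕ+} (hu1 : u ≠ 1) (huv : u ≠ v) : cut p v (edge p u) = 0 := by
  have h1 : Anc p v u ↔ Anc p v (p u) := by rw [anc_iff hu1, or_iff_right huv]
  rw [edge, cut_mk]
  by_cases ha : Anc p v u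
  · rw [if_pos (h1.1 ha), if_pos ha]
    exact CharTwo.add_self_eq_zero _
  · rw [if_neg (fun h => ha (h1.2 h)), if_neg ha, add_zero]

/-- The subtree below the deeper endpoint does not contain the other endpoint. Only vertices other
than the root give cuts, so if one endpoint is `1`, the other one is used. -/
lemma exists_cut (h : LetterTree V p d) {a b : ℕ+} (ha : a ∈ V) (hb : b ∈ V) (hab : a ≠ b) :
    ∃ v ∈ V.erase 1, cut p v s(a, b) = 1 := by
  have key : ∀ {a b : ℕ+}, a ∈ V → b ∈ V → a ≠ b → d b ≤ d a → a ≠ 1 →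
      ∃ v ∈ V.erase 1, cut p v s(a, b) = 1 := by
    intro a b ha hb hab hle ha1
    refine ⟨a, Finset.mem_erase.2 ⟨ha1, ha⟩, ?_⟩
    have hn : ¬ Anc p a b := by
      intro hanc
      rcases h.eq_or_depth_lt ha1 hb hanc with h2 | h2
      · exact hab h2.symm
      · omega
    rw [cut_mk, if_pos (anc_self p a), if_neg hn, add_zero]
  have root : ∀ {a : ℕ+}, a ∈ V → a ≠ 1 → ∃ v ∈ V.erase 1, cut p v s(a, 1) = 1 := by
    intro a ha ha1
    refine ⟨a, Finset.mem_erase.2 ⟨ha1, ha⟩, ?_⟩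
    rw [cut_mk, if_pos (anc_self p a), if_neg (not_anc_one ha1), add_zero]
  by_cases ha1 : a = 1
  · subst ha1
    rw [Sym2.eq_swap]
    exact root hb hab.symm
  by_cases hb1 : b = 1
  · subst hb1
    exact root ha ha1
  rcases le_total (d b) (d a) with hle | hle
  · exact key ha hb hab hle ha1
  · rw [Sym2.eq_swap]
    exact key hb ha hab.symm hle hb1

end LetterTree

/-! ### The bound on the number of letters of a linked family -/

section Families

variable {ι : Type*} [Fintype ι]

/-- The letters of a family of words. -/
def familySupp (W : ι → Σ k, Word k) : Finset ℕ+ := Finset.univ.biUnion fun i => (W i).2.supp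

/-- The edges of a family of words. -/
def familyEdges (W : ι → Σ k, Word k) : Finset (Sym2 ℕ+) :=
  Finset.univ.biUnion fun i => (W i).2.edges

lemma edges_subset_familyEdges (W : ι → Σ k, Word k) (i : ι) : (W i).2.edges ⊆ familyEdges W :=
  Finset.subset_biUnion_of_mem (fun i => (W i).2.edges) (Finset.mem_univ i)

lemma mem_familySupp (W : ι → Σ k, Word k) (i : ι) (j : Fin ((W i).1 + 1)) :
    (W i).2 j ∈ familySupp W :=
  Finset.mem_biUnion.2 ⟨i, Finset.mem_univ i, (W i).2.mem_supp j⟩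

/-- The first position at which a letter appears in a family of words. -/
def firstPosition (W : ι → Σ k, Word k) (v : ℕ+) : ℕ :=
  sInf {m | ∃ i, ∃ j : Fin ((W i).1 + 1), (W i).2 j = v ∧ (j : ℕ) = m}

/-- The letter just before the earliest occurrence of `v` itself first occurs earlier. So the first
position serves as depth, and connectedness of the union graph needs no separate argument. -/
lemma exists_parent (W : ι → Σ k, Word k) (hW : ∀ i, (W i).2 0 = 1) {v : ℕ+}
    (hv : v ∈ familySupp W) (hv1 : v ≠ 1) :
    ∃ u ∈ familySupp W, firstPosition W u < firstPosition W v ∧ s(u, v) ∈ familyEdges W := by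
  obtain ⟨i, _, hi⟩ := Finset.mem_biUnion.1 hv
  obtain ⟨j, _, hj⟩ := Finset.mem_image.1 hi
  obtain ⟨i, j, hj, hjv⟩ := Nat.sInf_mem
    (s := {m | ∃ i, ∃ j : Fin ((W i).1 + 1), (W i).2 j = v ∧ (j : ℕ) = m}) ⟨j, i, j, hj, rfl⟩
  have hj0 : j ≠ 0 := by
    rintro rfl
    exact hv1 (hj.symm.trans (hW i))
  obtain ⟨m, rfl⟩ := Fin.exists_succ_eq.2 hj0
  refine ⟨(W i).2 m.castSucc, mem_familySupp W i _, ?_, ?_⟩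
  · have h1 : firstPosition W ((W i).2 m.castSucc) ≤ (m : ℕ) :=
      Nat.sInf_le ⟨i, m.castSucc, rfl, rfl⟩
    have h2 : ((m.succ : Fin _) : ℕ) = firstPosition W v := hjv
    rw [Fin.val_succ] at h2
    omega
  · refine edges_subset_familyEdges W i ?_
    rw [← hj]
    exact (W i).2.step_mem_edges m

lemma exists_treeCounts [Nonempty ι] (W : ι → Σ k, Word k) (hW : ∀ i, (W i).2.NoSelfEdgeLoop)
    (h2 : ∀ e ∈ familyEdges W, 2 ≤ ∑ i, (W i).2.passages e) :
    ∃ T χ, T.card + 1 = (familySupp W).card ∧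
      TreeCounts (fun i e => (W i).2.passages e) (familyEdges W) T χ := by
  classical
  have hpar : ∀ v, ∃ u, v ∈ familySupp W → v ≠ 1 → u ∈ familySupp W ∧
      firstPosition W u < firstPosition W v ∧ s(u, v) ∈ familyEdges W := by
    intro v
    by_cases hv : v ∈ familySupp W ∧ v ≠ 1
    · obtain ⟨u, hu⟩ := exists_parent W (fun i => (hW i).1) hv.1 hv.2
      exact ⟨u, fun _ _ => hu⟩
    · exact ⟨1, fun h h' => absurd ⟨h, h'⟩ hv⟩
  choose p hp using hpar
  have hroot : 1 ∈ familySupp W := by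
    have := mem_familySupp W (Classical.arbitrary ι) 0
    rwa [(hW _).1] at this
  have hT : LetterTree (familySupp W) p (firstPosition W) :=
    ⟨hroot, fun v hv hv1 => (hp v hv hv1).1, fun v hv hv1 => (hp v hv hv1).2.1⟩
  have hinv := hT.edge_injOn.leftInvOn_invFunOn
  -- The lower endpoint of a tree edge, needed to index the fundamental cuts by edges rather than
  -- vertices.
  set ch := Function.invFunOn (LetterTree.edge p) ((familySupp W).erase 1 : Finset ℕ+)
  refine ⟨((familySupp W).erase 1).image (LetterTree.edge p),
    fun t => LetterTree.cut p (ch t), ?_, ?_, ?_, ?_, ?_, ?_, ?_, h2⟩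
  · rw [Finset.card_image_of_injOn hT.edge_injOn, Finset.card_erase_add_one hroot]
  · intro e he
    obtain ⟨v, hv, rfl⟩ := Finset.mem_image.1 he
    rw [Finset.mem_erase] at hv
    exact (hp v hv.2 hv.1).2.2
  · intro i e he
    exact edges_subset_familyEdges W i (((W i).2.passages_ne_zero e).1 he)
  · intro t ht
    obtain ⟨v, hv, rfl⟩ := Finset.mem_image.1 ht
    rw [hinv hv]
    rw [Finset.mem_erase] at hv
    exact hT.cut_edge_self hv.2 hv.1
  · intro t ht t' ht' hne
    obtain ⟨v, hv, rfl⟩ := Finset.mem_image.1 ht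
    obtain ⟨u, hu, rfl⟩ := Finset.mem_image.1 ht'
    rw [hinv hv]
    rw [Finset.mem_erase] at hu
    exact LetterTree.cut_edge_of_ne hu.1 (fun h => hne (by rw [h]))
  · intro f hf _
    obtain ⟨i, _, hi⟩ := Finset.mem_biUnion.1 hf
    have hdiag := (hW i).2.2 f hi
    obtain ⟨m, _, rfl⟩ := Finset.mem_image.1 hi
    obtain ⟨v, hv, hcut⟩ := hT.exists_cut (mem_familySupp W i m.castSucc)
      (mem_familySupp W i m.succ) (fun h => hdiag (Sym2.mk_isDiag_iff.2 h))
    refine ⟨LetterTree.edge p v, Finset.mem_image_of_mem _ hv, ?_⟩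
    rw [hinv hv]
    exact hcut
  · intro i t _
    rw [(W i).2.sum_passages_mul (edges_subset_familyEdges W i)]
    exact (W i).2.sum_add_eq_zero ((hW i).1.trans (hW i).2.1.symm)
      (fun x => if LetterTree.Anc p (ch t) x then 1 else 0)

lemma sum_sum_passages (W : ι → Σ k, Word k) :
    ∑ e ∈ familyEdges W, ∑ i, (W i).2.passages e = ∑ i, (W i).1 := by
  rw [Finset.sum_comm]
  exact Finset.sum_congr rfl fun i _ => (W i).2.sum_passages (edges_subset_familyEdges W i)

/-- Every edge of the family is passed at least twice, and every word shares an edge with another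
one. -/
structure IsLinked (W : ι → Σ k, Word k) : Prop where
  two_le : ∀ e ∈ familyEdges W, 2 ≤ ∑ i, (W i).2.passages e
  shared : ∀ i, ∃ j, j ≠ i ∧ ∃ e, e ∈ (W i).2.edges ∧ e ∈ (W j).2.edges

/-- The tree has one edge fewer than there are letters, and the passages sum to the total length.
With normalization `N^{(n-L)/2}`, linked families therefore contribute `O(1)`. -/
theorem IsLinked.two_mul_card_supp_le [Nonempty ι] {W : ι → Σ k, Word k} (h : IsLinked W)
    (hW : ∀ i, (W i).2.NoSelfEdgeLoop) :
    2 * (familySupp W).card + Fintype.card ι ≤ ∑ i, (W i).1 + 2 := by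
  obtain ⟨T, χ, hT, hc⟩ := exists_treeCounts W hW h.two_le
  have := hc.two_mul_card_add_card_le (by simpa only [Word.passages_ne_zero] using h.shared)
  rw [sum_sum_passages] at this
  omega

/-- The strict inequality saves a factor `N^{-1/2}`, which makes non-pairwise linkings negligible.
-/
theorem IsLinked.two_mul_card_supp_lt [Nonempty ι] {W : ι → Σ k, Word k} (h : IsLinked W)
    (hW : ∀ i, (W i).2.NoSelfEdgeLoop) {i₀ j₁ j₂ : ι} (h1 : j₁ ≠ i₀) (h2 : j₂ ≠ i₀) (h12 : j₁ ≠ j₂)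
    (he1 : ∃ e, e ∈ (W i₀).2.edges ∧ e ∈ (W j₁).2.edges)
    (he2 : ∃ e, e ∈ (W i₀).2.edges ∧ e ∈ (W j₂).2.edges) :
    2 * (familySupp W).card + Fintype.card ι < ∑ i, (W i).1 + 2 := by
  obtain ⟨T, χ, hT, hc⟩ := exists_treeCounts W hW h.two_le
  have := hc.two_mul_card_add_card_lt (by simpa only [Word.passages_ne_zero] using h.shared)
    h1 h2 h12 (by simpa only [Word.passages_ne_zero] using he1)
    (by simpa only [Word.passages_ne_zero] using he2)
  rw [sum_sum_passages] at this
  omega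

end Families

/-! ### Weights and passage counts of CLT pairs -/

namespace WordPair

variable {k l : ℕ}

/-- The two words of a sentence as a family. -/
def family (a : WordPair k l) : Fin 2 → Σ k, Word k := ![⟨k, a.1⟩, ⟨l, a.2⟩]

lemma familySupp_family (a : WordPair k l) : familySupp a.family = a.supp := by
  ext v
  simp [familySupp, family, Fin.exists_fin_two, supp]

lemma familyEdges_family (a : WordPair k l) : familyEdges a.family = a.edges := by
  ext v
  simp [familyEdges, family, Fin.exists_fin_two, edges]

lemma sum_passages_family (a : WordPair k l) (e : Sym2 ℕ+) :
    ∑ i, (a.family i).2.passages e = a.passages e := by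
  simp [Fin.sum_univ_two, family, passages]

lemma IsWeakCLT.isLinked {a : WordPair k l} (h : a.IsWeakCLT) : IsLinked a.family := by
  obtain ⟨e, he⟩ := h.2
  rw [Finset.mem_inter] at he
  refine ⟨?_, ?_⟩
  · intro e he
    rw [familyEdges_family] at he
    rw [sum_passages_family]
    exact h.1 e he
  · refine Fin.forall_fin_two.2 ⟨⟨1, by simp, e, he.1, he.2⟩, ⟨0, by simp, e, he.2, he.1⟩⟩

lemma noSelfEdge_family {a : WordPair k l} (h1 : a.1.NoSelfEdgeLoop) (h2 : a.2.NoSelfEdgeLoop) :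
    ∀ i, (a.family i).2.NoSelfEdgeLoop :=
  Fin.forall_fin_two.2 ⟨h1, h2⟩

/-- The weight of a weak CLT pair is at most `(k + l) / 2`. -/
theorem IsWeakCLT.two_mul_wt_le {a : WordPair k l} (h : a.IsWeakCLT) (h1 : a.1.NoSelfEdgeLoop)
    (h2 : a.2.NoSelfEdgeLoop) : 2 * a.wt ≤ k + l := by
  have := h.isLinked.two_mul_card_supp_le (noSelfEdge_family h1 h2)
  rw [familySupp_family] at this
  simp only [Fintype.card_fin, family, Fin.sum_univ_two, Matrix.cons_val_zero,
    Matrix.cons_val_one] at this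
  rw [wt]
  omega

lemma two_mul_wt_eq_iff {a : WordPair k l} :
    (a.wt : ℚ) = (((k + 1 : ℕ) : ℚ) + ((l + 1 : ℕ) : ℚ)) / 2 - 1 ↔ 2 * a.wt = k + l := by
  rw [← Nat.cast_inj (R := ℚ)]
  push_cast
  constructor <;> intro h <;> linarith

/-- In a CLT pair, each word passes each edge `0`, `1`, `2` or `4` times, and all edges of the
pair are passed twice or four times in total. -/
theorem IsCLT.passages {a : WordPair k l} (h : a.IsCLT) (h1 : a.1.NoSelfEdgeLoop)
    (h2 : a.2.NoSelfEdgeLoop) (e : Sym2 ℕ+) :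
    (a.1.passages e ≤ 2 ∨ a.1.passages e = 4) ∧ (a.2.passages e ≤ 2 ∨ a.2.passages e = 4) ∧
      (a.passages e ≤ 2 ∨ a.passages e = 4) := by
  obtain ⟨T, χ, hT, hc⟩ := exists_treeCounts a.family (noSelfEdge_family h1 h2)
    h.1.isLinked.two_le
  have hwt := two_mul_wt_eq_iff.1 h.2
  have heq : ∑ e ∈ familyEdges a.family, ∑ i, (a.family i).2.passages e = 2 * T.card + 2 := by
    rw [sum_sum_passages]
    rw [familySupp_family] at hT
    simp only [family, Fin.sum_univ_two, Matrix.cons_val_zero, Matrix.cons_val_one]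
    rw [wt] at hwt
    omega
  refine ⟨hc.passages_of_excess_two heq 0 e, hc.passages_of_excess_two heq 1 e, ?_⟩
  -- The cut equations are additive, so the two words together count as one closed walk with the
  -- same tree and the same surplus.
  have hc' : TreeCounts (fun (_ : Unit) e => a.passages e) (familyEdges a.family) T χ := by
    refine ⟨hc.subset, ?_, hc.cut_self, hc.cut_tree, hc.cross, ?_, ?_⟩
    · intro _ e he
      rw [familyEdges_family, edges, Finset.mem_union, ← Word.passages_ne_zero,
        ← Word.passages_ne_zero]
      simp only [WordPair.passages] at he
      omega
    · intro _ t ht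
      have c1 := hc.closed 0 t ht
      have c2 := hc.closed 1 t ht
      simp only [WordPair.passages, Nat.cast_add, add_mul, Finset.sum_add_distrib]
      exact (congrArg₂ (· + ·) c1 c2).trans (add_zero _)
    · intro e he
      rw [Fintype.sum_unique]
      rw [← sum_passages_family]
      exact hc.two_le e he
  refine hc'.passages_of_excess_two ?_ () e
  simp only [Fintype.sum_unique]
  simp_rw [← sum_passages_family]
  exact heq

end WordPair

/-! ### Moments of word products, uniformly in the word -/

/-- A real random variable with all moments finite. -/
def HasAllMoments {Ω : Type*} [MeasurableSpace Ω] (f : Ω → ℝ) (P : Measure Ω) : Prop :=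
  ∀ p : ENNReal, p ≠ ⊤ → MemLp f p P

namespace HasAllMoments

variable {Ω : Type*} [MeasurableSpace Ω] {P : Measure Ω} {f g : Ω → ℝ}

lemma mul (hf : HasAllMoments f P) (hg : HasAllMoments g P) :
    HasAllMoments (fun ω => f ω * g ω) P := by
  intro p hp
  have h2 : 2 * p ≠ ⊤ := ENNReal.mul_ne_top (by simp) hp
  have : ENNReal.HolderTriple (2 * p) (2 * p) p := by
    constructor
    rw [ENNReal.mul_inv (by simp) (by simp), ← add_mul, ENNReal.inv_two_add_inv_two, one_mul]
  exact (hg _ h2).mul' (hf _ h2)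

lemma add (hf : HasAllMoments f P) (hg : HasAllMoments g P) :
    HasAllMoments (fun ω => f ω + g ω) P := fun p hp => (hf p hp).add (hg p hp)

lemma const [IsFiniteMeasure P] (c : ℝ) : HasAllMoments (fun _ => c) P :=
  fun _ _ => memLp_const c

lemma sub_const [IsFiniteMeasure P] (hf : HasAllMoments f P) (c : ℝ) :
    HasAllMoments (fun ω => f ω - c) P := fun p hp => (hf p hp).sub (memLp_const c)

lemma const_mul (hf : HasAllMoments f P) (c : ℝ) : HasAllMoments (fun ω => c * f ω) P :=
  fun p hp => (hf p hp).const_mul c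

lemma sum {ι : Type*} (s : Finset ι) {F : ι → Ω → ℝ} (h : ∀ i ∈ s, HasAllMoments (F i) P) :
    HasAllMoments (fun ω => ∑ i ∈ s, F i ω) P :=
  fun p hp => memLp_finsetSum s fun i hi => h i hi p hp

lemma prod [IsFiniteMeasure P] {ι : Type*} (s : Finset ι) {F : ι → Ω → ℝ}
    (h : ∀ i ∈ s, HasAllMoments (F i) P) : HasAllMoments (fun ω => ∏ i ∈ s, F i ω) P := by
  classical
  induction s using Finset.induction_on with
  | empty => simpa using const (P := P) 1
  | insert i s hi ih =>
    simp only [Finset.prod_insert hi]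
    exact (h i (Finset.mem_insert_self i s)).mul
      (ih fun j hj => h j (Finset.mem_insert_of_mem hj))

lemma pow [IsFiniteMeasure P] (hf : HasAllMoments f P) (n : ℕ) :
    HasAllMoments (fun ω => f ω ^ n) P := by
  simpa using prod (P := P) (Finset.range n) fun _ _ => hf

lemma abs (hf : HasAllMoments f P) : HasAllMoments (fun ω => |f ω|) P :=
  fun p hp => (hf p hp).abs

lemma integrable (hf : HasAllMoments f P) : Integrable f P :=
  memLp_one_iff_integrable.1 (hf 1 (by simp))

end HasAllMoments

/-- Every factor is at most the largest one; the summand `1` covers the empty product. -/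
lemma Finset.prod_le_one_add_sum_pow {ι : Type*} (s : Finset ι) {a : ι → ℝ}
    (ha : ∀ i ∈ s, 0 ≤ a i) : ∏ i ∈ s, a i ≤ 1 + ∑ i ∈ s, a i ^ s.card := by
  rcases s.eq_empty_or_nonempty with rfl | hs
  · simp
  obtain ⟨j, hj, hmax⟩ := s.exists_max_image a hs
  have h1 : ∏ i ∈ s, a i ≤ a j ^ s.card := by
    rw [← Finset.prod_const]
    exact Finset.prod_le_prod ha hmax
  have h2 : a j ^ s.card ≤ ∑ i ∈ s, a i ^ s.card :=
    Finset.single_le_sum (f := fun i => a i ^ s.card)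
      (fun i hi => pow_nonneg (ha i hi) _) hj
  linarith

section Wigner

variable {Ω : Type*} [MeasurableSpace Ω] {P : Measure Ω} {ξ : Sym2 ℕ+ → Ω → ℝ}

lemma hasAllMoments_of_integrable_abs_pow [IsFiniteMeasure P] {f : Ω → ℝ} (hf : Measurable f)
    (h : ∀ p : ℕ, Integrable (fun ω => |f ω| ^ p) P) : HasAllMoments f P := by
  intro p hp
  obtain ⟨n, hn⟩ := ENNReal.exists_nat_gt hp
  have hn0 : (n : ENNReal) ≠ 0 := hn.pos.ne'
  have h1 : MemLp f n P := by
    rw [← integrable_norm_rpow_iff hf.aestronglyMeasurable hn0 (by simp)]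
    simpa using h n
  exact h1.mono_exponent hn.le

namespace IsWignerFamily

lemma hasAllMoments [IsFiniteMeasure P] (hξ : IsWignerFamily ξ P) (e : Sym2 ℕ+) :
    HasAllMoments (ξ e) P := by
  intro p hp
  induction e using Sym2.ind with
  | _ i j =>
    by_cases hij : i = j
    · subst hij
      exact (hξ.identDistrib_diag i).memLp_iff.2
        (hasAllMoments_of_integrable_abs_pow (hξ.measurable _) hξ.moments_diag p hp)
    · exact (hξ.identDistrib_offDiag i j hij).memLp_iff.2
        (hasAllMoments_of_integrable_abs_pow (hξ.measurable _) hξ.moments_offDiag p hp)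

lemma integral_comp_eq (hξ : IsWignerFamily ξ P) {e : Sym2 ℕ+} (he : ¬ e.IsDiag) {g : ℝ → ℝ}
    (hg : Measurable g) : ∫ ω, g (ξ e ω) ∂P = ∫ ω, g (ξ s(1, 2) ω) ∂P := by
  induction e using Sym2.ind with
  | _ i j => exact ((hξ.identDistrib_offDiag i j (by simpa using he)).comp hg).integral_eq

/-- The moments of an edge product. -/
lemma integral_prod_pow (hξ : IsWignerFamily ξ P) (S : Finset (Sym2 ℕ+))
    (hS : ∀ e ∈ S, ¬ e.IsDiag) (n : Sym2 ℕ+ → ℕ) :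
    ∫ ω, ∏ e ∈ S, ξ e ω ^ n e ∂P = ∏ e ∈ S, ∫ ω, ξ s(1, 2) ω ^ n e ∂P := by
  have hind : iIndepFun (fun (e : S) => ξ e) P := hξ.indep.precomp Subtype.val_injective
  have h1 := hind.integral_fun_prod_comp (f := fun (e : S) (x : ℝ) => x ^ n e)
    (fun e => (hξ.measurable e).aemeasurable)
    (fun e => (measurable_id.pow_const _).aestronglyMeasurable)
  have h2 : ∀ ω, ∏ e ∈ S, ξ e ω ^ n e = ∏ e : S, ξ e ω ^ n e := fun ω =>
    (Finset.prod_coe_sort S fun e => ξ e ω ^ n e).symm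
  simp_rw [h2]
  rw [h1, ← Finset.prod_coe_sort S fun e => ∫ ω, ξ s(1, 2) ω ^ n e ∂P]
  exact Finset.prod_congr rfl fun e _ =>
    hξ.integral_comp_eq (hS e e.2) (measurable_id.pow_const (n e))

end IsWignerFamily

lemma wordProd_eq_prod_subset {k : ℕ} (w : Word k) {E : Finset (Sym2 ℕ+)} (hE : w.edges ⊆ E)
    (ω : Ω) : wordProd ξ w ω = ∏ e ∈ E, ξ e ω ^ w.passages e := by
  refine Finset.prod_subset hE fun e _ he => ?_
  rw [← Word.passages_ne_zero, not_not] at he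
  rw [he, pow_zero]

lemma wordProd_eq_prod_step {k : ℕ} (w : Word k) (ω : Ω) :
    wordProd ξ w ω = ∏ i, ξ (w.step i) ω := by
  rw [Finset.prod_comp (fun e => ξ e ω) w.step]
  rfl

namespace IsWignerFamily

lemma hasAllMoments_wordProd [IsFiniteMeasure P] (hξ : IsWignerFamily ξ P) {k : ℕ} (w : Word k) :
    HasAllMoments (wordProd ξ w) P :=
  HasAllMoments.prod _ fun e _ => (hξ.hasAllMoments e).pow _

lemma hasAllMoments_centered [IsFiniteMeasure P] (hξ : IsWignerFamily ξ P) {k : ℕ} (w : Word k) :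
    HasAllMoments (centeredWordProd ξ P w) P :=
  (hξ.hasAllMoments_wordProd w).sub_const _

lemma integral_centered [IsProbabilityMeasure P] (hξ : IsWignerFamily ξ P) {k : ℕ} (w : Word k) :
    ∫ ω, centeredWordProd ξ P w ω ∂P = 0 := by
  simp only [centeredWordProd]
  rw [integral_sub (hξ.hasAllMoments_wordProd w).integrable (integrable_const _)]
  simp

lemma integral_wordProd (hξ : IsWignerFamily ξ P) {k : ℕ} {w : Word k} (hw : w.NoSelfEdgeLoop) :
    ∫ ω, wordProd ξ w ω ∂P = ∏ e ∈ w.edges, ∫ ω, ξ s(1, 2) ω ^ w.passages e ∂P :=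
  hξ.integral_prod_pow _ hw.2.2 _

lemma integral_wordProd_mul (hξ : IsWignerFamily ξ P) {k l : ℕ} {a : WordPair k l}
    (h1 : a.1.NoSelfEdgeLoop) (h2 : a.2.NoSelfEdgeLoop) :
    ∫ ω, wordProd ξ a.1 ω * wordProd ξ a.2 ω ∂P
      = ∏ e ∈ a.edges, ∫ ω, ξ s(1, 2) ω ^ a.passages e ∂P := by
  rw [← hξ.integral_prod_pow]
  · refine integral_congr_ae (ae_of_all _ fun ω => ?_)
    simp only
    rw [wordProd_eq_prod_subset a.1 (E := a.edges) Finset.subset_union_left,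
      wordProd_eq_prod_subset a.2 (E := a.edges) Finset.subset_union_right,
      ← Finset.prod_mul_distrib]
    simp_rw [WordPair.passages, pow_add]
  · intro e he
    rcases Finset.mem_union.1 he with h | h
    · exact h1.2.2 e h
    · exact h2.2.2 e h

lemma pairExpectation_eq [IsProbabilityMeasure P] (hξ : IsWignerFamily ξ P) {k l : ℕ}
    (a : WordPair k l) :
    pairExpectation ξ P a = ∫ ω, wordProd ξ a.1 ω * wordProd ξ a.2 ω ∂P
      - (∫ ω, wordProd ξ a.1 ω ∂P) * ∫ ω, wordProd ξ a.2 ω ∂P := by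
  have i1 := (hξ.hasAllMoments_wordProd a.1)
  have i2 := (hξ.hasAllMoments_wordProd a.2)
  have h : ∀ ω, centeredWordProd ξ P a.1 ω * centeredWordProd ξ P a.2 ω
      = wordProd ξ a.1 ω * wordProd ξ a.2 ω - (∫ ω, wordProd ξ a.1 ω ∂P) * wordProd ξ a.2 ω
        - (∫ ω, wordProd ξ a.2 ω ∂P) * centeredWordProd ξ P a.1 ω := by
    intro ω
    simp only [centeredWordProd]
    ring
  rw [pairExpectation]
  simp_rw [h]
  have i3 : Integrable (fun ω => wordProd ξ a.1 ω * wordProd ξ a.2 ω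
      - (∫ ω, wordProd ξ a.1 ω ∂P) * wordProd ξ a.2 ω) P :=
    (i1.mul i2).integrable.sub (i2.integrable.const_mul _)
  rw [integral_sub i3 ((hξ.hasAllMoments_centered a.1).integrable.const_mul _),
    integral_sub (i1.mul i2).integrable (i2.integrable.const_mul _), integral_const_mul,
    integral_const_mul, hξ.integral_centered, mul_zero, sub_zero]

/-- All steps traverse off-diagonal edges, whose entries have one common law, so the bound does not
depend on the word. -/
lemma integral_abs_wordProd_pow_le [IsProbabilityMeasure P] (hξ : IsWignerFamily ξ P) {k : ℕ}
    {w : Word k} (hw : w.NoSelfEdgeLoop) (n : ℕ) :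
    ∫ ω, |wordProd ξ w ω| ^ n ∂P ≤ 1 + k * ∫ ω, (|ξ s(1, 2) ω| ^ n) ^ k ∂P := by
  have hint : ∀ i : Fin k, Integrable (fun ω => (|ξ (w.step i) ω| ^ n) ^ k) P := fun i =>
    (((hξ.hasAllMoments _).abs.pow n).pow k).integrable
  calc ∫ ω, |wordProd ξ w ω| ^ n ∂P
      ≤ ∫ ω, (1 + ∑ i : Fin k, (|ξ (w.step i) ω| ^ n) ^ k) ∂P := by
        refine integral_mono ((hξ.hasAllMoments_wordProd w).abs.pow n).integrable
          ((integrable_const _).add (integrable_finsetSum _ fun i _ => hint i)) fun ω => ?_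
        have h1 := Finset.prod_le_one_add_sum_pow (Finset.univ : Finset (Fin k))
          (a := fun i => |ξ (w.step i) ω| ^ n) fun i _ => by positivity
        simpa only [wordProd_eq_prod_step, Finset.abs_prod, ← Finset.prod_pow, Finset.card_univ,
          Fintype.card_fin] using h1
    _ = 1 + k * ∫ ω, (|ξ s(1, 2) ω| ^ n) ^ k ∂P := by
        rw [integral_add (integrable_const _) (integrable_finsetSum _ fun i _ => hint i),
          integral_finsetSum _ fun i _ => hint i]
        have h2 : ∀ i : Fin k, ∫ ω, (|ξ (w.step i) ω| ^ n) ^ k ∂P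
            = ∫ ω, (|ξ s(1, 2) ω| ^ n) ^ k ∂P := fun i =>
          hξ.integral_comp_eq (hw.2.2 _ (w.step_mem_edges i)) (g := fun x => (|x| ^ n) ^ k)
            (by fun_prop)
        simp [h2]

lemma exists_integral_abs_centered_pow_le [IsProbabilityMeasure P] (hξ : IsWignerFamily ξ P)
    (n k : ℕ) : ∃ C : ℝ, ∀ w : Word k, w.NoSelfEdgeLoop →
      ∫ ω, |centeredWordProd ξ P w ω| ^ n ∂P ≤ C := by
  set B : ℕ → ℝ := fun n => 1 + k * ∫ ω, (|ξ s(1, 2) ω| ^ n) ^ k ∂P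
  refine ⟨2 ^ (n - 1) * (B n + B 1 ^ n), fun w hw => ?_⟩
  have hT := hξ.hasAllMoments_wordProd w
  have hc : |∫ ω, wordProd ξ w ω ∂P| ≤ B 1 := by
    refine (abs_integral_le_integral_abs).trans ?_
    simpa only [B, pow_one] using hξ.integral_abs_wordProd_pow_le hw 1
  calc ∫ ω, |centeredWordProd ξ P w ω| ^ n ∂P
      ≤ ∫ ω, 2 ^ (n - 1) * (|wordProd ξ w ω| ^ n + B 1 ^ n) ∂P := by
        refine integral_mono ((hξ.hasAllMoments_centered w).abs.pow n).integrable
          (((hT.abs.pow n).integrable.add (integrable_const _)).const_mul _) fun ω => ?_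
        have h1 : |centeredWordProd ξ P w ω| ≤ |wordProd ξ w ω| + B 1 :=
          (abs_sub _ _).trans (by gcongr)
        refine (pow_le_pow_left₀ (abs_nonneg _) h1 n).trans ?_
        exact add_pow_le (abs_nonneg _) ((abs_nonneg _).trans hc) n
    _ = 2 ^ (n - 1) * (∫ ω, |wordProd ξ w ω| ^ n ∂P + B 1 ^ n) := by
        rw [integral_const_mul, integral_add (hT.abs.pow n).integrable (integrable_const _)]
        simp
    _ ≤ 2 ^ (n - 1) * (B n + B 1 ^ n) := by
        have := hξ.integral_abs_wordProd_pow_le hw n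
        gcongr

end IsWignerFamily

end Wigner

/-! ### Joint moments of centered word products: vanishing and factorization -/

section JointMoments

variable {Ω : Type*} [MeasurableSpace Ω] {P : Measure Ω} {ξ : Sym2 ℕ+ → Ω → ℝ}
  {ι : Type*} {κ : ι → ℕ}

/-- `E[∏_{i ∈ J} T̄_{w_i}]`. -/
def jointMoment (ξ : Sym2 ℕ+ → Ω → ℝ) (P : Measure Ω) (w : ∀ i : ι, Word (κ i)) (J : Finset ι) :
    ℝ :=
  ∫ ω, ∏ i ∈ J, centeredWordProd ξ P (w i) ω ∂P

lemma IsWignerFamily.exists_abs_jointMoment_le [IsProbabilityMeasure P]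
    (hξ : IsWignerFamily ξ P) (κ : ι → ℕ) (J : Finset ι) :
    ∃ C : ℝ, ∀ w : ∀ i, Word (κ i), (∀ i, (w i).NoSelfEdgeLoop) → |jointMoment ξ P w J| ≤ C := by
  choose C hC using fun i : ι => hξ.exists_integral_abs_centered_pow_le J.card (κ i)
  refine ⟨1 + ∑ i ∈ J, C i, fun w hw => ?_⟩
  have hint : ∀ i, Integrable (fun ω => |centeredWordProd ξ P (w i) ω| ^ J.card) P := fun i =>
    ((hξ.hasAllMoments_centered (w i)).abs.pow _).integrable
  calc |jointMoment ξ P w J|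
      ≤ ∫ ω, |∏ i ∈ J, centeredWordProd ξ P (w i) ω| ∂P := abs_integral_le_integral_abs
    _ ≤ ∫ ω, (1 + ∑ i ∈ J, |centeredWordProd ξ P (w i) ω| ^ J.card) ∂P := by
        refine integral_mono
          (HasAllMoments.prod J fun i _ => hξ.hasAllMoments_centered (w i)).abs.integrable
          ((integrable_const _).add (integrable_finsetSum _ fun i _ => hint i)) fun ω => ?_
        simp only [Finset.abs_prod]
        exact Finset.prod_le_one_add_sum_pow J fun i _ => abs_nonneg _
    _ = 1 + ∑ i ∈ J, ∫ ω, |centeredWordProd ξ P (w i) ω| ^ J.card ∂P := by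
        rw [integral_add (integrable_const _) (integrable_finsetSum _ fun i _ => hint i),
          integral_finsetSum _ fun i _ => hint i]
        simp
    _ ≤ 1 + ∑ i ∈ J, C i := by
        gcongr with i hi
        exact hC i (w i) (hw i)

/-- The σ-algebra generated by the entries indexed by `S`. -/
abbrev entriesSigma (ξ : Sym2 ℕ+ → Ω → ℝ) (S : Set (Sym2 ℕ+)) : MeasurableSpace Ω :=
  ⨆ e ∈ S, MeasurableSpace.comap (ξ e) inferInstance

lemma measurable_entry {S : Set (Sym2 ℕ+)} {e : Sym2 ℕ+} (he : e ∈ S) :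
    Measurable[entriesSigma ξ S] (ξ e) :=
  measurable_iff_comap_le.2
    (le_iSup₂ (f := fun e (_ : e ∈ S) => MeasurableSpace.comap (ξ e) inferInstance) e he)

lemma measurable_prod_pow {S : Set (Sym2 ℕ+)} (E : Finset (Sym2 ℕ+)) (hE : ∀ e ∈ E, e ∈ S)
    (n : Sym2 ℕ+ → ℕ) : Measurable[entriesSigma ξ S] fun ω => ∏ e ∈ E, ξ e ω ^ n e :=
  Finset.measurable_fun_prod (m := entriesSigma ξ S) E fun e he =>
    (measurable_entry (hE e he)).pow_const _

lemma measurable_centered {S : Set (Sym2 ℕ+)} {k : ℕ} {w : Word k}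
    (hw : ∀ e ∈ w.edges, e ∈ S) : Measurable[entriesSigma ξ S] (centeredWordProd ξ P w) :=
  (measurable_prod_pow w.edges hw w.passages).sub_const _

lemma measurable_prod_centered {S : Set (Sym2 ℕ+)} (w : ∀ i : ι, Word (κ i)) (J : Finset ι)
    (hw : ∀ i ∈ J, ∀ e ∈ (w i).edges, e ∈ S) :
    Measurable[entriesSigma ξ S] fun ω => ∏ i ∈ J, centeredWordProd ξ P (w i) ω :=
  Finset.measurable_fun_prod (m := entriesSigma ξ S) J fun i hi => measurable_centered (hw i hi)

namespace IsWignerFamily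

lemma entriesSigma_le (hξ : IsWignerFamily ξ P) (S : Set (Sym2 ℕ+)) :
    entriesSigma ξ S ≤ (inferInstance : MeasurableSpace Ω) :=
  iSup₂_le fun e _ => (hξ.measurable e).comap_le

lemma integral_mul_of_disjoint (hξ : IsWignerFamily ξ P) {S T : Set (Sym2 ℕ+)}
    (hST : Disjoint S T) {f g : Ω → ℝ} (hf : Measurable[entriesSigma ξ S] f)
    (hg : Measurable[entriesSigma ξ T] g) :
    ∫ ω, f ω * g ω ∂P = (∫ ω, f ω ∂P) * ∫ ω, g ω ∂P := by
  have h1 : Indep (entriesSigma ξ S) (entriesSigma ξ T) P :=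
    indep_iSup_of_disjoint (fun e => (hξ.measurable e).comap_le) hξ.indep.iIndep hST
  have h2 : IndepFun f g P := (IndepFun_iff_Indep _ _ _).2
    (indep_of_indep_of_le h1 (measurable_iff_comap_le.1 hf) (measurable_iff_comap_le.1 hg))
  exact h2.integral_fun_mul_eq_mul_integral
    (hf.mono (hξ.entriesSigma_le S) le_rfl).aestronglyMeasurable
    (hg.mono (hξ.entriesSigma_le T) le_rfl).aestronglyMeasurable

lemma jointMoment_union [DecidableEq ι] (hξ : IsWignerFamily ξ P) (w : ∀ i : ι, Word (κ i))
    {A B : Finset ι} (hAB : Disjoint A B)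
    (h : ∀ i ∈ A, ∀ j ∈ B, Disjoint (w i).edges (w j).edges) :
    jointMoment ξ P w (A ∪ B) = jointMoment ξ P w A * jointMoment ξ P w B := by
  simp only [jointMoment, Finset.prod_union hAB]
  refine hξ.integral_mul_of_disjoint (S := {e | ∃ i ∈ A, e ∈ (w i).edges})
    (T := {e | ∃ i ∈ B, e ∈ (w i).edges}) ?_
    (measurable_prod_centered w A fun i hi e he => ⟨i, hi, he⟩)
    (measurable_prod_centered w B fun i hi e he => ⟨i, hi, he⟩)
  rw [Set.disjoint_left]
  rintro e ⟨i, hi, hei⟩ ⟨j, hj, hej⟩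
  exact Finset.disjoint_left.1 (h i hi j hj) hei hej

lemma jointMoment_singleton [IsProbabilityMeasure P] (hξ : IsWignerFamily ξ P)
    (w : ∀ i : ι, Word (κ i)) (i : ι) : jointMoment ξ P w {i} = 0 := by
  simp [jointMoment, hξ.integral_centered]

lemma jointMoment_eq_zero_of_disjoint [IsProbabilityMeasure P] [DecidableEq ι]
    (hξ : IsWignerFamily ξ P) (w : ∀ i : ι, Word (κ i)) {J : Finset ι} {i : ι} (hi : i ∈ J)
    (h : ∀ j, j ≠ i → Disjoint (w i).edges (w j).edges) : jointMoment ξ P w J = 0 := by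
  rw [← Finset.insert_erase hi, Finset.insert_eq, hξ.jointMoment_union w, jointMoment_singleton hξ,
    zero_mul]
  · simp
  · intro i' hi' j hj
    rw [Finset.mem_singleton.1 hi']
    exact h j (Finset.ne_of_mem_erase hj)

/-- The centered factor `ξ e` occurs to the first power in `T_{w_i}`. Hence `E[T_{w_i}] = 0`, so no
centering term is left, and `ξ e` splits off from the whole product by independence. -/
lemma jointMoment_eq_zero_of_single_passage [IsProbabilityMeasure P] [DecidableEq ι]
    (hξ : IsWignerFamily ξ P) {w : ∀ i : ι, Word (κ i)} (hw : ∀ i, (w i).NoSelfEdgeLoop)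
    {J : Finset ι} {i : ι} (hi : i ∈ J) {e : Sym2 ℕ+} (h1 : (w i).passages e = 1)
    (h0 : ∀ j, j ≠ i → (w j).passages e = 0) : jointMoment ξ P w J = 0 := by
  have he : e ∈ (w i).edges := by
    rw [← Word.passages_ne_zero, h1]
    exact one_ne_zero
  have hmean : ∫ ω, ξ e ω ∂P = 0 :=
    (hξ.integral_comp_eq ((hw i).2.2 e he) measurable_id).trans hξ.mean_offDiag
  have hT : ∫ ω, wordProd ξ (w i) ω ∂P = 0 := by
    rw [hξ.integral_wordProd (hw i)]
    refine Finset.prod_eq_zero he ?_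
    rw [h1]
    simpa using hξ.mean_offDiag
  have hprod : ∀ ω, ∏ j ∈ J, centeredWordProd ξ P (w j) ω
      = ξ e ω * ((∏ e' ∈ (w i).edges.erase e, ξ e' ω ^ (w i).passages e')
        * ∏ j ∈ J.erase i, centeredWordProd ξ P (w j) ω) := by
    intro ω
    rw [← Finset.mul_prod_erase _ _ hi, centeredWordProd, hT, sub_zero, wordProd,
      ← Finset.mul_prod_erase _ _ he, h1, pow_one, mul_assoc]
  rw [jointMoment]
  simp_rw [hprod]
  rw [hξ.integral_mul_of_disjoint (S := {e}) (T := {e}ᶜ) disjoint_compl_right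
    (measurable_entry (Set.mem_singleton e)), hmean, zero_mul]
  refine Measurable.mul (measurable_prod_pow _ (fun e' he' => ?_) _)
    (measurable_prod_centered w _ fun j hj e' he' => ?_)
  · simpa using Finset.ne_of_mem_erase he'
  · rintro rfl
    exact (Word.passages_ne_zero _ _).2 he' (h0 j (Finset.ne_of_mem_erase hj))

/-- Unlinkedness is caused by one word: it makes the only passage of some edge, or is independent of
all others. That word kills every sub-product containing it, which is needed for the terms of the
Wick sum. -/
lemma exists_null_of_not_isLinked [IsProbabilityMeasure P] [Fintype ι] [DecidableEq ι]
    (hξ : IsWignerFamily ξ P) {w : ∀ i : ι, Word (κ i)} (hw : ∀ i, (w i).NoSelfEdgeLoop)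
    (h : ¬ IsLinked (fun i => (⟨κ i, w i⟩ : Σ k, Word k))) :
    ∃ i, ∀ J : Finset ι, i ∈ J → jointMoment ξ P w J = 0 := by
  by_contra hnull
  refine h ⟨?_, ?_⟩
  · intro e he
    by_contra hlt
    obtain ⟨i, _, hi⟩ := Finset.mem_biUnion.1 he
    have h1 : (w i).passages e ≠ 0 := ((w i).passages_ne_zero e).2 hi
    have h2 : ∑ j, (w j).passages e
        = (w i).passages e + ∑ j ∈ Finset.univ.erase i, (w j).passages e :=
      (Finset.add_sum_erase _ _ (Finset.mem_univ i)).symm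
    have h3 : ¬ 2 ≤ ∑ j, (w j).passages e := hlt
    have h4 : ∑ j ∈ Finset.univ.erase i, (w j).passages e = 0 := by omega
    refine hnull ⟨i, fun J hJ => hξ.jointMoment_eq_zero_of_single_passage hw hJ (e := e)
      (by omega) fun j hj => ?_⟩
    exact Finset.sum_eq_zero_iff.1 h4 j (Finset.mem_erase.2 ⟨hj, Finset.mem_univ j⟩)
  · intro i
    by_contra hno
    push Not at hno
    exact hnull ⟨i, fun J hJ => hξ.jointMoment_eq_zero_of_disjoint w hJ fun j hj =>
      Finset.disjoint_left.2 fun e h1 h2 => hno j hj e h1 h2⟩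

/-- The Wick expansion is exact unless the words are linked and one of them shares edges with two
others. -/
theorem jointMoment_univ_eq [IsProbabilityMeasure P] [Fintype ι] [DecidableEq ι]
    (hξ : IsWignerFamily ξ P) {w : ∀ i : ι, Word (κ i)} (hw : ∀ i, (w i).NoSelfEdgeLoop) (i₀ : ι)
    (h : ¬ (IsLinked (fun i => (⟨κ i, w i⟩ : Σ k, Word k)) ∧
      ∃ i j₁ j₂, j₁ ≠ i ∧ j₂ ≠ i ∧ j₁ ≠ j₂ ∧ (∃ e, e ∈ (w i).edges ∧ e ∈ (w j₁).edges) ∧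
        ∃ e, e ∈ (w i).edges ∧ e ∈ (w j₂).edges)) :
    jointMoment ξ P w Finset.univ
      = ∑ j ∈ Finset.univ.erase i₀, jointMoment ξ P w {i₀, j} * jointMoment ξ P w {i₀, j}ᶜ := by
  by_cases hl : IsLinked (fun i => (⟨κ i, w i⟩ : Σ k, Word k))
  swap
  · obtain ⟨i, hi⟩ := hξ.exists_null_of_not_isLinked hw hl
    rw [hi _ (Finset.mem_univ i)]
    refine (Finset.sum_eq_zero fun j _ => ?_).symm
    -- The null word lies in one of the two blocks.
    by_cases hij : i ∈ ({i₀, j} : Finset ι)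
    · rw [hi _ hij, zero_mul]
    · rw [hi _ (Finset.mem_compl.2 hij), mul_zero]
  have h2 : ∀ i j₁ j₂, j₁ ≠ i → j₂ ≠ i → j₁ ≠ j₂ → (∃ e, e ∈ (w i).edges ∧ e ∈ (w j₁).edges) →
      Disjoint (w i).edges (w j₂).edges := by
    intro i j₁ j₂ h1 h2 h12 he
    rw [Finset.disjoint_left]
    intro e he1 he2
    exact h ⟨hl, i, j₁, j₂, h1, h2, h12, he, e, he1, he2⟩
  -- No word touches two others, so `i₀` has a unique partner `j`, and this pair is edge-disjoint
  -- from the rest. For any other `m`, the words `i₀` and `m` are independent and their covariance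
  -- is zero.
  obtain ⟨j, hj, e, he1, he2⟩ := hl.shared i₀
  rw [Finset.sum_eq_single_of_mem j (Finset.mem_erase.2 ⟨hj, Finset.mem_univ j⟩)]
  · conv_lhs => rw [← Finset.union_compl ({i₀, j} : Finset ι)]
    refine hξ.jointMoment_union w disjoint_compl_right fun i hi m hm => ?_
    simp only [Finset.mem_compl, Finset.mem_insert, Finset.mem_singleton, not_or] at hi hm
    rcases hi with rfl | rfl
    · exact h2 _ j m hj hm.1 (Ne.symm hm.2) ⟨e, he1, he2⟩
    · exact h2 _ i₀ m hj.symm hm.2 (Ne.symm hm.1) ⟨e, he2, he1⟩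
  · intro m hm hmj
    have hm0 : m ≠ i₀ := Finset.ne_of_mem_erase hm
    rw [Finset.insert_eq, hξ.jointMoment_union w (by simpa using hm0.symm), jointMoment_singleton hξ,
      zero_mul, zero_mul]
    intro i hi m' hm'
    rw [Finset.mem_singleton.1 hi, Finset.mem_singleton.1 hm']
    exact h2 i₀ j m hj hm0 hmj.symm ⟨e, he1, he2⟩

end IsWignerFamily

end JointMoments

/-! ### Counting words with few letters -/

lemma mem_letters {N : ℕ} {x : ℕ+} : x ∈ letters N ↔ (x : ℕ) ≤ N := by
  simp only [letters, Finset.mem_map, Finset.mem_range, Function.Embedding.coeFn_mk]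
  constructor
  · rintro ⟨n, hn, rfl⟩
    simpa using hn
  · intro h
    refine ⟨x.natPred, ?_, PNat.succPNat_natPred x⟩
    have := PNat.natPred_add_one x
    omega

lemma card_letters (N : ℕ) : (letters N).card = N := by
  simp [letters]

lemma mem_noSelfEdgeWords {N k : ℕ} {w : Word k} :
    w ∈ noSelfEdgeWords N k ↔ (∀ i, w i ∈ letters N) ∧ w.NoSelfEdgeLoop := by
  simp [noSelfEdgeWords]

/-- The number of maps to `{1, …, N}` hitting `1` and taking at most `r + 1` values is
`O(N ^ r)`. -/
lemma card_le_of_card_image_le {α I : Type*} [Fintype I] [DecidableEq I] (s : Finset α)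
    (F : α → I → ℕ+) (hF : Function.Injective F) {N r : ℕ}
    (hN : ∀ a ∈ s, ∀ i, F a i ∈ letters N)
    (h1 : ∀ a ∈ s, ∃ i, F a i = 1)
    (hr : ∀ a ∈ s, (Finset.univ.image (F a)).card ≤ r + 1) :
    s.card ≤ (r + 1) ^ Fintype.card I * N ^ r := by
  classical
  -- A map is encoded by its pattern and the values of the classes; class `0` is reserved for the
  -- letter `1`, so only `r` values are free.
  let Φ : (I → Fin (r + 1)) × (Fin r → letters N) → I → ℕ+ :=
    fun hg i => Fin.cons (α := fun _ => ℕ+) 1 (fun j => (hg.2 j : ℕ+)) (hg.1 i)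
  have hsub : s.image F ⊆ Finset.univ.image Φ := by
    intro x hx
    obtain ⟨a, ha, rfl⟩ := Finset.mem_image.1 hx
    obtain ⟨i₁, hi₁⟩ := h1 a ha
    have h1N : (1 : ℕ+) ∈ letters N := hi₁ ▸ hN a ha i₁
    set t := (Finset.univ.image (F a)).erase 1 with ht
    have hmem1 : (1 : ℕ+) ∈ Finset.univ.image (F a) :=
      Finset.mem_image.2 ⟨i₁, Finset.mem_univ _, hi₁⟩
    have hcard : Fintype.card t ≤ Fintype.card (Fin r) := by
      rw [Fintype.card_coe, Fintype.card_fin, ht]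
      have h2 := Finset.card_erase_add_one hmem1
      have h3 := hr a ha
      omega
    obtain ⟨f⟩ := Function.Embedding.nonempty_of_card_le hcard
    have htN : ∀ y : t, (y : ℕ+) ∈ letters N := by
      rintro ⟨y, hy⟩
      obtain ⟨i, _, hi⟩ := Finset.mem_image.1 (Finset.mem_of_mem_erase hy)
      exact hi ▸ hN a ha i
    let g : Fin r → letters N :=
      Function.extend f (fun y => ⟨(y : ℕ+), htN y⟩) fun _ => ⟨1, h1N⟩
    have hg : ∀ y : t, (g (f y) : ℕ+) = y := fun y => by
      simp [g, f.injective.extend_apply]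
    have hex : ∀ i, ∃ j : Fin (r + 1),
        Fin.cons (α := fun _ => ℕ+) 1 (fun j => (g j : ℕ+)) j = F a i := by
      intro i
      by_cases hi : F a i = 1
      · exact ⟨0, by simp [hi]⟩
      · have hit : F a i ∈ t :=
          Finset.mem_erase.2 ⟨hi, Finset.mem_image_of_mem _ (Finset.mem_univ i)⟩
        exact ⟨(f ⟨_, hit⟩).succ, by simp [hg]⟩
    choose h hh using hex
    exact Finset.mem_image.2 ⟨(h, g), Finset.mem_univ _, funext hh⟩
  have h2 := (Finset.card_le_card hsub).trans Finset.card_image_le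
  rw [Finset.card_image_of_injective _ hF] at h2
  simpa [card_letters] using h2

lemma tendsto_descFactorial_div_pow (m : ℕ) :
    Tendsto (fun N : ℕ => ((N - 1).descFactorial m : ℝ) / (N : ℝ) ^ m) atTop (nhds 1) := by
  induction m with
  | zero => simp
  | succ m ih =>
    have h1 : Tendsto (fun N : ℕ => (1 : ℝ) - (m + 1 : ℕ) / (N : ℝ)) atTop (nhds 1) := by
      simpa using tendsto_const_nhds.sub (tendsto_const_div_atTop_nhds_zero_nat ((m + 1 : ℕ) : ℝ))
    have h2 := h1.mul ih
    rw [one_mul] at h2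
    refine h2.congr' ?_
    filter_upwards [eventually_ge_atTop (m + 1)] with N hN
    have hN0 : (N : ℝ) ≠ 0 := by
      have : N ≠ 0 := by omega
      exact_mod_cast this
    have h3 : ((N - 1 - m : ℕ) : ℝ) = N - (m + 1 : ℕ) := by
      rw [Nat.sub_sub, add_comm 1 m, Nat.cast_sub hN]
    rw [Nat.descFactorial_succ, Nat.cast_mul, h3]
    field_simp
    ring

/-! ### Relabelling of sentences and the size of an equivalence class -/

namespace WordPair

variable {k l : ℕ}

/-- The steps of both words of a sentence. -/
def step (a : WordPair k l) : Fin k ⊕ Fin l → Sym2 ℕ+ := Sum.elim a.1.step a.2.step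

lemma edges_eq_image (a : WordPair k l) : a.edges = Finset.univ.image a.step := by
  ext e
  simp [edges, Word.edges, step]

lemma passages_eq_card (a : WordPair k l) (e : Sym2 ℕ+) :
    a.passages e = (Finset.univ.filter fun i => a.step i = e).card := by
  simp only [passages, Word.passages, Finset.card_filter, Fintype.sum_sum_type]
  rfl

/-- The letters of both words of a sentence. -/
def letter (a : WordPair k l) : Fin (k + 1) ⊕ Fin (l + 1) → ℕ+ := Sum.elim a.1 a.2

lemma supp_eq_image (a : WordPair k l) : a.supp = Finset.univ.image a.letter := by
  ext e
  simp [supp, Word.supp, letter]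

/-- Relabelling the letters of a sentence. -/
def relabel (f : ℕ+ → ℕ+) (a : WordPair k l) : WordPair k l := (f ∘ a.1, f ∘ a.2)

lemma step_relabel (f : ℕ+ → ℕ+) (a : WordPair k l) (i : Fin k ⊕ Fin l) :
    (relabel f a).step i = Sym2.map f (a.step i) := by
  cases i <;> rfl

lemma supp_relabel (f : ℕ+ → ℕ+) (a : WordPair k l) : (relabel f a).supp = a.supp.image f := by
  rw [supp_eq_image, supp_eq_image, Finset.image_image]
  congr 1
  funext i
  cases i <;> rfl

lemma equivalent_iff {a b : WordPair k l} :
    a.Equivalent b ↔ ∃ f : ℕ+ → ℕ+, Set.InjOn f a.supp ∧ relabel f a = b := by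
  constructor
  · rintro ⟨f, hf, h1, h2⟩
    exact ⟨f, hf.injOn, Prod.ext h1 h2⟩
  · rintro ⟨f, hf, rfl⟩
    refine ⟨f, ?_, rfl, rfl⟩
    rw [supp_relabel, Finset.coe_image]
    exact hf.bijOn_image

/-- All letters of the edge lie in `V`. -/
lemma mem_supp_of_mem_step (a : WordPair k l) (i : Fin k ⊕ Fin l) {x : ℕ+} (hx : x ∈ a.step i) :
    x ∈ a.supp := by
  cases i with
  | inl i =>
    rcases Sym2.mem_iff.1 hx with rfl | rfl
    · exact a.fst_mem_supp _
    · exact a.fst_mem_supp _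
  | inr i =>
    rcases Sym2.mem_iff.1 hx with rfl | rfl
    · exact a.snd_mem_supp _
    · exact a.snd_mem_supp _

lemma map_injective_of_injOn {f : ℕ+ → ℕ+} {V : Finset ℕ+} (hf : Set.InjOn f V) {e e' : Sym2 ℕ+}
    (he : ∀ x ∈ e, x ∈ V) (he' : ∀ x ∈ e', x ∈ V) (h : Sym2.map f e = Sym2.map f e') : e = e' := by
  induction e using Sym2.ind with
  | _ x y =>
    induction e' using Sym2.ind with
    | _ x' y' =>
      have hx := he x (Sym2.mem_mk_left x y)
      have hy := he y (Sym2.mem_mk_right x y)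
      have hx' := he' x' (Sym2.mem_mk_left x' y')
      have hy' := he' y' (Sym2.mem_mk_right x' y')
      rw [Sym2.map_mk, Sym2.map_mk, Sym2.eq_iff] at h
      rw [Sym2.eq_iff]
      rcases h with ⟨h1, h2⟩ | ⟨h1, h2⟩
      · exact Or.inl ⟨hf hx hx' h1, hf hy hy' h2⟩
      · exact Or.inr ⟨hf hx hy' h1, hf hy hx' h2⟩

lemma step_relabel_eq_iff {f : ℕ+ → ℕ+} {a : WordPair k l} (hf : Set.InjOn f a.supp)
    (i j : Fin k ⊕ Fin l) :
    (relabel f a).step i = (relabel f a).step j ↔ a.step i = a.step j := by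
  rw [step_relabel, step_relabel]
  exact ⟨map_injective_of_injOn hf (fun x hx => a.mem_supp_of_mem_step i hx)
    (fun x hx => a.mem_supp_of_mem_step j hx), fun h => by rw [h]⟩

lemma passages_relabel {f : ℕ+ → ℕ+} {a : WordPair k l} (hf : Set.InjOn f a.supp)
    (j : Fin k ⊕ Fin l) :
    (relabel f a).passages ((relabel f a).step j) = a.passages (a.step j) := by
  rw [passages_eq_card, passages_eq_card]
  simp_rw [step_relabel_eq_iff hf]

lemma fst_passages_relabel {f : ℕ+ → ℕ+} {a : WordPair k l} (hf : Set.InjOn f a.supp)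
    (j : Fin k ⊕ Fin l) :
    (relabel f a).1.passages ((relabel f a).step j) = a.1.passages (a.step j) := by
  have h := fun i : Fin k => step_relabel_eq_iff hf (Sum.inl i) j
  change ((Finset.univ.filter fun i : Fin k => (relabel f a).step (Sum.inl i)
    = (relabel f a).step j)).card = _
  simp_rw [h]
  rfl

lemma snd_passages_relabel {f : ℕ+ → ℕ+} {a : WordPair k l} (hf : Set.InjOn f a.supp)
    (j : Fin k ⊕ Fin l) :
    (relabel f a).2.passages ((relabel f a).step j) = a.2.passages (a.step j) := by
  have h := fun i : Fin l => step_relabel_eq_iff hf (Sum.inr i) j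
  change ((Finset.univ.filter fun i : Fin l => (relabel f a).step (Sum.inr i)
    = (relabel f a).step j)).card = _
  simp_rw [h]
  rfl

lemma prod_edges_relabel {R : Type*} [CommMonoid R] {f : ℕ+ → ℕ+} {a : WordPair k l}
    (hf : Set.InjOn f a.supp) {F G : Sym2 ℕ+ → R}
    (hFG : ∀ j, G ((relabel f a).step j) = F (a.step j)) :
    ∏ e ∈ (relabel f a).edges, G e = ∏ e ∈ a.edges, F e := by
  have himg : (relabel f a).edges = a.edges.image (Sym2.map f) := by
    rw [edges_eq_image, edges_eq_image, Finset.image_image]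
    congr 1
    funext i
    exact step_relabel f a i
  rw [himg, Finset.prod_image]
  · refine Finset.prod_congr rfl fun e he => ?_
    rw [edges_eq_image] at he
    obtain ⟨i, _, rfl⟩ := Finset.mem_image.1 he
    rw [← hFG, step_relabel]
  · intro e he e' he' h
    rw [Finset.mem_coe, edges_eq_image] at he he'
    obtain ⟨i, _, rfl⟩ := Finset.mem_image.1 he
    obtain ⟨j, _, rfl⟩ := Finset.mem_image.1 he'
    exact map_injective_of_injOn hf (fun x hx => a.mem_supp_of_mem_step i hx)
      (fun x hx => a.mem_supp_of_mem_step j hx) h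

lemma wt_relabel {f : ℕ+ → ℕ+} {a : WordPair k l} (hf : Set.InjOn f a.supp) :
    (relabel f a).wt = a.wt := by
  rw [wt, wt, supp_relabel, Finset.card_image_of_injOn hf]

lemma IsCLT.relabel {f : ℕ+ → ℕ+} {a : WordPair k l} (h : a.IsCLT) (hf : Set.InjOn f a.supp) :
    (relabel f a).IsCLT := by
  refine ⟨⟨?_, ?_⟩, ?_⟩
  · intro e he
    rw [edges_eq_image] at he
    obtain ⟨i, _, rfl⟩ := Finset.mem_image.1 he
    rw [passages_relabel hf]
    refine h.1.1 _ ?_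
    rw [edges_eq_image]
    exact Finset.mem_image_of_mem _ (Finset.mem_univ i)
  · obtain ⟨e, he⟩ := h.1.2
    rw [Finset.mem_inter] at he
    obtain ⟨i, _, rfl⟩ := Finset.mem_image.1 he.1
    obtain ⟨j, _, hj⟩ := Finset.mem_image.1 he.2
    refine ⟨Sym2.map f (a.1.step i), Finset.mem_inter.2 ⟨?_, ?_⟩⟩
    · exact Finset.mem_image.2 ⟨i, Finset.mem_univ _, rfl⟩
    · rw [← hj]
      exact Finset.mem_image.2 ⟨j, Finset.mem_univ _, rfl⟩
  · rw [wt_relabel hf]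
    exact h.2

lemma noSelfEdgeLoop_comp {n : ℕ} {f : ℕ+ → ℕ+} {V : Finset ℕ+} {w : Word n}
    (hf : Set.InjOn f V) (hV : ∀ i, w i ∈ V) (hf1 : f 1 = 1) (hw : w.NoSelfEdgeLoop) :
    Word.NoSelfEdgeLoop (f ∘ w) := by
  refine ⟨by simp [hw.1, hf1], by simp [hw.2.1, hf1], ?_⟩
  intro e he hd
  obtain ⟨i, _, rfl⟩ := Finset.mem_image.1 he
  have h1 : f (w i.castSucc) = f (w i.succ) := Sym2.mk_isDiag_iff.1 hd
  exact hw.2.2 _ (w.step_mem_edges i) (Sym2.mk_isDiag_iff.2 (hf (hV _) (hV _) h1))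

lemma one_mem_supp {a : WordPair k l} (h : a.1.NoSelfEdgeLoop) : 1 ∈ a.supp :=
  h.1 ▸ a.fst_mem_supp 0

/-- Extend an embedding of letters other than `1` by `1 ↦ 1`. -/
def extendOne {a : WordPair k l} {N : ℕ} (f : a.supp.erase 1 ↪ (letters N).erase 1) (x : ℕ+) :
    ℕ+ := if h : x ∈ a.supp.erase 1 then f ⟨x, h⟩ else 1

lemma extendOne_one {a : WordPair k l} {N : ℕ} (f : a.supp.erase 1 ↪ (letters N).erase 1) :
    extendOne f 1 = 1 := dif_neg (by simp)

lemma extendOne_of_ne {a : WordPair k l} {N : ℕ} (f : a.supp.erase 1 ↪ (letters N).erase 1)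
    {x : ℕ+} (hx : x ∈ a.supp.erase 1) : extendOne f x = f ⟨x, hx⟩ := dif_pos hx

lemma extendOne_injOn {a : WordPair k l} {N : ℕ} (f : a.supp.erase 1 ↪ (letters N).erase 1) :
    Set.InjOn (extendOne f) a.supp := by
  have key : ∀ x ∈ a.supp, x ≠ 1 → extendOne f x ≠ 1 := by
    intro x hx h1 h
    rw [extendOne_of_ne f (Finset.mem_erase.2 ⟨h1, hx⟩)] at h
    exact Finset.ne_of_mem_erase (f _).2 h
  intro x hx y hy hxy
  by_cases hx1 : x = 1
  · by_contra hne
    rw [hx1, extendOne_one] at hxy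
    exact key y hy (fun h => hne (hx1.trans h.symm)) hxy.symm
  by_cases hy1 : y = 1
  · rw [hy1, extendOne_one] at hxy
    exact absurd hxy (key x hx hx1)
  rw [extendOne_of_ne f (Finset.mem_erase.2 ⟨hx1, hx⟩),
    extendOne_of_ne f (Finset.mem_erase.2 ⟨hy1, hy⟩)] at hxy
  simpa using f.injective (Subtype.ext hxy)

lemma extendOne_mem {a : WordPair k l} {N : ℕ} (hN : 1 ≤ N)
    (f : a.supp.erase 1 ↪ (letters N).erase 1) (x : ℕ+) : extendOne f x ∈ letters N := by
  rw [extendOne]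
  split_ifs with h
  · exact Finset.mem_of_mem_erase (f ⟨x, h⟩).2
  · rw [mem_letters]
    simpa using hN

lemma relabel_mem {a : WordPair k l} (h1 : a.1.NoSelfEdgeLoop) (h2 : a.2.NoSelfEdgeLoop) {N : ℕ}
    (hN : 1 ≤ N) (f : a.supp.erase 1 ↪ (letters N).erase 1) :
    relabel (extendOne f) a ∈ noSelfEdgeWords N k ×ˢ noSelfEdgeWords N l := by
  rw [Finset.mem_product, mem_noSelfEdgeWords, mem_noSelfEdgeWords]
  exact ⟨⟨fun _ => extendOne_mem hN f _,
    noSelfEdgeLoop_comp (extendOne_injOn f) a.fst_mem_supp (extendOne_one f) h1⟩,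
    ⟨fun _ => extendOne_mem hN f _,
    noSelfEdgeLoop_comp (extendOne_injOn f) a.snd_mem_supp (extendOne_one f) h2⟩⟩

open scoped Classical in
/-- The number of relabellings of a sentence with letters in `{1, …, N}` fixing the letter `1`. -/
lemma card_equivalent {a : WordPair k l} (h1 : a.1.NoSelfEdgeLoop) (h2 : a.2.NoSelfEdgeLoop)
    {N : ℕ} (hN : 1 ≤ N) :
    ((noSelfEdgeWords N k ×ˢ noSelfEdgeWords N l).filter fun b => a.Equivalent b).card
      = (N - 1).descFactorial (a.wt - 1) := by
  have h1N : (1 : ℕ+) ∈ letters N := mem_letters.2 (by simpa using hN)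
  have hcard : Fintype.card (a.supp.erase 1 ↪ (letters N).erase 1)
      = (N - 1).descFactorial (a.wt - 1) := by
    rw [Fintype.card_embedding_eq, Fintype.card_coe, Fintype.card_coe,
      Finset.card_erase_of_mem h1N, Finset.card_erase_of_mem (one_mem_supp h1), card_letters, wt]
  rw [← hcard, ← Finset.card_univ]
  symm
  refine Finset.card_bij (fun f _ => relabel (extendOne f) a) ?_ ?_ ?_
  · intro f _
    exact Finset.mem_filter.2 ⟨relabel_mem h1 h2 hN f,
      equivalent_iff.2 ⟨_, extendOne_injOn f, rfl⟩⟩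
  · intro f _ g _ hfg
    have hval : ∀ x ∈ a.supp, extendOne f x = extendOne g x := by
      intro x hx
      rw [supp_eq_image] at hx
      obtain ⟨i, _, rfl⟩ := Finset.mem_image.1 hx
      cases i with
      | inl i => exact congrFun (congrArg Prod.fst hfg) i
      | inr i => exact congrFun (congrArg Prod.snd hfg) i
    ext ⟨x, hx⟩
    have h3 := hval x (Finset.mem_of_mem_erase hx)
    rw [extendOne_of_ne f hx, extendOne_of_ne g hx] at h3
    rw [h3]
  · intro b hb
    rw [Finset.mem_filter, Finset.mem_product, mem_noSelfEdgeWords, mem_noSelfEdgeWords] at hb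
    obtain ⟨⟨⟨hb1, hb1'⟩, hb2, hb2'⟩, heq⟩ := hb
    obtain ⟨F, hF, rfl⟩ := equivalent_iff.1 heq
    have hF1 : F 1 = 1 := by
      have h3 : F (a.1 0) = 1 := hb1'.1
      rwa [h1.1] at h3
    have hFN : ∀ x ∈ a.supp, F x ∈ letters N := by
      intro x hx
      rw [supp_eq_image] at hx
      obtain ⟨i, _, rfl⟩ := Finset.mem_image.1 hx
      cases i with
      | inl i => exact hb1 i
      | inr i => exact hb2 i
    have hne : ∀ x ∈ a.supp, x ≠ 1 → F x ≠ 1 := by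
      intro x hx hx1 h
      exact hx1 (hF hx (one_mem_supp h1) (h.trans hF1.symm))
    let f : a.supp.erase 1 ↪ (letters N).erase 1 :=
      ⟨fun x => ⟨F x, Finset.mem_erase.2 ⟨hne x (Finset.mem_of_mem_erase x.2)
        (Finset.ne_of_mem_erase x.2), hFN x (Finset.mem_of_mem_erase x.2)⟩⟩, by
        rintro ⟨x, hx⟩ ⟨y, hy⟩ hxy
        exact Subtype.ext (hF (Finset.mem_of_mem_erase hx) (Finset.mem_of_mem_erase hy)
          (congrArg Subtype.val hxy))⟩
    have hfF : ∀ x ∈ a.supp, extendOne f x = F x := by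
      intro x hx
      by_cases hx1 : x = 1
      · rw [hx1, extendOne_one, hF1]
      · rw [extendOne_of_ne f (Finset.mem_erase.2 ⟨hx1, hx⟩)]
        rfl
    exact ⟨f, Finset.mem_univ _, Prod.ext (funext fun i => hfF _ (a.fst_mem_supp i))
      (funext fun i => hfF _ (a.snd_mem_supp i))⟩

end WordPair

/-! ### Convergence of the covariances -/

section Covariance

variable {Ω : Type*} [MeasurableSpace Ω] {P : Measure Ω} {ξ : Sym2 ℕ+ → Ω → ℝ} {k l : ℕ}

lemma mem_cltPairs {a : WordPair k l} : a ∈ cltPairs k l ↔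
    (a.1 ∈ noSelfEdgeWords ((k + l) / 2) k ∧ a.2 ∈ noSelfEdgeWords ((k + l) / 2) l) ∧
      a.IsCLT := by
  classical
  rw [cltPairs, Finset.mem_filter, Finset.mem_product]

lemma CLTClass.rep_mem (q : CLTClass k l) : q.rep ∈ cltPairs k l := (Quotient.out q).2

lemma CLTClass.isCLT_rep (q : CLTClass k l) : q.rep.IsCLT := (mem_cltPairs.1 q.rep_mem).2

lemma CLTClass.fst_rep (q : CLTClass k l) : q.rep.1.NoSelfEdgeLoop :=
  (mem_noSelfEdgeWords.1 (mem_cltPairs.1 q.rep_mem).1.1).2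

lemma CLTClass.snd_rep (q : CLTClass k l) : q.rep.2.NoSelfEdgeLoop :=
  (mem_noSelfEdgeWords.1 (mem_cltPairs.1 q.rep_mem).1.2).2

lemma limitCov_eq_zero_of_odd (h : Odd (k + l)) : limitCov ξ P k l = 0 := by
  refine Finset.sum_eq_zero fun q _ => ?_
  have h1 := WordPair.two_mul_wt_eq_iff.1 q.isCLT_rep.2
  rw [← h1] at h
  exact absurd (even_two_mul _) (Nat.not_even_iff_odd.2 h)

namespace IsWignerFamily

/-- The covariance of two words in terms of the moments of an off-diagonal entry. -/
lemma pairExpectation_eq_moments [IsProbabilityMeasure P] (hξ : IsWignerFamily ξ P)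
    {a : WordPair k l} (h1 : a.1.NoSelfEdgeLoop) (h2 : a.2.NoSelfEdgeLoop) :
    pairExpectation ξ P a = ∏ e ∈ a.edges, ∫ ω, ξ s(1, 2) ω ^ a.passages e ∂P
      - (∏ e ∈ a.edges, ∫ ω, ξ s(1, 2) ω ^ a.1.passages e ∂P)
        * ∏ e ∈ a.edges, ∫ ω, ξ s(1, 2) ω ^ a.2.passages e ∂P := by
  have key : ∀ {n : ℕ} (w : Word n), w.NoSelfEdgeLoop → w.edges ⊆ a.edges →
      ∫ ω, wordProd ξ w ω ∂P = ∏ e ∈ a.edges, ∫ ω, ξ s(1, 2) ω ^ w.passages e ∂P := by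
    intro n w hw hwa
    rw [hξ.integral_wordProd hw]
    refine Finset.prod_subset hwa fun e _ he => ?_
    rw [← Word.passages_ne_zero, not_not] at he
    simp [he]
  rw [hξ.pairExpectation_eq, hξ.integral_wordProd_mul h1 h2,
    key a.1 h1 Finset.subset_union_left, key a.2 h2 Finset.subset_union_right]

/-- The moment formula sees only the passage counts, which an injective relabelling preserves edge
by edge. -/
lemma pairExpectation_eq_of_equivalent [IsProbabilityMeasure P] (hξ : IsWignerFamily ξ P)
    {a b : WordPair k l} (ha1 : a.1.NoSelfEdgeLoop) (ha2 : a.2.NoSelfEdgeLoop)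
    (hb1 : b.1.NoSelfEdgeLoop) (hb2 : b.2.NoSelfEdgeLoop) (h : a.Equivalent b) :
    pairExpectation ξ P a = pairExpectation ξ P b := by
  obtain ⟨f, hf, rfl⟩ := WordPair.equivalent_iff.1 h
  rw [hξ.pairExpectation_eq_moments ha1 ha2, hξ.pairExpectation_eq_moments hb1 hb2]
  congr 1
  · refine (WordPair.prod_edges_relabel hf fun j => ?_).symm
    rw [WordPair.passages_relabel hf]
  · congr 1
    · refine (WordPair.prod_edges_relabel hf fun j => ?_).symm
      rw [WordPair.fst_passages_relabel hf]
    · refine (WordPair.prod_edges_relabel hf fun j => ?_).symm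
      rw [WordPair.snd_passages_relabel hf]

/-- The limiting covariance depends only on the second and fourth moments of the off-diagonal
entries. -/
lemma limitCov_congr [IsProbabilityMeasure P] (hξ : IsWignerFamily ξ P) {Ω' : Type*}
    [MeasurableSpace Ω'] {P' : Measure Ω'} [IsProbabilityMeasure P'] {ξ' : Sym2 ℕ+ → Ω' → ℝ}
    (hξ' : IsWignerFamily ξ' P')
    (h2 : ∫ ω, ξ' s(1, 2) ω ^ 2 ∂P' = ∫ ω, ξ s(1, 2) ω ^ 2 ∂P)
    (h4 : ∫ ω, ξ' s(1, 2) ω ^ 4 ∂P' = ∫ ω, ξ s(1, 2) ω ^ 4 ∂P) :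
    limitCov ξ' P' k l = limitCov ξ P k l := by
  have key : ∀ n : ℕ, n ≤ 2 ∨ n = 4 →
      ∫ ω, ξ' s(1, 2) ω ^ n ∂P' = ∫ ω, ξ s(1, 2) ω ^ n ∂P := by
    rintro n (hn | rfl)
    · interval_cases n
      · simp
      · simp [hξ.mean_offDiag, hξ'.mean_offDiag]
      · exact h2
    · exact h4
  refine Finset.sum_congr rfl fun q _ => ?_
  have hp := q.isCLT_rep.passages q.fst_rep q.snd_rep
  rw [hξ.pairExpectation_eq_moments q.fst_rep q.snd_rep,
    hξ'.pairExpectation_eq_moments q.fst_rep q.snd_rep]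
  simp_rw [key _ (hp _).1, key _ (hp _).2.1, key _ (hp _).2.2]

lemma exists_abs_pairExpectation_le [IsProbabilityMeasure P] (hξ : IsWignerFamily ξ P)
    (k l : ℕ) : ∃ C : ℝ, ∀ a : WordPair k l, a.1.NoSelfEdgeLoop → a.2.NoSelfEdgeLoop →
      |pairExpectation ξ P a| ≤ C := by
  obtain ⟨C1, hC1⟩ := hξ.exists_integral_abs_centered_pow_le 2 k
  obtain ⟨C2, hC2⟩ := hξ.exists_integral_abs_centered_pow_le 2 l
  refine ⟨C1 + C2, fun a h1 h2 => ?_⟩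
  have m1 := hξ.hasAllMoments_centered a.1
  have m2 := hξ.hasAllMoments_centered a.2
  calc |pairExpectation ξ P a|
      ≤ ∫ ω, |centeredWordProd ξ P a.1 ω * centeredWordProd ξ P a.2 ω| ∂P :=
        abs_integral_le_integral_abs
    _ ≤ ∫ ω, (|centeredWordProd ξ P a.1 ω| ^ 2 + |centeredWordProd ξ P a.2 ω| ^ 2) ∂P := by
        refine integral_mono (m1.mul m2).abs.integrable
          ((m1.abs.pow 2).add (m2.abs.pow 2)).integrable fun ω => ?_
        simp only [abs_mul]
        nlinarith [sq_nonneg (|centeredWordProd ξ P a.1 ω| - |centeredWordProd ξ P a.2 ω|),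
          sq_nonneg (|centeredWordProd ξ P a.1 ω| + |centeredWordProd ξ P a.2 ω|)]
    _ = _ := integral_add (m1.abs.pow 2).integrable (m2.abs.pow 2).integrable
    _ ≤ C1 + C2 := add_le_add (hC1 _ h1) (hC2 _ h2)

lemma pairExpectation_eq_zero [IsProbabilityMeasure P] (hξ : IsWignerFamily ξ P)
    {a : WordPair k l} (h1 : a.1.NoSelfEdgeLoop) (h2 : a.2.NoSelfEdgeLoop)
    (h : ¬ a.IsWeakCLT) : pairExpectation ξ P a = 0 := by
  have hl : ¬ IsLinked a.family := by
    intro hl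
    refine h ⟨?_, ?_⟩
    · intro e he
      rw [← WordPair.sum_passages_family]
      exact hl.two_le e (by rwa [WordPair.familyEdges_family])
    · obtain ⟨j, hj, e, he1, he2⟩ := hl.shared 0
      obtain rfl : j = 1 := by omega
      exact ⟨e, Finset.mem_inter.2 ⟨he1, he2⟩⟩
  obtain ⟨i, hi⟩ := hξ.exists_null_of_not_isLinked (w := fun i => (a.family i).2)
    (WordPair.noSelfEdge_family h1 h2) hl
  have h3 := hi _ (Finset.mem_univ i)
  rw [jointMoment] at h3
  simp_rw [Fin.prod_univ_two] at h3
  exact h3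

open scoped Classical in
-- Group the CLT pairs by class; an equivalence between words starting at `1` fixes `1`, so the
-- members of a class correspond to injections of the other letters.
lemma sum_isCLT_eq [IsProbabilityMeasure P] (hξ : IsWignerFamily ξ P) {N : ℕ} (hN : 1 ≤ N) :
    ∑ a ∈ (noSelfEdgeWords N k ×ˢ noSelfEdgeWords N l).filter WordPair.IsCLT, pairExpectation ξ P a
      = ∑ q : CLTClass k l, pairExpectation ξ P q.rep * (N - 1).descFactorial (q.rep.wt - 1) := by
  have h1 : ∀ a ∈ (noSelfEdgeWords N k ×ˢ noSelfEdgeWords N l).filter WordPair.IsCLT,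
      pairExpectation ξ P a = ∑ q : CLTClass k l,
        if q.rep.Equivalent a then pairExpectation ξ P q.rep else 0 := by
    intro a ha
    rw [Finset.mem_filter, Finset.mem_product, mem_noSelfEdgeWords, mem_noSelfEdgeWords] at ha
    obtain ⟨⟨⟨_, hw1⟩, _, hw2⟩, hclt⟩ := ha
    have hwt := WordPair.two_mul_wt_eq_iff.1 hclt.2
    have hpos : 1 ≤ a.wt := Finset.card_pos.2 ⟨1, WordPair.one_mem_supp hw1⟩
    have hM : (k + l) / 2 = a.wt := by omega
    have h1M : (1 : ℕ+) ∈ letters a.wt := mem_letters.2 (by simpa using hpos)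
    -- A CLT pair has exactly `(k + l) / 2` letters, so it can be relabelled into the range where
    -- representatives are chosen.
    obtain ⟨f⟩ : Nonempty (a.supp.erase 1 ↪ (letters a.wt).erase 1) := by
      refine Function.Embedding.nonempty_of_card_le ?_
      rw [Fintype.card_coe, Fintype.card_coe, Finset.card_erase_of_mem h1M,
        Finset.card_erase_of_mem (WordPair.one_mem_supp hw1), card_letters, WordPair.wt]
    set b := WordPair.relabel (WordPair.extendOne f) a
    have hab : a.Equivalent b :=
      WordPair.equivalent_iff.2 ⟨_, WordPair.extendOne_injOn f, rfl⟩
    have hb : b ∈ cltPairs k l := by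
      rw [mem_cltPairs, hM]
      exact ⟨Finset.mem_product.1 (WordPair.relabel_mem hw1 hw2 hpos f),
        hclt.relabel (WordPair.extendOne_injOn f)⟩
    set q₀ : CLTClass k l := Quotient.mk (cltSetoid k l) ⟨b, hb⟩
    have hq₀ : q₀.rep.Equivalent b := Quotient.mk_out (s := cltSetoid k l) ⟨b, hb⟩
    have heq : q₀.rep.Equivalent a :=
      WordPair.equivalent_equivalence.trans hq₀ (WordPair.equivalent_equivalence.symm hab)
    rw [Finset.sum_eq_single_of_mem q₀ (Finset.mem_univ _), if_pos heq]
    · exact (hξ.pairExpectation_eq_of_equivalent q₀.fst_rep q₀.snd_rep hw1 hw2 heq).symm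
    · intro q _ hq
      refine if_neg fun h => hq ?_
      have h3 : q.rep.Equivalent q₀.rep :=
        WordPair.equivalent_equivalence.trans h (WordPair.equivalent_equivalence.symm heq)
      exact Quotient.out_equiv_out.1 h3
  rw [Finset.sum_congr rfl h1, Finset.sum_comm]
  refine Finset.sum_congr rfl fun q _ => ?_
  rw [← Finset.sum_filter, Finset.sum_const, nsmul_eq_mul, mul_comm,
    ← WordPair.card_equivalent q.fst_rep q.snd_rep hN, Finset.filter_filter]
  congr 3
  refine Finset.filter_congr fun a _ => ⟨fun h => h.2, fun h => ⟨?_, h⟩⟩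
  obtain ⟨f, hf, rfl⟩ := WordPair.equivalent_iff.1 h
  exact q.isCLT_rep.relabel hf

end IsWignerFamily

/-- The normalization `√N / N ^ (k / 2)` as a power of `N`. -/
lemma sqrt_mul_one_div_rpow {N : ℕ} (hN : 1 ≤ N) (k : ℕ) :
    √(N : ℝ) * (1 / (N : ℝ) ^ ((k : ℝ) / 2)) = (N : ℝ) ^ ((1 - k : ℝ) / 2) := by
  have h0 : (0 : ℝ) < N := by exact_mod_cast hN
  rw [Real.sqrt_eq_rpow, one_div ((N : ℝ) ^ ((k : ℝ) / 2)), ← Real.rpow_neg h0.le,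
    ← Real.rpow_add h0]
  congr 1
  ring

lemma Y_eq {N : ℕ} (hN : 1 ≤ N) (k : ℕ) (ω : Ω) :
    Y ξ P N k ω = (N : ℝ) ^ ((1 - k : ℝ) / 2)
      * ∑ w ∈ noSelfEdgeWords N k, centeredWordProd ξ P w ω := by
  rw [Y, ← mul_assoc, sqrt_mul_one_div_rpow hN]

lemma tendsto_natCast_rpow_zero {e : ℝ} (he : e < 0) :
    Tendsto (fun N : ℕ => (N : ℝ) ^ e) atTop (nhds 0) := by
  have := (tendsto_rpow_neg_atTop (neg_pos.2 he)).comp (tendsto_natCast_atTop_atTop (R := ℝ))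
  simpa [Function.comp_def] using this

namespace IsWignerFamily

lemma hasAllMoments_Y [IsFiniteMeasure P] (hξ : IsWignerFamily ξ P) (N k : ℕ) :
    HasAllMoments (Y ξ P N k) P :=
  ((HasAllMoments.sum _ fun w _ => hξ.hasAllMoments_centered w).const_mul _).const_mul _

lemma measurable_Y (hξ : IsWignerFamily ξ P) (N k : ℕ) : Measurable (Y ξ P N k) := by
  refine ((Finset.measurable_fun_sum _ fun w _ => ?_).const_mul _).const_mul _
  exact (measurable_centered (S := Set.univ) fun _ _ => Set.mem_univ _).mono
    (hξ.entriesSigma_le _) le_rfl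

lemma integral_Y [IsProbabilityMeasure P] (hξ : IsWignerFamily ξ P) (N k : ℕ) :
    ∫ ω, Y ξ P N k ω ∂P = 0 := by
  simp only [Y]
  rw [integral_const_mul, integral_const_mul,
    integral_finsetSum _ fun w _ => (hξ.hasAllMoments_centered w).integrable]
  simp [hξ.integral_centered]

lemma integral_Y_mul_Y [IsProbabilityMeasure P] (hξ : IsWignerFamily ξ P) {N : ℕ} (hN : 1 ≤ N)
    (k l : ℕ) :
    ∫ ω, Y ξ P N k ω * Y ξ P N l ω ∂P = (N : ℝ) ^ (1 - (k + l : ℝ) / 2)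
      * ∑ a ∈ noSelfEdgeWords N k ×ˢ noSelfEdgeWords N l, pairExpectation ξ P a := by
  have h0 : (0 : ℝ) < N := by exact_mod_cast hN
  have h1 : ∀ ω, Y ξ P N k ω * Y ξ P N l ω = (N : ℝ) ^ (1 - (k + l : ℝ) / 2)
      * ∑ a ∈ noSelfEdgeWords N k ×ˢ noSelfEdgeWords N l,
        centeredWordProd ξ P a.1 ω * centeredWordProd ξ P a.2 ω := by
    intro ω
    rw [Y_eq hN, Y_eq hN, mul_mul_mul_comm, ← Real.rpow_add h0, Finset.sum_mul_sum,
      ← Finset.sum_product']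
    congr 2
    ring
  simp_rw [h1]
  rw [integral_const_mul, integral_finsetSum _ fun a _ =>
    ((hξ.hasAllMoments_centered a.1).mul (hξ.hasAllMoments_centered a.2)).integrable]
  rfl

open scoped Classical in
-- The number `(k + l - 1) / 2` is the largest weight below `(k + l) / 2`; one is subtracted in the
-- exponent for the fixed letter `1`.
lemma card_small_pairs_le (N : ℕ) (hkl : 2 ≤ k + l) :
    ((noSelfEdgeWords N k ×ˢ noSelfEdgeWords N l).filter fun a => 2 * WordPair.wt a < k + l).card
      ≤ ((k + l - 1) / 2) ^ (k + l + 2) * N ^ ((k + l - 1) / 2 - 1) := by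
  by_cases hsmall : (k + l - 1) / 2 = 0
  · refine (Finset.card_eq_zero.2 (Finset.filter_eq_empty_iff.2 fun a ha hlt => ?_)).le.trans
      (Nat.zero_le _)
    rw [Finset.mem_product, mem_noSelfEdgeWords] at ha
    have hpos : 1 ≤ a.wt := Finset.card_pos.2 ⟨1, WordPair.one_mem_supp ha.1.2⟩
    omega
  have hr : (k + l - 1) / 2 = ((k + l - 1) / 2 - 1) + 1 := by omega
  have hcard : Fintype.card (Fin (k + 1) ⊕ Fin (l + 1)) = k + l + 2 := by
    simp
    omega
  have hinj : Function.Injective (WordPair.letter (k := k) (l := l)) := by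
    intro a b hab
    exact Prod.ext (funext fun i => congrFun hab (Sum.inl i))
      (funext fun i => congrFun hab (Sum.inr i))
  have := card_le_of_card_image_le
    ((noSelfEdgeWords N k ×ˢ noSelfEdgeWords N l).filter fun a => 2 * WordPair.wt a < k + l)
    WordPair.letter hinj (N := N) (r := (k + l - 1) / 2 - 1) ?_ ?_ ?_
  · rwa [hcard, ← hr] at this
  · intro a ha
    rw [Finset.mem_filter, Finset.mem_product, mem_noSelfEdgeWords, mem_noSelfEdgeWords] at ha
    rintro (i | i)
    · exact ha.1.1.1 i
    · exact ha.1.2.1 i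
  · intro a ha
    rw [Finset.mem_filter, Finset.mem_product, mem_noSelfEdgeWords] at ha
    exact ⟨Sum.inl 0, ha.1.1.2.1⟩
  · intro a ha
    have h2 := (Finset.mem_filter.1 ha).2
    rw [WordPair.wt, WordPair.supp_eq_image] at h2
    omega

/-- The covariances converge to `limitCov`. -/
theorem tendsto_integral_Y_mul_Y [IsProbabilityMeasure P] (hξ : IsWignerFamily ξ P)
    (hk : 2 ≤ k) (hl : 2 ≤ l) :
    Tendsto (fun N => ∫ ω, Y ξ P N k ω * Y ξ P N l ω ∂P) atTop (nhds (limitCov ξ P k l)) := by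
  classical
  obtain ⟨C₀, hC₀⟩ := hξ.exists_abs_pairExpectation_le k l
  obtain ⟨C, hC0, hC⟩ : ∃ C : ℝ, 0 ≤ C ∧ ∀ a : WordPair k l, a.1.NoSelfEdgeLoop →
      a.2.NoSelfEdgeLoop → |pairExpectation ξ P a| ≤ C :=
    ⟨|C₀|, abs_nonneg _, fun a h1 h2 => (hC₀ a h1 h2).trans (le_abs_self _)⟩
  set s : ℕ → Finset (WordPair k l) := fun N => noSelfEdgeWords N k ×ˢ noSelfEdgeWords N l with hs
  set r := (k + l - 1) / 2 - 1 with hr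
  have hmain : Tendsto (fun N : ℕ => (N : ℝ) ^ (1 - (k + l : ℝ) / 2)
      * ∑ a ∈ (s N).filter WordPair.IsCLT, pairExpectation ξ P a) atTop
      (nhds (limitCov ξ P k l)) := by
    have h1 : Tendsto (fun N : ℕ => ∑ q : CLTClass k l, pairExpectation ξ P q.rep
        * (((N - 1).descFactorial (q.rep.wt - 1) : ℝ) / (N : ℝ) ^ (q.rep.wt - 1))) atTop
        (nhds (∑ q : CLTClass k l, pairExpectation ξ P q.rep * 1)) :=
      tendsto_finsetSum _ fun q _ => tendsto_const_nhds.mul (tendsto_descFactorial_div_pow _)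
    simp_rw [mul_one] at h1
    refine h1.congr' ?_
    filter_upwards [eventually_ge_atTop 1] with N hN
    have h0 : (0 : ℝ) < N := by exact_mod_cast hN
    rw [hξ.sum_isCLT_eq hN, Finset.mul_sum]
    refine Finset.sum_congr rfl fun q _ => ?_
    have hwt := WordPair.two_mul_wt_eq_iff.1 q.isCLT_rep.2
    have hpos : 1 ≤ q.rep.wt := Finset.card_pos.2 ⟨1, WordPair.one_mem_supp q.fst_rep⟩
    have hexp : (1 - (k + l : ℝ) / 2) = -((q.rep.wt - 1 : ℕ) : ℝ) := by
      have h2 : (2 : ℝ) * q.rep.wt = k + l := by exact_mod_cast hwt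
      rw [Nat.cast_sub hpos, Nat.cast_one]
      linarith
    rw [hexp, Real.rpow_neg h0.le, Real.rpow_natCast]
    field_simp
  have hrest : Tendsto (fun N : ℕ => (N : ℝ) ^ (1 - (k + l : ℝ) / 2)
      * ∑ a ∈ (s N).filter (fun a => ¬ WordPair.IsCLT a), pairExpectation ξ P a) atTop (nhds 0) := by
    have hlim : Tendsto (fun N : ℕ => (C * ((k + l - 1) / 2 : ℕ) ^ (k + l + 2))
        * (N : ℝ) ^ (1 - (k + l : ℝ) / 2 + r)) atTop (nhds 0) := by
      have he : 1 - (k + l : ℝ) / 2 + r < 0 := by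
        -- The exponent of `N` is at most `-1/2`.
        have h2 : 2 * r + 3 ≤ k + l := by omega
        have h3 : (2 : ℝ) * r + 3 ≤ k + l := by exact_mod_cast h2
        linarith
      simpa using (tendsto_natCast_rpow_zero he).const_mul _
    refine squeeze_zero_norm' ?_ hlim
    filter_upwards [eventually_ge_atTop 1] with N hN
    have h0 : (0 : ℝ) < N := by exact_mod_cast hN
    have hns : ∀ a ∈ s N, a.1.NoSelfEdgeLoop ∧ a.2.NoSelfEdgeLoop := by
      intro a ha
      simp only [hs, Finset.mem_product, mem_noSelfEdgeWords] at ha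
      exact ⟨ha.1.2, ha.2.2⟩
    have h4 : ‖∑ a ∈ (s N).filter (fun a => ¬ WordPair.IsCLT a), pairExpectation ξ P a‖
        ≤ ((s N).filter fun a => 2 * WordPair.wt a < k + l).card * C := by
      have h5 : ∑ a ∈ (s N).filter (fun a => ¬ WordPair.IsCLT a), pairExpectation ξ P a
          = ∑ a ∈ (s N).filter (fun a => 2 * WordPair.wt a < k + l), pairExpectation ξ P a := by
        symm
        refine Finset.sum_subset_zero_on_sdiff ?_ ?_ fun _ _ => rfl
        · intro a ha
          rw [Finset.mem_filter] at ha ⊢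
          refine ⟨ha.1, fun hclt => ?_⟩
          have := WordPair.two_mul_wt_eq_iff.1 hclt.2
          omega
        · intro a ha
          rw [Finset.mem_sdiff, Finset.mem_filter, Finset.mem_filter] at ha
          obtain ⟨⟨has, hnot⟩, hbig⟩ := ha
          obtain ⟨hw1, hw2⟩ := hns a has
          refine hξ.pairExpectation_eq_zero hw1 hw2 fun hweak => ?_
          have h6 := hweak.two_mul_wt_le hw1 hw2
          have h7 : ¬ 2 * a.wt < k + l := fun h => hbig ⟨has, h⟩
          exact hnot ⟨hweak, WordPair.two_mul_wt_eq_iff.2 (by omega)⟩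
      rw [h5, ← nsmul_eq_mul]
      refine (norm_sum_le _ _).trans (Finset.sum_le_card_nsmul _ _ _ fun a ha => ?_)
      obtain ⟨hw1, hw2⟩ := hns a (Finset.mem_filter.1 ha).1
      exact hC a hw1 hw2
    have hcount : (((s N).filter fun a => 2 * WordPair.wt a < k + l).card : ℝ)
        ≤ ((k + l - 1) / 2 : ℕ) ^ (k + l + 2) * (N : ℝ) ^ r := by
      exact_mod_cast card_small_pairs_le (k := k) (l := l) N (by omega)
    rw [norm_mul, Real.norm_of_nonneg (by positivity), Real.rpow_add h0, Real.rpow_natCast]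
    calc _ ≤ (N : ℝ) ^ (1 - (k + l : ℝ) / 2)
          * ((((k + l - 1) / 2 : ℕ) ^ (k + l + 2) * (N : ℝ) ^ r) * C) := by
          refine mul_le_mul_of_nonneg_left (h4.trans ?_) (by positivity)
          exact mul_le_mul_of_nonneg_right hcount hC0
      _ = _ := by ring
  have hsum := hmain.add hrest
  rw [add_zero] at hsum
  refine hsum.congr' ?_
  filter_upwards [eventually_ge_atTop 1] with N hN
  rw [hξ.integral_Y_mul_Y hN, ← mul_add, Finset.sum_filter_add_sum_filter_not]

end IsWignerFamily

end Covariance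

/-! ### The asymptotic Wick formula -/

section Wick

variable {Ω : Type*} [MeasurableSpace Ω] {P : Measure Ω} {ξ : Sym2 ℕ+ → Ω → ℝ}

/-- Expansion of a product of two expectations of products of sums. -/
lemma integral_prod_sum_mul_integral_prod_sum [IsFiniteMeasure P] {ι : Type*} [Fintype ι]
    [DecidableEq ι] {α : ι → Type*} (S : ∀ i, Finset (α i)) (f : ∀ i, α i → Ω → ℝ)
    (hf : ∀ i x, HasAllMoments (f i x) P) (A : Finset ι) :
    (∫ ω, ∏ i ∈ A, ∑ x ∈ S i, f i x ω ∂P) * ∫ ω, ∏ i ∈ Aᶜ, ∑ x ∈ S i, f i x ω ∂P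
      = ∑ W ∈ Fintype.piFinset S,
        (∫ ω, ∏ i ∈ A, f i (W i) ω ∂P) * ∫ ω, ∏ i ∈ Aᶜ, f i (W i) ω ∂P := by
  have split : ∀ (g : ι → Ω → ℝ) (z : Ω × Ω), (∏ i ∈ A, g i z.1) * ∏ i ∈ Aᶜ, g i z.2
      = ∏ i, g i (if i ∈ A then z.1 else z.2) := by
    intro g z
    rw [← Finset.prod_mul_prod_compl A fun i => g i (if i ∈ A then z.1 else z.2)]
    congr 1
    · exact Finset.prod_congr rfl fun i hi => by rw [if_pos hi]
    · exact Finset.prod_congr rfl fun i hi => by rw [if_neg (Finset.mem_compl.1 hi)]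
  -- On `P × P` the two expectations become one, and the two products become a single product over
  -- all `i`, each factor evaluated at its own coordinate; it can then be expanded at once.
  simp_rw [← integral_prod_mul (μ := P) (ν := P)]
  rw [← integral_finsetSum]
  · refine integral_congr_ae (ae_of_all _ fun z => ?_)
    simp only
    rw [split fun i ω => ∑ x ∈ S i, f i x ω, Finset.prod_univ_sum]
    exact Finset.sum_congr rfl fun W _ => (split (fun i => f i (W i)) z).symm
  · intro W _
    exact (HasAllMoments.prod A fun i _ => hf i (W i)).integrable.mul_prod
      (HasAllMoments.prod Aᶜ fun i _ => hf i (W i)).integrable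

variable {ι : Type*} [Fintype ι] [DecidableEq ι]

/-- `E[∏_{i ∈ A} Y_{N, κ_i}]`. -/
def momentY (ξ : Sym2 ℕ+ → Ω → ℝ) (P : Measure Ω) (N : ℕ) (κ : ι → ℕ) (A : Finset ι) : ℝ :=
  ∫ ω, ∏ i ∈ A, Y ξ P N (κ i) ω ∂P

lemma IsWignerFamily.momentY_mul [IsProbabilityMeasure P] (hξ : IsWignerFamily ξ P) {N : ℕ}
    (hN : 1 ≤ N) (κ : ι → ℕ) (A : Finset ι) :
    momentY ξ P N κ A * momentY ξ P N κ Aᶜ = (N : ℝ) ^ (∑ i, (1 - κ i : ℝ) / 2)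
      * ∑ w ∈ Fintype.piFinset fun i => noSelfEdgeWords N (κ i),
        jointMoment ξ P w A * jointMoment ξ P w Aᶜ := by
  have h0 : (0 : ℝ) < N := by exact_mod_cast hN
  simp only [momentY, Y_eq hN, Finset.mul_sum]
  rw [integral_prod_sum_mul_integral_prod_sum (fun i => noSelfEdgeWords N (κ i))
    (fun i w ω => (N : ℝ) ^ ((1 - κ i : ℝ) / 2) * centeredWordProd ξ P w ω)
    (fun i w => (hξ.hasAllMoments_centered w).const_mul _)]
  refine Finset.sum_congr rfl fun w _ => ?_
  simp_rw [Finset.prod_mul_distrib]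
  rw [integral_const_mul, integral_const_mul, mul_mul_mul_comm,
    Finset.prod_mul_prod_compl A fun i => (N : ℝ) ^ ((1 - κ i : ℝ) / 2),
    Real.rpow_sum_of_pos h0]
  rfl

/-- The words are linked, and one of them shares edges with two others. -/
def IsEntangled {κ : ι → ℕ} (w : ∀ i, Word (κ i)) : Prop :=
  IsLinked (fun i => (⟨κ i, w i⟩ : Σ k, Word k)) ∧
    ∃ i j₁ j₂, j₁ ≠ i ∧ j₂ ≠ i ∧ j₁ ≠ j₂ ∧ (∃ e, e ∈ (w i).edges ∧ e ∈ (w j₁).edges) ∧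
      ∃ e, e ∈ (w i).edges ∧ e ∈ (w j₂).edges

open scoped Classical in
/-- With `n` words of total length `L`, there are `O(N ^ ((L - n - 1) / 2))` entangled families. -/
lemma card_isEntangled_le [Nonempty ι] (κ : ι → ℕ) (N : ℕ) :
    ((Fintype.piFinset fun i => noSelfEdgeWords N (κ i)).filter IsEntangled).card
      ≤ ((∑ i, κ i + 1 - Fintype.card ι) / 2) ^ Fintype.card (Σ i, Fin (κ i + 1))
        * N ^ ((∑ i, κ i + 1 - Fintype.card ι) / 2 - 1) := by
  have hns : ∀ w ∈ (Fintype.piFinset fun i => noSelfEdgeWords N (κ i)).filter IsEntangled,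
      (∀ i, (∀ j, w i j ∈ letters N) ∧ (w i).NoSelfEdgeLoop) ∧ IsEntangled w := by
    intro w hw
    rw [Finset.mem_filter, Fintype.mem_piFinset] at hw
    exact ⟨fun i => mem_noSelfEdgeWords.1 (hw.1 i), hw.2⟩
  have himage : ∀ w : ∀ i, Word (κ i),
      Finset.univ.image (fun x : Σ i, Fin (κ i + 1) => w x.1 x.2)
        = familySupp fun i => (⟨κ i, w i⟩ : Σ k, Word k) := by
    intro w
    ext v
    simp [familySupp, Word.supp]
  have hcard : ∀ w ∈ (Fintype.piFinset fun i => noSelfEdgeWords N (κ i)).filter IsEntangled,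
      (familySupp fun i => (⟨κ i, w i⟩ : Σ k, Word k)).card
        ≤ (∑ i, κ i + 1 - Fintype.card ι) / 2 := by
    intro w hw
    obtain ⟨hw1, hl, i, j₁, j₂, h1, h2, h12, he1, he2⟩ := hns w hw
    have := hl.two_mul_card_supp_lt (fun i => (hw1 i).2) h1 h2 h12 he1 he2
    simp only at this
    omega
  have i₀ : ι := Classical.arbitrary ι
  by_cases hsmall : (∑ i, κ i + 1 - Fintype.card ι) / 2 = 0
  · refine (Finset.card_eq_zero.2 (Finset.eq_empty_of_forall_notMem fun w hw => ?_)).le.trans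
      (Nat.zero_le _)
    have h1 := hcard w hw
    have hpos : 0 < (familySupp fun i => (⟨κ i, w i⟩ : Σ k, Word k)).card :=
      Finset.card_pos.2 ⟨w i₀ 0, mem_familySupp (fun i => (⟨κ i, w i⟩ : Σ k, Word k)) i₀ 0⟩
    omega
  have hr : (∑ i, κ i + 1 - Fintype.card ι) / 2
      = ((∑ i, κ i + 1 - Fintype.card ι) / 2 - 1) + 1 := by omega
  have hinj : Function.Injective
      fun (w : ∀ i, Word (κ i)) (x : Σ i, Fin (κ i + 1)) => w x.1 x.2 := by
    intro w w' h
    funext i j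
    exact congrFun h ⟨i, j⟩
  have := card_le_of_card_image_le
    ((Fintype.piFinset fun i => noSelfEdgeWords N (κ i)).filter IsEntangled) _ hinj (N := N)
    (r := (∑ i, κ i + 1 - Fintype.card ι) / 2 - 1) ?_ ?_ ?_
  · rwa [← hr] at this
  · rintro w hw ⟨i, j⟩
    exact ((hns w hw).1 i).1 j
  · intro w hw
    exact ⟨⟨i₀, 0⟩, ((hns w hw).1 i₀).2.1⟩
  · intro w hw
    rw [himage, ← hr]
    exact hcard w hw

/-- The asymptotic Wick formula for the joint moments of the `Y_{N, k}`. -/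
theorem IsWignerFamily.tendsto_momentY_sub [IsProbabilityMeasure P] (hξ : IsWignerFamily ξ P)
    (κ : ι → ℕ) (i₀ : ι) :
    Tendsto (fun N => momentY ξ P N κ Finset.univ
      - ∑ j ∈ Finset.univ.erase i₀, momentY ξ P N κ {i₀, j} * momentY ξ P N κ {i₀, j}ᶜ) atTop
      (nhds 0) := by
  classical
  have : Nonempty ι := ⟨i₀⟩
  choose C hC using fun J : Finset ι => hξ.exists_abs_jointMoment_le κ J
  set D : ℝ := |C Finset.univ| + ∑ j ∈ Finset.univ.erase i₀, |C {i₀, j}| * |C {i₀, j}ᶜ| with hD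
  have hD0 : 0 ≤ D := by positivity
  set Δ : (∀ i, Word (κ i)) → ℝ := fun w => jointMoment ξ P w Finset.univ
    - ∑ j ∈ Finset.univ.erase i₀, jointMoment ξ P w {i₀, j} * jointMoment ξ P w {i₀, j}ᶜ with hΔ
  have hΔle : ∀ w : ∀ i, Word (κ i), (∀ i, (w i).NoSelfEdgeLoop) → |Δ w| ≤ D := by
    intro w hw
    refine (abs_sub _ _).trans (add_le_add ((hC _ w hw).trans (le_abs_self _)) ?_)
    refine (Finset.abs_sum_le_sum_abs _ _).trans (Finset.sum_le_sum fun j _ => ?_)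
    rw [abs_mul]
    exact mul_le_mul ((hC _ w hw).trans (le_abs_self _)) ((hC _ w hw).trans (le_abs_self _))
      (abs_nonneg _) (abs_nonneg _)
  have hΔ0 : ∀ w : ∀ i, Word (κ i), (∀ i, (w i).NoSelfEdgeLoop) → ¬ IsEntangled w → Δ w = 0 :=
    fun w hw h => sub_eq_zero.2 (hξ.jointMoment_univ_eq hw i₀ h)
  set S := fun N => Fintype.piFinset fun i => noSelfEdgeWords N (κ i)
  have hS : ∀ N, ∀ w ∈ S N, ∀ i, (w i).NoSelfEdgeLoop := fun N w hw i =>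
    (mem_noSelfEdgeWords.1 (Fintype.mem_piFinset.1 hw i)).2
  have hexp : ∀ N : ℕ, 1 ≤ N → momentY ξ P N κ Finset.univ
      - ∑ j ∈ Finset.univ.erase i₀, momentY ξ P N κ {i₀, j} * momentY ξ P N κ {i₀, j}ᶜ
      = (N : ℝ) ^ (∑ i, (1 - κ i : ℝ) / 2) * ∑ w ∈ (S N).filter IsEntangled, Δ w := by
    intro N hN
    have huniv := hξ.momentY_mul hN κ Finset.univ
    have h1 : momentY ξ P N κ Finset.univᶜ = 1 := by simp [momentY]
    have h2 : ∀ w : ∀ i, Word (κ i), jointMoment ξ P w Finset.univᶜ = 1 := fun w => by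
      simp [jointMoment]
    simp only [h1, h2, mul_one] at huniv
    rw [huniv]
    simp_rw [hξ.momentY_mul hN κ]
    rw [← Finset.mul_sum, ← mul_sub, Finset.sum_comm, ← Finset.sum_sub_distrib]
    congr 1
    symm
    refine Finset.sum_subset_zero_on_sdiff (Finset.filter_subset _ _) ?_ fun _ _ => rfl
    intro w hw
    rw [Finset.mem_sdiff, Finset.mem_filter] at hw
    exact hΔ0 w (hS N w hw.1) fun h => hw.2 ⟨hw.1, h⟩
  set r' := (∑ i, κ i + 1 - Fintype.card ι) / 2 with hr'
  set M := Fintype.card (Σ i, Fin (κ i + 1)) with hM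
  have hMpos : M ≠ 0 := (Fintype.card_pos_iff.2 ⟨⟨i₀, 0⟩⟩).ne'
  have hlim : Tendsto (fun N : ℕ => (D * (r' : ℝ) ^ M)
      * (N : ℝ) ^ (∑ i, (1 - κ i : ℝ) / 2 + (r' - 1 : ℕ))) atTop (nhds 0) := by
    -- For `r' = 0` the truncated exponent `r' - 1` is not the true one, but the factor `r' ^ M`
    -- vanishes since `M ≠ 0`.
    by_cases h0 : r' = 0
    · simp [h0, hMpos]
    have he : ∑ i, (1 - κ i : ℝ) / 2 + (r' - 1 : ℕ) < 0 := by
      rw [← Finset.sum_div, Finset.sum_sub_distrib, Finset.sum_const, Finset.card_univ,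
        nsmul_eq_mul, mul_one]
      have h2 : 2 * (r' - 1) + 1 + Fintype.card ι ≤ ∑ i, κ i := by omega
      have h3 : (2 : ℝ) * (r' - 1 : ℕ) + 1 + Fintype.card ι ≤ ∑ i, (κ i : ℝ) := by
        exact_mod_cast h2
      linarith
    simpa using (tendsto_natCast_rpow_zero he).const_mul _
  refine squeeze_zero_norm' ?_ hlim
  filter_upwards [eventually_ge_atTop 1] with N hN
  have h0 : (0 : ℝ) < N := by exact_mod_cast hN
  rw [hexp N hN, norm_mul, Real.norm_of_nonneg (by positivity), Real.rpow_add h0,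
    Real.rpow_natCast]
  have h4 : ‖∑ w ∈ (S N).filter IsEntangled, Δ w‖ ≤ ((S N).filter IsEntangled).card * D := by
    rw [← nsmul_eq_mul]
    refine (norm_sum_le _ _).trans (Finset.sum_le_card_nsmul _ _ _ fun w hw => ?_)
    exact hΔle w (hS N w (Finset.mem_filter.1 hw).1)
  have hcount : (((S N).filter IsEntangled).card : ℝ) ≤ (r' : ℝ) ^ M * (N : ℝ) ^ (r' - 1) := by
    exact_mod_cast card_isEntangled_le κ N
  calc _ ≤ (N : ℝ) ^ (∑ i, (1 - κ i : ℝ) / 2) * (((r' : ℝ) ^ M * (N : ℝ) ^ (r' - 1)) * D) := by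
        refine mul_le_mul_of_nonneg_left (h4.trans ?_) (by positivity)
        exact mul_le_mul_of_nonneg_right hcount hD0
    _ = _ := by ring

end Wick

/-! ### Gaussian moments of linear combinations -/

section LinearCombinations

variable {Ω : Type*} [MeasurableSpace Ω] {P : Measure Ω} {ξ : Sym2 ℕ+ → Ω → ℝ}

/-- The linear combinations `∑_k t_k Y_{N, k}`. -/
def combY (ξ : Sym2 ℕ+ → Ω → ℝ) (P : Measure Ω) (s : Finset ℕ) (t : ℕ → ℝ) (N : ℕ) (ω : Ω) : ℝ :=
  ∑ k ∈ s, t k * Y ξ P N k ω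

/-- The moments of the centered Gaussian law of variance `v`. -/
def gaussianMoment (v : ℝ) : ℕ → ℝ
  | 0 => 1
  | 1 => 0
  | n + 2 => (n + 1) * v * gaussianMoment v n

namespace IsWignerFamily

lemma hasAllMoments_combY [IsFiniteMeasure P] (hξ : IsWignerFamily ξ P) (s : Finset ℕ)
    (t : ℕ → ℝ) (N : ℕ) : HasAllMoments (combY ξ P s t N) P :=
  HasAllMoments.sum _ fun _ _ => (hξ.hasAllMoments_Y N _).const_mul _

lemma integral_combY [IsProbabilityMeasure P] (hξ : IsWignerFamily ξ P) (s : Finset ℕ)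
    (t : ℕ → ℝ) (N : ℕ) : ∫ ω, combY ξ P s t N ω ∂P = 0 := by
  simp only [combY]
  rw [integral_finsetSum _ fun k _ => ((hξ.hasAllMoments_Y N k).const_mul (t k)).integrable]
  simp [integral_const_mul, hξ.integral_Y]

lemma tendsto_integral_combY_sq [IsProbabilityMeasure P] (hξ : IsWignerFamily ξ P)
    {s : Finset ℕ} (hs : ∀ k ∈ s, 2 ≤ k) (t : ℕ → ℝ) :
    Tendsto (fun N => ∫ ω, combY ξ P s t N ω ^ 2 ∂P) atTop
      (nhds (∑ k ∈ s, ∑ l ∈ s, t k * t l * limitCov ξ P k l)) := by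
  have h : ∀ N, ∫ ω, combY ξ P s t N ω ^ 2 ∂P
      = ∑ k ∈ s, ∑ l ∈ s, t k * t l * ∫ ω, Y ξ P N k ω * Y ξ P N l ω ∂P := by
    intro N
    have hint : ∀ k l, HasAllMoments (fun ω => t k * t l * (Y ξ P N k ω * Y ξ P N l ω)) P :=
      fun k l => ((hξ.hasAllMoments_Y N k).mul (hξ.hasAllMoments_Y N l)).const_mul _
    have h1 : ∀ ω, combY ξ P s t N ω ^ 2
        = ∑ k ∈ s, ∑ l ∈ s, t k * t l * (Y ξ P N k ω * Y ξ P N l ω) := by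
      intro ω
      rw [combY, sq, Finset.sum_mul_sum]
      exact Finset.sum_congr rfl fun k _ => Finset.sum_congr rfl fun l _ => by ring
    simp_rw [h1]
    rw [integral_finsetSum _ fun k _ => (HasAllMoments.sum s fun l _ => hint k l).integrable]
    refine Finset.sum_congr rfl fun k _ => ?_
    rw [integral_finsetSum _ fun l _ => (hint k l).integrable]
    exact Finset.sum_congr rfl fun l _ => integral_const_mul _ _
  simp_rw [h]
  exact tendsto_finsetSum _ fun k hk => tendsto_finsetSum _ fun l hl =>
    (hξ.tendsto_integral_Y_mul_Y (hs k hk) (hs l hl)).const_mul _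

lemma tendsto_integral_combY_pow_sub [IsProbabilityMeasure P] (hξ : IsWignerFamily ξ P)
    (s : Finset ℕ) (t : ℕ → ℝ) (n : ℕ) :
    Tendsto (fun N => ∫ ω, combY ξ P s t N ω ^ (n + 2) ∂P
      - (n + 1) * ((∫ ω, combY ξ P s t N ω ^ 2 ∂P) * ∫ ω, combY ξ P s t N ω ^ n ∂P)) atTop
      (nhds 0) := by
  have hexp : ∀ N (A : Finset (Fin (n + 2))),
      (∫ ω, combY ξ P s t N ω ^ A.card ∂P) * ∫ ω, combY ξ P s t N ω ^ Aᶜ.card ∂P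
        = ∑ κ ∈ Fintype.piFinset fun _ : Fin (n + 2) => s,
          (∏ i, t (κ i)) * (momentY ξ P N κ A * momentY ξ P N κ Aᶜ) := by
    intro N A
    have h := integral_prod_sum_mul_integral_prod_sum (P := P) (fun _ : Fin (n + 2) => s)
      (fun _ k ω => t k * Y ξ P N k ω) (fun _ k => (hξ.hasAllMoments_Y N k).const_mul _) A
    simp only [Finset.prod_const] at h
    simp only [combY]
    rw [h]
    refine Finset.sum_congr rfl fun κ _ => ?_
    simp_rw [Finset.prod_mul_distrib]
    rw [integral_const_mul, integral_const_mul, mul_mul_mul_comm,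
      Finset.prod_mul_prod_compl A fun i => t (κ i)]
    rfl
  have hlim : Tendsto (fun N => ∑ κ ∈ Fintype.piFinset fun _ : Fin (n + 2) => s,
      (∏ i, t (κ i)) * (momentY ξ P N κ Finset.univ
        - ∑ j ∈ Finset.univ.erase 0, momentY ξ P N κ {0, j} * momentY ξ P N κ {0, j}ᶜ)) atTop
      (nhds (∑ κ ∈ Fintype.piFinset fun _ : Fin (n + 2) => s, (∏ i, t (κ i)) * 0)) :=
    tendsto_finsetSum _ fun κ _ => (hξ.tendsto_momentY_sub κ 0).const_mul _
  simp only [mul_zero, Finset.sum_const_zero] at hlim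
  refine hlim.congr fun N => ?_
  have huniv := hexp N Finset.univ
  have h1 : ∀ κ : Fin (n + 2) → ℕ, momentY ξ P N κ ∅ = 1 := fun κ => by
    simp [momentY]
  simp only [h1, mul_one, Finset.card_univ, Fintype.card_fin, Finset.compl_univ, Finset.card_empty,
    pow_zero, integral_const, probReal_univ, smul_eq_mul] at huniv
  have hpair : ∀ j ∈ Finset.univ.erase (0 : Fin (n + 2)),
      ∑ κ ∈ Fintype.piFinset fun _ : Fin (n + 2) => s,
          (∏ i, t (κ i)) * (momentY ξ P N κ {0, j} * momentY ξ P N κ {0, j}ᶜ)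
        = (∫ ω, combY ξ P s t N ω ^ 2 ∂P) * ∫ ω, combY ξ P s t N ω ^ n ∂P := by
    intro j hj
    have hj0 : (0 : Fin (n + 2)) ≠ j := (Finset.ne_of_mem_erase hj).symm
    have h2 := hexp N {0, j}
    rw [Finset.card_compl, Finset.card_pair hj0, Fintype.card_fin, Nat.add_sub_cancel] at h2
    exact h2.symm
  -- After summation over `κ`, each of the `n + 1` possible partners of the index `0` gives the same
  -- term.
  simp_rw [mul_sub, Finset.sum_sub_distrib, Finset.mul_sum]
  rw [Finset.sum_comm (t := Finset.univ.erase (0 : Fin (n + 2))), Finset.sum_congr rfl hpair,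
    Finset.sum_const, Finset.card_erase_of_mem (Finset.mem_univ _), Finset.card_univ,
    Fintype.card_fin, nsmul_eq_mul, huniv]
  simp

/-- All moments of the linear combinations converge to Gaussian moments. -/
theorem tendsto_integral_combY_pow [IsProbabilityMeasure P] (hξ : IsWignerFamily ξ P)
    {s : Finset ℕ} (hs : ∀ k ∈ s, 2 ≤ k) (t : ℕ → ℝ) (n : ℕ) :
    Tendsto (fun N => ∫ ω, combY ξ P s t N ω ^ n ∂P) atTop
      (nhds (gaussianMoment (∑ k ∈ s, ∑ l ∈ s, t k * t l * limitCov ξ P k l) n)) := by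
  induction n using Nat.twoStepInduction with
  | zero => simp [gaussianMoment]
  | one => simp [gaussianMoment, hξ.integral_combY]
  | more n ih _ =>
    have h1 := (hξ.tendsto_integral_combY_pow_sub s t n).add
      (((hξ.tendsto_integral_combY_sq hs t).mul ih).const_mul ((n : ℝ) + 1))
    simp only [sub_add_cancel, zero_add] at h1
    rw [gaussianMoment, mul_assoc]
    exact h1

end IsWignerFamily

end LinearCombinations

/-! ### From moments to characteristic functions -/

section MomentMethod

/-- The remainder of order `n + 1` vanishes at `0`, and its derivative is `i` times the remainder of
order `n`; compare with the integrated bound. -/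
lemma norm_exp_I_mul_sub_sum_le_of_nonneg (n : ℕ) {x : ℝ} (hx : 0 ≤ x) :
    ‖Complex.exp (Complex.I * x)
      - ∑ j ∈ Finset.range n, (Complex.I * x) ^ j / (j.factorial : ℂ)‖ ≤ x ^ n / n.factorial := by
  induction n generalizing x with
  | zero => simp [Complex.norm_exp_I_mul_ofReal]
  | succ n ih =>
    have hf : ∀ y : ℝ, HasDerivAt (fun y : ℝ => Complex.exp (Complex.I * y)
        - ∑ j ∈ Finset.range (n + 1), (Complex.I * y) ^ j / (j.factorial : ℂ))
        (Complex.I * (Complex.exp (Complex.I * y)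
          - ∑ j ∈ Finset.range n, (Complex.I * y) ^ j / (j.factorial : ℂ))) y := by
      intro y
      have h1 : HasDerivAt (fun y : ℝ => Complex.I * (y : ℂ)) Complex.I y := by
        simpa using (Complex.ofRealCLM.hasDerivAt (x := y)).const_mul Complex.I
      have h2 : HasDerivAt (fun y : ℝ => ∑ j ∈ Finset.range (n + 1),
          (Complex.I * (y : ℂ)) ^ j / (j.factorial : ℂ))
          (Complex.I * ∑ j ∈ Finset.range n, (Complex.I * y) ^ j / (j.factorial : ℂ)) y := by
        simp_rw [Finset.sum_range_succ' _ n, Finset.mul_sum]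
        simp only [pow_zero]
        refine HasDerivAt.add_const _ (HasDerivAt.fun_sum fun j _ => ?_)
        have := (h1.pow (j + 1)).div_const ((j + 1).factorial : ℂ)
        refine this.congr_deriv ?_
        rw [Nat.factorial_succ]
        have h0 : ((j : ℂ) + 1) ≠ 0 := by exact_mod_cast j.succ_ne_zero
        have h0' : (j.factorial : ℂ) ≠ 0 := by exact_mod_cast j.factorial_ne_zero
        push_cast
        field_simp
      have h3 := h1.cexp.sub h2
      exact h3.congr_deriv (by ring)
    have hB : ∀ y : ℝ, HasDerivAt (fun y : ℝ => y ^ (n + 1) / ((n + 1).factorial : ℝ))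
        (y ^ n / n.factorial) y := by
      intro y
      have := (hasDerivAt_pow (n + 1) y).div_const ((n + 1).factorial : ℝ)
      refine this.congr_deriv ?_
      rw [Nat.factorial_succ]
      have h0 : ((n : ℝ) + 1) ≠ 0 := by exact_mod_cast n.succ_ne_zero
      have h0' : (n.factorial : ℝ) ≠ 0 := by exact_mod_cast n.factorial_ne_zero
      push_cast
      field_simp
    refine image_norm_le_of_norm_deriv_right_le_deriv_boundary (a := 0) (b := x)
      (fun y _ => (hf y).continuousAt.continuousWithinAt)
      (fun y _ => (hf y).hasDerivWithinAt) ?_ hB (fun y hy => ?_) ⟨hx, le_rfl⟩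
    · simp [Finset.sum_range_succ']
    · rw [norm_mul, Complex.norm_I, one_mul]
      exact ih hy.1

/-- Taylor's formula for `x ↦ exp (i x)`. -/
lemma norm_exp_I_mul_sub_sum_le (n : ℕ) (x : ℝ) :
    ‖Complex.exp (Complex.I * x)
      - ∑ j ∈ Finset.range n, (Complex.I * x) ^ j / (j.factorial : ℂ)‖
      ≤ |x| ^ n / n.factorial := by
  rcases le_total 0 x with hx | hx
  · rw [abs_of_nonneg hx]
    exact norm_exp_I_mul_sub_sum_le_of_nonneg n hx
  · rw [abs_of_nonpos hx]
    refine le_trans (le_of_eq ?_) (norm_exp_I_mul_sub_sum_le_of_nonneg n (neg_nonneg.2 hx))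
    rw [← Complex.norm_conj]
    simp [← Complex.exp_conj, map_sum]

lemma gaussianMoment_two_mul_div_factorial (v : ℝ) (m : ℕ) :
    gaussianMoment v (2 * m) / (2 * m).factorial = (v / 2) ^ m / m.factorial ∧
      gaussianMoment v (2 * m + 1) = 0 := by
  induction m with
  | zero => simp [gaussianMoment]
  | succ m ih =>
    rw [show 2 * (m + 1) + 1 = 2 * m + 1 + 2 by ring, show 2 * (m + 1) = 2 * m + 2 by ring]
    refine ⟨?_, by simp [gaussianMoment, ih.2]⟩
    have h1 : ((2 * m).factorial : ℝ) ≠ 0 := by exact_mod_cast Nat.factorial_ne_zero _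
    have h2 : (m.factorial : ℝ) ≠ 0 := by exact_mod_cast Nat.factorial_ne_zero _
    have h3 : (m : ℝ) + 1 ≠ 0 := by positivity
    have h4 : (2 * (m : ℝ) + 1) ≠ 0 := by positivity
    have h5 : (2 * (m : ℝ) + 2) ≠ 0 := by positivity
    have key := ih.1
    rw [div_eq_div_iff h1 h2] at key
    simp only [gaussianMoment, Nat.factorial_succ, pow_succ]
    push_cast
    rw [div_eq_div_iff (by positivity) (by positivity)]
    linear_combination (2 * (m:ℝ) + 1) * v * ((m:ℝ) + 1) * key

lemma sum_I_pow_mul_gaussianMoment (v : ℝ) (m : ℕ) :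
    ∑ j ∈ Finset.range (2 * m), Complex.I ^ j * (gaussianMoment v j : ℂ) / (j.factorial : ℂ)
      = ∑ j ∈ Finset.range m, ((-v / 2 : ℝ) : ℂ) ^ j / (j.factorial : ℂ) := by
  induction m with
  | zero => simp
  | succ m ih =>
    rw [show 2 * (m + 1) = 2 * m + 1 + 1 by ring, Finset.sum_range_succ, Finset.sum_range_succ, ih,
      Finset.sum_range_succ, (gaussianMoment_two_mul_div_factorial v m).2]
    have key : ((gaussianMoment v (2 * m) / (2 * m).factorial : ℝ) : ℂ)
        = (((v / 2) ^ m / m.factorial : ℝ) : ℂ) := by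
      rw [(gaussianMoment_two_mul_div_factorial v m).1]
    push_cast at key
    rw [mul_div_assoc, key, pow_mul, Complex.I_sq]
    push_cast
    rw [neg_div, neg_pow ((v : ℂ) / 2)]
    ring

/-- The method of moments for centered Gaussian limits, at the level of characteristic functions. -/
theorem tendsto_integral_exp_I_mul_of_moments {Ω : Type*} [MeasurableSpace Ω] {P : Measure Ω}
    [IsProbabilityMeasure P] {Z : ℕ → Ω → ℝ} (hZ : ∀ N, HasAllMoments (Z N) P)
    {v : ℝ} (h : ∀ n, Tendsto (fun N => ∫ ω, Z N ω ^ n ∂P) atTop (nhds (gaussianMoment v n))) :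
    Tendsto (fun N => ∫ ω, Complex.exp (Complex.I * Z N ω) ∂P) atTop
      (nhds (Complex.exp ((-v / 2 : ℝ) : ℂ))) := by
  have hpow : ∀ N n, Integrable (fun ω => Z N ω ^ n) P := fun N n => ((hZ N).pow n).integrable
  have hexp : ∀ N, Integrable (fun ω => Complex.exp (Complex.I * Z N ω)) P := by
    intro N
    refine Integrable.of_bound (C := 1) ?_ (ae_of_all _ fun ω => ?_)
    · have := (hZ N).integrable.aestronglyMeasurable
      fun_prop
    · rw [Complex.norm_exp_I_mul_ofReal]
  set S : ℕ → ℕ → ℂ := fun m N => ∑ j ∈ Finset.range (2 * m),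
    Complex.I ^ j * ((∫ ω, Z N ω ^ j ∂P : ℝ) : ℂ) / (j.factorial : ℂ) with hS
  have hbound : ∀ m N, ‖∫ ω, Complex.exp (Complex.I * Z N ω) ∂P - S m N‖
      ≤ (∫ ω, Z N ω ^ (2 * m) ∂P) / (2 * m).factorial := by
    intro m N
    have hint : ∀ j ∈ Finset.range (2 * m), Integrable
        (fun ω => (Complex.I * (Z N ω : ℂ)) ^ j / (j.factorial : ℂ)) P := by
      intro j _
      have := ((hpow N j).ofReal (𝕜 := ℂ)).const_mul (Complex.I ^ j / (j.factorial : ℂ))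
      refine this.congr (ae_of_all _ fun ω => ?_)
      simp only [RCLike.ofReal_pow, Complex.coe_algebraMap, mul_pow]
      ring
    have hSm : S m N = ∫ ω, ∑ j ∈ Finset.range (2 * m),
        (Complex.I * (Z N ω : ℂ)) ^ j / (j.factorial : ℂ) ∂P := by
      rw [integral_finsetSum _ hint]
      refine Finset.sum_congr rfl fun j _ => ?_
      rw [← integral_complex_ofReal, mul_div_right_comm, ← integral_const_mul]
      refine integral_congr_ae (ae_of_all _ fun ω => ?_)
      simp only [mul_pow]
      push_cast
      ring
    rw [hSm, ← integral_sub (hexp N) (integrable_finsetSum _ hint), ← integral_div]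
    refine norm_integral_le_of_norm_le ((hpow N (2 * m)).div_const _) (ae_of_all _ fun ω => ?_)
    rw [← (even_two_mul m).pow_abs]
    exact norm_exp_I_mul_sub_sum_le (2 * m) (Z N ω)
  have hSlim : ∀ m, Tendsto (S m) atTop
      (nhds (∑ j ∈ Finset.range m, ((-v / 2 : ℝ) : ℂ) ^ j / (j.factorial : ℂ))) := by
    intro m
    rw [← sum_I_pow_mul_gaussianMoment]
    refine tendsto_finsetSum _ fun j _ => Tendsto.div_const (Tendsto.const_mul _ ?_) _
    exact (Complex.continuous_ofReal.tendsto _).comp (h j)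
  have hexpsum : Tendsto (fun m => ∑ j ∈ Finset.range m,
      ((-v / 2 : ℝ) : ℂ) ^ j / (j.factorial : ℂ)) atTop
      (nhds (Complex.exp ((-v / 2 : ℝ) : ℂ))) := by
    rw [Complex.exp_eq_exp_ℂ]
    exact (NormedSpace.expSeries_div_hasSum_exp ((-v / 2 : ℝ) : ℂ)).tendsto_sum_nat
  have herr : Tendsto (fun m : ℕ => (v / 2) ^ m / (m.factorial : ℝ)) atTop (nhds 0) :=
    FloorSemiring.tendsto_pow_div_factorial_atTop _
  rw [Metric.tendsto_atTop]
  intro ε hε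
  -- First fix the order `2 * m` from the limiting Gaussian moments, then let `N` grow: the Taylor
  -- remainder tends to `(v / 2) ^ m / m!`, which is already small.
  obtain ⟨m, hm1, hm2⟩ := ((Metric.tendsto_nhds.1 hexpsum (ε / 3) (by positivity)).and
    (herr.eventually_lt_const (show 0 < ε / 3 by positivity))).exists
  have h3 := (h (2 * m)).div_const ((2 * m).factorial : ℝ)
  rw [(gaussianMoment_two_mul_div_factorial v m).1] at h3
  obtain ⟨N₀, hN₀⟩ := eventually_atTop.1 ((Metric.tendsto_nhds.1 (hSlim m) (ε / 3)
    (by positivity)).and (h3.eventually_lt_const hm2))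
  refine ⟨N₀, fun N hN => ?_⟩
  obtain ⟨h4, h5⟩ := hN₀ N hN
  have h6 := (hbound m N).trans_lt h5
  rw [← dist_eq_norm] at h6
  linarith [dist_triangle4 (∫ ω, Complex.exp (Complex.I * Z N ω) ∂P) (S m N)
    (∑ j ∈ Finset.range m, ((-v / 2 : ℝ) : ℂ) ^ j / (j.factorial : ℂ)) (Complex.exp ((-v / 2 : ℝ) : ℂ))]

end MomentMethod

/-! ### Gaussian sequences with prescribed covariance -/

section GaussianSequence

/-- A Cholesky decomposition of an infinite positive semidefinite matrix. -/
lemma exists_lower_triangular_factor {D : ℕ → ℕ → ℝ} (hsymm : ∀ m n, D m n = D n m)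
    (hpsd : ∀ (s : Finset ℕ) (t : ℕ → ℝ), 0 ≤ ∑ m ∈ s, ∑ n ∈ s, t m * t n * D m n) :
    ∃ c : ℕ → ℕ → ℝ, ∀ m n, D m n = ∑ i ∈ Finset.range (m + 1), ∑ j ∈ Finset.range (n + 1),
      c m i * c n j * if i = j then 1 else 0 := by
  -- The reproducing kernel Hilbert space of `D` realizes it as the Gram matrix of the kernel
  -- functions `f n`; Gram–Schmidt then gives the triangular factor.
  set K : Matrix ℕ ℕ (ℝ →L[ℝ] ℝ) := Matrix.of fun m n => D m n • ContinuousLinearMap.id ℝ ℝ with hK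
  have hKpsd : K.PosSemidef := by
    have h := (RKHS.posSemidef_tfae (K := K)).out 0 2
    refine h.2 ⟨?_, fun vv => ?_⟩
    · ext m n
      have hid : star (ContinuousLinearMap.id ℝ ℝ) = ContinuousLinearMap.id ℝ ℝ :=
        ContinuousLinearMap.adjoint_id
      simp [hK, hsymm m n, hid]
    · refine (hpsd vv.support vv).trans_eq ?_
      simp only [Finsupp.sum, RCLike.re_to_real]
      refine Finset.sum_congr rfl fun m _ => Finset.sum_congr rfl fun n _ => ?_
      simp [hK, hsymm n m]
      ring
  have : Fact K.PosSemidef := ⟨hKpsd⟩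
  set f : ℕ → RKHS.OfKernel K := fun n => RKHS.kerFun (RKHS.OfKernel K) n (1 : ℝ) with hf
  have hinner : ∀ m n, inner ℝ (f m) (f n) = D m n := by
    intro m n
    rw [hf, ← RKHS.kernel_inner, RKHS.OfKernel.kernel_ofKernel]
    simp [hK, hsymm n m]
  set g := InnerProductSpace.gramSchmidt ℝ f with hg
  set a : ℕ → ℕ → ℝ := fun n i => if i = n then 1 else inner ℝ (g i) (f n) / ‖g i‖ ^ 2 with ha
  have hfg : ∀ n, f n = ∑ i ∈ Finset.range (n + 1), a n i • g i := by
    intro n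
    rw [Finset.sum_range_succ, InnerProductSpace.gramSchmidt_def'' ℝ f n, add_comm]
    congr 1
    · rw [Nat.Iio_eq_range]
      refine Finset.sum_congr rfl fun i hi => ?_
      simp [ha, (Finset.mem_range.1 hi).ne, hg]
    · simp [ha, hg]
  -- The `g i` are not normalized, and some may vanish if `D` is degenerate; their coefficients are
  -- then zero.
  refine ⟨fun n i => a n i * ‖g i‖, fun m n => ?_⟩
  rw [← hinner, hfg m, hfg n, sum_inner]
  refine Finset.sum_congr rfl fun i _ => ?_
  rw [inner_sum]
  refine Finset.sum_congr rfl fun j _ => ?_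
  rw [real_inner_smul_left, real_inner_smul_right]
  split_ifs with hij
  · subst hij
    rw [real_inner_self_eq_norm_sq]
    ring
  · rw [hg, InnerProductSpace.gramSchmidt_orthogonal ℝ f hij]
    ring

/-- Existence of a centered Gaussian sequence with a given covariance. -/
theorem exists_gaussianProcess {D : ℕ → ℕ → ℝ} (hsymm : ∀ m n, D m n = D n m)
    (hpsd : ∀ (s : Finset ℕ) (t : ℕ → ℝ), 0 ≤ ∑ m ∈ s, ∑ n ∈ s, t m * t n * D m n) :
    ∃ (Q : Measure (ℕ → ℝ)) (_ : IsProbabilityMeasure Q) (X : ℕ → (ℕ → ℝ) → ℝ),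
      (∀ n, Measurable (X n)) ∧ IsGaussianProcess X Q ∧ (∀ n, ∫ ω, X n ω ∂Q = 0) ∧
      ∀ m n, ∫ ω, X m ω * X n ω ∂Q = D m n := by
  obtain ⟨c, hc⟩ := exists_lower_triangular_factor hsymm hpsd
  set Q : Measure (ℕ → ℝ) := Measure.infinitePi fun _ => gaussianReal 0 1 with hQ
  have hlaw : ∀ i, MeasurePreserving (fun ω : ℕ → ℝ => ω i) Q (gaussianReal 0 1) := fun i =>
    measurePreserving_eval_infinitePi _ i
  have hindep : iIndepFun (fun (i : ℕ) (ω : ℕ → ℝ) => ω i) Q :=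
    iIndepFun_infinitePi (X := fun _ x => x) fun _ => measurable_id
  have hgauss : ∀ i, HasGaussianLaw (fun ω : ℕ → ℝ => ω i) Q := fun i =>
    ⟨by rw [(hlaw i).map_eq]; infer_instance⟩
  have hproc : IsGaussianProcess (fun (i : ℕ) (ω : ℕ → ℝ) => ω i) Q := by
    refine ⟨fun I => ?_⟩
    exact iIndepFun.hasGaussianLaw (X := fun (i : I) (ω : ℕ → ℝ) => ω i) (fun i => hgauss i)
      (hindep.precomp Subtype.val_injective)
  have hmean : ∀ i, ∫ ω, ω i ∂Q = 0 := by
    intro i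
    have h := integral_map (hlaw i).aemeasurable (f := fun x : ℝ => x) (by fun_prop)
    rw [(hlaw i).map_eq, integral_id_gaussianReal] at h
    exact h.symm
  have hL2 : ∀ i, MemLp (fun ω : ℕ → ℝ => ω i) 2 Q := fun i => (hgauss i).memLp_two
  have hcov : ∀ i j, ∫ ω, ω i * ω j ∂Q = if i = j then 1 else 0 := by
    intro i j
    split_ifs with hij
    · subst hij
      have h := integral_map (hlaw i).aemeasurable (f := fun x : ℝ => x ^ 2) (by fun_prop)
      have h2 := variance_fun_id_gaussianReal (μ := 0) (v := 1)
      rw [variance_of_integral_eq_zero (by fun_prop) integral_id_gaussianReal] at h2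
      rw [(hlaw i).map_eq, h2] at h
      simpa [sq] using h.symm
    · have := (hindep.indepFun hij).integral_mul_eq_mul_integral (hL2 i).aestronglyMeasurable
        (hL2 j).aestronglyMeasurable
      simp only [hmean, mul_zero] at this
      exact this
  refine ⟨Q, inferInstance, fun n ω => ∑ j ∈ Finset.range (n + 1), c n j * ω j,
    fun n => by fun_prop, ?_, fun n => ?_, fun m n => ?_⟩
  · refine hproc.of_isGaussianProcess fun n => ⟨Finset.range (n + 1),
      ∑ j : Finset.range (n + 1), c n j • ContinuousLinearMap.proj j, fun ω => ?_⟩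
    simp [← Finset.sum_coe_sort (Finset.range (n + 1))]
  · rw [integral_finsetSum _ fun j _ => ((hL2 j).integrable one_le_two).const_mul _]
    simp [integral_const_mul, hmean]
  · rw [hc]
    simp_rw [Finset.sum_mul_sum]
    have hint : ∀ i j, Integrable (fun ω : ℕ → ℝ => c m i * ω i * (c n j * ω j)) Q := fun i j =>
      ((hL2 i).const_mul _).integrable_mul ((hL2 j).const_mul _)
    rw [integral_finsetSum _ fun i _ => integrable_finsetSum _ fun j _ => hint i j]
    refine Finset.sum_congr rfl fun i _ => ?_
    rw [integral_finsetSum _ fun j _ => hint i j]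
    refine Finset.sum_congr rfl fun j _ => ?_
    rw [← hcov, ← integral_const_mul]
    exact integral_congr_ae (ae_of_all _ fun ω => by ring)

end GaussianSequence

/-! ### The limiting sequence and convergence in distribution -/

section Main

variable {Ω : Type*} [MeasurableSpace Ω] {P : Measure Ω} {ξ : Sym2 ℕ+ → Ω → ℝ}

lemma IsWignerFamily.limitCov_comm [IsProbabilityMeasure P] (hξ : IsWignerFamily ξ P) {k l : ℕ}
    (hk : 2 ≤ k) (hl : 2 ≤ l) : limitCov ξ P k l = limitCov ξ P l k := by
  refine tendsto_nhds_unique (hξ.tendsto_integral_Y_mul_Y hk hl) ?_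
  simpa only [mul_comm] using hξ.tendsto_integral_Y_mul_Y hl hk

lemma IsWignerFamily.sum_limitCov_nonneg [IsProbabilityMeasure P] (hξ : IsWignerFamily ξ P)
    {s : Finset ℕ} (hs : ∀ k ∈ s, 2 ≤ k) (t : ℕ → ℝ) :
    0 ≤ ∑ k ∈ s, ∑ l ∈ s, t k * t l * limitCov ξ P k l :=
  ge_of_tendsto' (hξ.tendsto_integral_combY_sq hs t)
    fun _ => integral_nonneg fun _ => sq_nonneg _

theorem IsWignerFamily.exists_gaussianSeq [IsProbabilityMeasure P] (hξ : IsWignerFamily ξ P) :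
    ∃ (Ω₀ : Type) (_ : MeasurableSpace Ω₀) (Q : Measure Ω₀) (_ : IsProbabilityMeasure Q)
      (η : Set.Ici (2 : ℕ) → Ω₀ → ℝ), (∀ k, Measurable (η k)) ∧
        IsCenteredGaussianSeq η Q (limitCov ξ P) := by
  obtain ⟨Q, hQ, X, hX, hG, hm, hc⟩ := exists_gaussianProcess
    (D := fun m n => limitCov ξ P (m + 2) (n + 2)) (fun m n => hξ.limitCov_comm (by simp) (by simp))
    (fun s t => by
      have := hξ.sum_limitCov_nonneg (s := s.map (addRightEmbedding 2))
        (fun k hk => by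
          obtain ⟨m, -, rfl⟩ := Finset.mem_map.1 hk
          simp) (fun k => t (k - 2))
      simpa [Finset.sum_map] using this)
  refine ⟨ℕ → ℝ, inferInstance, Q, hQ, fun k => X (k - 2), fun k => hX _,
    hG.comp_right fun k : Set.Ici (2 : ℕ) => (k : ℕ) - 2, fun k => hm _, fun k l => ?_⟩
  rw [hc, Nat.sub_add_cancel k.2, Nat.sub_add_cancel l.2]

theorem IsWignerFamily.tendstoInDistribution_Y [IsProbabilityMeasure P] (hξ : IsWignerFamily ξ P)
    {Ω₀ : Type*} [MeasurableSpace Ω₀] {Q : Measure Ω₀} [IsProbabilityMeasure Q]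
    {η : Set.Ici (2 : ℕ) → Ω₀ → ℝ} (hη : ∀ k, Measurable (η k))
    (hG : IsCenteredGaussianSeq η Q (limitCov ξ P)) (K : ℕ) :
    TendstoInDistribution
      (fun (N : ℕ) (ω : Ω) (k : Set.Icc (2 : ℕ) K) => Y ξ P N k ω) atTop
      (fun (ω : Ω₀) (k : Set.Icc (2 : ℕ) K) => η ⟨k, k.2.1⟩ ω) (fun _ => P) Q := by
  have hYm : ∀ N k, Measurable (Y ξ P N k) := fun N k => measurable_Y hξ N k
  -- Characteristic functions need an inner product, so convergence is proved in Euclidean space and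
  -- transported back. For each `t` it reduces to the linear combination `combY` with coefficients
  -- `t`.
  set Yv : ℕ → Ω → EuclideanSpace ℝ (Set.Icc (2 : ℕ) K) := fun N ω =>
    WithLp.toLp 2 fun k : Set.Icc (2 : ℕ) K => Y ξ P N k ω with hYv
  set ηv : Ω₀ → EuclideanSpace ℝ (Set.Icc (2 : ℕ) K) := fun ω =>
    WithLp.toLp 2 fun k : Set.Icc (2 : ℕ) K => η ⟨k, k.2.1⟩ ω with hηv
  have hYvm : ∀ N, Measurable (Yv N) := fun N =>
    (WithLp.measurable_toLp 2 _).comp (measurable_pi_lambda _ fun k => hYm N k)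
  have hηvm : Measurable ηv :=
    (WithLp.measurable_toLp 2 _).comp (measurable_pi_lambda _ fun k => hη _)
  suffices h : TendstoInDistribution Yv atTop ηv (fun _ => P) Q from
    h.continuous_comp (PiLp.continuous_ofLp 2 fun _ : Set.Icc (2 : ℕ) K => ℝ)
  refine ⟨fun N => (hYvm N).aemeasurable, hηvm.aemeasurable,
    ProbabilityMeasure.tendsto_iff_tendsto_charFun.2 fun t => ?_⟩
  set t' : ℕ → ℝ := fun k => if h : k ∈ Set.Icc 2 K then t ⟨k, h⟩ else 0 with ht'
  have hsum : ∀ F : ℕ → ℝ, ∑ k : Set.Icc (2 : ℕ) K, t k * F k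
      = ∑ k ∈ Finset.Icc 2 K, t' k * F k := by
    intro F
    rw [← Finset.sum_coe_sort (Finset.Icc 2 K)]
    refine Fintype.sum_equiv (Equiv.subtypeEquivRight fun k => by simp) _ _ fun k => ?_
    simp [ht', k.2.1, k.2.2]
  have hG' : HasGaussianLaw ηv Q := by
    have h1 : IsGaussianProcess (fun k : Set.Icc (2 : ℕ) K => η ⟨k, k.2.1⟩) Q :=
      hG.gaussian.comp_right fun k : Set.Icc (2 : ℕ) K => (⟨k, k.2.1⟩ : Set.Ici (2 : ℕ))
    have h2 := (h1.hasGaussianLaw Finset.univ).map_fun (ContinuousLinearMap.pi fun k =>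
      ContinuousLinearMap.proj (R := ℝ) (φ := fun _ => ℝ)
        (⟨k, Finset.mem_univ k⟩ : (Finset.univ : Finset (Set.Icc (2 : ℕ) K))))
    exact HasGaussianLaw.toLp_pi 2 h2
  have hηL : ∀ k : Set.Icc (2 : ℕ) K, MemLp (η ⟨k, k.2.1⟩) 2 Q := fun k =>
    (hG.gaussian.hasGaussianLaw_eval _).memLp_two
  have hinner : ∀ ω, inner ℝ t (ηv ω) = ∑ k : Set.Icc (2 : ℕ) K, t k * η ⟨k, k.2.1⟩ ω := by
    intro ω
    rw [PiLp.inner_apply]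
    exact Finset.sum_congr rfl fun k _ => by simp [hηv, mul_comm]
  have hmean : ∫ ω, inner ℝ t (ηv ω) ∂Q = 0 := by
    simp_rw [hinner]
    rw [integral_finsetSum _ fun k _ => ((hηL k).integrable one_le_two).const_mul _]
    simp [integral_const_mul, hG.mean]
  have hvar : Var[fun ω => inner ℝ t (ηv ω); Q]
      = ∑ k ∈ Finset.Icc 2 K, ∑ l ∈ Finset.Icc 2 K, t' k * t' l * limitCov ξ P k l := by
    rw [variance_of_integral_eq_zero (by fun_prop) hmean]
    have hint : ∀ k l : Set.Icc (2 : ℕ) K, Integrable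
        (fun ω => t k * η ⟨k, k.2.1⟩ ω * (t l * η ⟨l, l.2.1⟩ ω)) Q := fun k l =>
      ((hηL k).const_mul _).integrable_mul ((hηL l).const_mul _)
    simp_rw [hinner, sq, Finset.sum_mul_sum]
    rw [integral_finsetSum _ fun k _ => integrable_finsetSum _ fun l _ => hint k l]
    have h1 : ∀ k : Set.Icc (2 : ℕ) K,
        ∫ ω, ∑ l : Set.Icc (2 : ℕ) K, t k * η ⟨k, k.2.1⟩ ω * (t l * η ⟨l, l.2.1⟩ ω) ∂Q
          = t k * ∑ l ∈ Finset.Icc 2 K, t' l * limitCov ξ P k l := by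
      intro k
      rw [← hsum, integral_finsetSum _ fun l _ => hint k l, Finset.mul_sum]
      refine Finset.sum_congr rfl fun l _ => ?_
      rw [← hG.cov ⟨k, k.2.1⟩ ⟨l, l.2.1⟩, ← integral_const_mul, ← integral_const_mul]
      exact integral_congr_ae (ae_of_all _ fun ω => by ring)
    simp_rw [h1]
    rw [hsum fun k => ∑ l ∈ Finset.Icc 2 K, t' l * limitCov ξ P k l]
    simp_rw [Finset.mul_sum, mul_assoc]
  have hlim : charFun (Q.map ηv) t = Complex.exp ((-(∑ k ∈ Finset.Icc 2 K,
      ∑ l ∈ Finset.Icc 2 K, t' k * t' l * limitCov ξ P k l) / 2 : ℝ) : ℂ) := by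
    rw [hG'.charFun_map_eq, hmean, hvar]
    congr 1
    push_cast
    ring
  have hN : ∀ N, charFun (P.map (Yv N)) t
      = ∫ ω, Complex.exp (Complex.I * combY ξ P (Finset.Icc 2 K) t' N ω) ∂P := by
    intro N
    rw [charFun_apply, integral_map (hYvm N).aemeasurable (by fun_prop)]
    refine integral_congr_ae (ae_of_all _ fun ω => ?_)
    have h1 : inner ℝ (Yv N ω) t = combY ξ P (Finset.Icc 2 K) t' N ω := by
      rw [combY, ← hsum, PiLp.inner_apply]
      exact Finset.sum_congr rfl fun k _ => by simp [hYv]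
    simp only [h1, mul_comm]
  simp only [ProbabilityMeasure.coe_mk, hN, hlim]
  exact tendsto_integral_exp_I_mul_of_moments (fun N => hξ.hasAllMoments_combY _ _ N)
    fun n => hξ.tendsto_integral_combY_pow (fun k hk => (Finset.mem_Icc.1 hk).1) t' n

end Main

end

theorem mainTheorem2 {Ω : Type*} [MeasurableSpace Ω] (P : Measure Ω) [IsProbabilityMeasure P]
    (ξ : Sym2 ℕ+ → Ω → ℝ) (hξ : IsWignerFamily ξ P) :
    -- the summands of `limitCov` do not depend on the representatives of the equivalence classes
    (∀ k l : ℕ, 2 ≤ k → 2 ≤ l → ∀ a ∈ cltPairs k l, ∀ b ∈ cltPairs k l, a.Equivalent b →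
      pairExpectation ξ P a = pairExpectation ξ P b) ∧
    -- the covariance vanishes when `k + l` is odd
    (∀ k l : ℕ, 2 ≤ k → 2 ≤ l → Odd (k + l) → limitCov ξ P k l = 0) ∧
    -- the covariance depends only on the second and fourth moments of `ξ₁₂`
    (∀ (Ω' : Type*) [MeasurableSpace Ω'] (P' : Measure Ω') [IsProbabilityMeasure P']
      (ξ' : Sym2 ℕ+ → Ω' → ℝ), IsWignerFamily ξ' P' →
      ∫ ω, ξ' s(1, 2) ω ^ 2 ∂P' = ∫ ω, ξ s(1, 2) ω ^ 2 ∂P →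
      ∫ ω, ξ' s(1, 2) ω ^ 4 ∂P' = ∫ ω, ξ s(1, 2) ω ^ 4 ∂P →
      ∀ k l : ℕ, 2 ≤ k → 2 ≤ l → limitCov ξ' P' k l = limitCov ξ P k l) ∧
    -- existence of the limiting Gaussian sequence, and joint convergence in distribution
    (∃ (Ω₀ : Type) (_ : MeasurableSpace Ω₀) (Q : Measure Ω₀) (_ : IsProbabilityMeasure Q)
      (η : Set.Ici (2 : ℕ) → Ω₀ → ℝ), IsCenteredGaussianSeq η Q (limitCov ξ P) ∧
      ∀ K : ℕ, 2 ≤ K →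
        TendstoInDistribution
          (fun (N : ℕ) (ω : Ω) (k : Set.Icc (2 : ℕ) K) => Y ξ P N k ω) atTop
          (fun (ω : Ω₀) (k : Set.Icc (2 : ℕ) K) => η ⟨k, k.2.1⟩ ω) (fun _ => P) Q) := by
  refine ⟨fun k l _ _ a ha b hb h => ?_, fun k l _ _ h => limitCov_eq_zero_of_odd h,
    fun Ω' _ P' _ ξ' hξ' h2 h4 k l _ _ => hξ.limitCov_congr hξ' h2 h4, ?_⟩
  · obtain ⟨ha1, ha2⟩ := (mem_cltPairs.1 ha).1
    obtain ⟨hb1, hb2⟩ := (mem_cltPairs.1 hb).1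
    exact hξ.pairExpectation_eq_of_equivalent (mem_noSelfEdgeWords.1 ha1).2
      (mem_noSelfEdgeWords.1 ha2).2 (mem_noSelfEdgeWords.1 hb1).2 (mem_noSelfEdgeWords.1 hb2).2 h
  · obtain ⟨Ω₀, _, Q, _, η, hη, hG⟩ := hξ.exists_gaussianSeq
    exact ⟨Ω₀, inferInstance, Q, inferInstance, η, hG, fun K _ =>
      hξ.tendstoInDistribution_Y hη hG K⟩
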